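/- Let $\langle D\rangle_m=(m^2-\Delta)^{1/2}$ on $\mathbb R^3$, $\langle D\rangle=\langle D\rangle_1$, $\langle\tau\rangle=(1+\tau^2)^{1/2}$, $\Box=-\partial_t^2+\Delta$, and for real $s$ let $\|f\|_{W^{s,p}}=\|\langle D\rangle^s f\|_{L^p(\mathbb R^3)}$, $H^s=W^{s,2}$; norms of $xf=(x_1f,x_2f,x_3f)$ are those of a vector-valued function, $\|xf\|_{H^s}^2=\sum_j\|x_jf\|_{H^s}^2$. Consider, for real-valued $U,V$ on $I\times\mathbb R^3$, the system $$(\Box-1)U=UV-\tfrac12U^3,\qquad (\Box-M^2)V=U^2V-\tfrac12U^4+\partial U\cdot\partial U,\qquad \partial U\cdot\partial U=-(\partial_tU)^2+|\nabla U|^2,\qquad(\ast)$$ and put $u=(\partial_t+i\langle D\rangle)U$, $v=(\partial_t+i\langle D\rangle_M)V$, $l=e^{-it\langle D\rangle}u$, $h=e^{-it\langle D\rangle_M}v$. (Since $U,V$ are real, the complex-valued data $u(0),v(0)$ carry the same information as $U,\partial_tU,V,\partial_tV$ at $t=0$.) With $\delta=1/14$ and $p=(\tfrac16-\delta)^{-1}$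 let, with suprema over $t\in I$, $$\begin{aligned}\|(u,v)\|_{X(I)}={}&\sup_t\langle t\rangle^{1+3\delta}\|u(t)\|_{W^{k,p}}+\sup_t\langle t/M\rangle^{1+3\delta}\sqrt M\,\|v(t)\|_{W^{k,p}}\\&+\sup_t\|xl(t)\|_{H^{k+3/2}}+\sqrt M\sup_t\|xh(t)\|_{H^{k+3/2}}+\sup_t\|u(t)\|_{H^N}+\sqrt M\sup_t\|v(t)\|_{H^N}.\end{aligned}$$ **Theorem (Local existence).** Let $k\ge0$ and $N>k+6$ be real numbers and $E>0$. There is $M_0>0$, depending only on $N,k,E$, such that for every $M\ge M_0$ and all complex-valued $u_0,v_0$ on $\mathbb R^3$ (tempered distributions) with $$\|u_0\|_{H^N}+M\|v_0\|_{H^N}+\|xu_0\|_{H^{k+3/2}}+M\|xv_0\|_{H^{k+3/2}}<\frac EM$$ there exist an interval $I\supseteq[0,1]$ and a classical ($C^2$) real-valued solution $(U,V)$ of $(\ast)$ on $I\times\mathbb R^3$, with $U(t),\partial_tU(t),V(t),\partial_tV(t)\in L^2(\mathbb R^3)$ for $t\in I$, such that $u(0)=u_0$, $v(0)=v_0$ and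 $$\|(u,v)\|_{X(I)}<\frac{2E}{M}.$$ -/

import Mathlib

open MeasureTheory Set
open scoped SchwartzMap ENNReal

namespace KleinGordonEFT

noncomputable section

/-- Physical space `ℝ³`. -/
abbrev E3 : Type := EuclideanSpace ℝ (Fin 3)

/-! ### Fourier multipliers

Mathlib's Fourier transform uses the character `exp (-2πi x·ξ)`, so the frequency variable dual to
`x` with respect to `exp (-i x·ρ)` is `ρ = 2πξ`. -/

/-- The symbol `⟨ρ⟩_m = (m² + |ρ|²)^{1/2}` of `⟨D⟩_m`, at `ρ = 2πξ`. -/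
def bracket (m : ℝ) (ξ : E3) : ℝ := Real.sqrt (m ^ 2 + (2 * Real.pi * ‖ξ‖) ^ 2)

/-- The Japanese bracket `⟨τ⟩ = (1 + τ²)^{1/2}` of a real number. -/
def jap (τ : ℝ) : ℝ := Real.sqrt (1 + τ ^ 2)

/-- `⟨D⟩^s T`, where `⟨D⟩ = (1 - Δ)^{1/2}`. -/
def besselOp (s : ℝ) (T : 𝓢'(E3, ℂ)) : 𝓢'(E3, ℂ) :=
  TemperedDistribution.fourierMultiplierCLM ℂ (fun ξ : E3 => ((bracket 1 ξ ^ s : ℝ) : ℂ)) T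

/-- `⟨D⟩_m T`, where `⟨D⟩_m = (m² - Δ)^{1/2}`. -/
def dispOp (m : ℝ) (T : 𝓢'(E3, ℂ)) : 𝓢'(E3, ℂ) :=
  TemperedDistribution.fourierMultiplierCLM ℂ (fun ξ : E3 => ((bracket m ξ : ℝ) : ℂ)) T

/-- `e^{i t ⟨D⟩_m} T`. -/
def propagator (m t : ℝ) (T : 𝓢'(E3, ℂ)) : 𝓢'(E3, ℂ) :=
  TemperedDistribution.fourierMultiplierCLM ℂ
    (fun ξ : E3 => Complex.exp (((t * bracket m ξ : ℝ) : ℂ) * Complex.I)) T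

/-- The product `x_j T` of a tempered distribution with the `j`-th coordinate function. -/
def coordMul (j : Fin 3) (T : 𝓢'(E3, ℂ)) : 𝓢'(E3, ℂ) :=
  TemperedDistribution.smulLeftCLM ℂ (fun x : E3 => ((x j : ℝ) : ℂ)) T

/-! The symbols above are of temperate growth, so Mathlib's multiplier operators with these symbols
are the genuine ones. -/

lemma hasTemperateGrowth_bracket_rpow {m : ℝ} (hm : 0 < m) (s : ℝ) :
    (fun ξ : E3 => bracket m ξ ^ s).HasTemperateGrowth := by
  have h1 := (Function.hasTemperateGrowth_one_add_norm_sq_rpow (H := E3) (s / 2)).comp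
    (((2 * Real.pi / m) • ContinuousLinearMap.id ℝ E3).hasTemperateGrowth)
  have h2 := (Function.HasTemperateGrowth.const (E := E3) (m ^ s)).mul h1
  refine (congrArg Function.HasTemperateGrowth (?_ :
    (fun ξ : E3 => bracket m ξ ^ s) = _)).mpr h2
  funext ξ
  have e : m ^ 2 + (2 * Real.pi * ‖ξ‖) ^ 2
      = m ^ 2 * (1 + ‖(2 * Real.pi / m) • ξ‖ ^ 2) := by
    rw [norm_smul, Real.norm_eq_abs]
    simp only [mul_pow, sq_abs]
    field_simp
  simp only [bracket, Pi.mul_apply, Function.comp, smul_apply,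
    ContinuousLinearMap.id_apply]
  rw [e, Real.sqrt_mul (by positivity), Real.sqrt_sq hm.le,
    Real.mul_rpow hm.le (Real.sqrt_nonneg _), Real.sqrt_eq_rpow, ← Real.rpow_mul (by positivity)]
  congr 2
  ring

lemma hasTemperateGrowth_bracket {m : ℝ} (hm : 0 < m) :
    (fun ξ : E3 => bracket m ξ).HasTemperateGrowth := by
  simpa using hasTemperateGrowth_bracket_rpow hm 1

lemma hasTemperateGrowth_exp_bracket {m : ℝ} (hm : 0 < m) (t : ℝ) :
    (fun ξ : E3 =>
      Complex.exp (((t * bracket m ξ : ℝ) : ℂ) * Complex.I)).HasTemperateGrowth := by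
  have h1 : (fun τ : ℝ => Complex.exp (((t * τ : ℝ) : ℂ) * Complex.I)).HasTemperateGrowth := by
    have key : ∀ n : ℕ, iteratedDeriv n
        (fun τ : ℝ => Complex.exp (((t * τ : ℝ) : ℂ) * Complex.I))
        = fun τ : ℝ => ((t : ℂ) * Complex.I) ^ n
            * Complex.exp (((t * τ : ℝ) : ℂ) * Complex.I) := by
      intro n
      induction n with
      | zero => simp
      | succ n ih =>
        rw [iteratedDeriv_succ, ih]
        funext τ
        have h : HasDerivAt (fun τ : ℝ => ((t * τ : ℝ) : ℂ) * Complex.I)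
            ((t : ℂ) * Complex.I) τ := by
          simpa using (((hasDerivAt_id τ).const_mul t).ofReal_comp).mul_const Complex.I
        rw [(h.cexp.const_mul _).deriv]
        ring
    refine ⟨?_, fun n => ⟨0, |t| ^ n, fun τ => ?_⟩⟩
    · exact (((Complex.ofRealCLM.contDiff.comp (contDiff_const.mul contDiff_id)).mul
        contDiff_const).cexp : _)
    · rw [norm_iteratedFDeriv_eq_norm_iteratedDeriv, key n]
      simp [Complex.norm_exp_ofReal_mul_I, -Complex.ofReal_mul]
  exact h1.comp (hasTemperateGrowth_bracket hm)

/-! ### Norms -/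

/-- The tempered distribution `T` is (integration against) the function `f ∈ L^p`. -/
def IsLpFunction (p : ℝ≥0∞) (T : 𝓢'(E3, ℂ)) (f : E3 → ℂ) : Prop :=
  MemLp f p volume ∧ ∀ φ : 𝓢(E3, ℂ), T φ = ∫ x, φ x * f x

/-- The norm of `W^{s,p}(ℝ³)` for real `s`, that is `‖⟨D⟩^s T‖_{L^p}`; it is `∞` if `⟨D⟩^s T` is not
in `L^p`. The set below has, up to almost everywhere equality, at most one element. -/
def sobolevNorm (s : ℝ) (p : ℝ≥0∞) (T : 𝓢'(E3, ℂ)) : ℝ≥0∞ :=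
  ⨅ f ∈ {f : E3 → ℂ | IsLpFunction p (besselOp s T) f}, eLpNorm f p volume

/-- The norm `‖x T‖_{H^s}` of the vector-valued distribution `x T = (x₁ T, x₂ T, x₃ T)`. -/
def weightedNorm (s : ℝ) (T : 𝓢'(E3, ℂ)) : ℝ≥0∞ :=
  (∑ j : Fin 3, sobolevNorm s 2 (coordMul j T) ^ 2) ^ (1 / 2 : ℝ)

/-- The weighted norm of the initial data,
`‖u₀‖_{H^N} + M ‖v₀‖_{H^N} + ‖x u₀‖_{H^{k+3/2}} + M ‖x v₀‖_{H^{k+3/2}}`. -/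
def dataNorm (N k M : ℝ) (u₀ v₀ : 𝓢'(E3, ℂ)) : ℝ≥0∞ :=
  sobolevNorm N 2 u₀ + ENNReal.ofReal M * sobolevNorm N 2 v₀
    + weightedNorm (k + 3 / 2) u₀ + ENNReal.ofReal M * weightedNorm (k + 3 / 2) v₀

/-- The parameter `δ` of the decay norm. -/
def delta : ℝ := 1 / 14

/-- The Lebesgue exponent `p = (1/6 - δ)^{-1}` of the decay norm. -/
def decayExponent : ℝ≥0∞ := ENNReal.ofReal ((1 / 6 - delta)⁻¹)

/-- The decay norm. Here and below the supremum is over all times in `I`. -/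
def ZNorm (k M : ℝ) (I : Set ℝ) (u v : ℝ → 𝓢'(E3, ℂ)) : ℝ≥0∞ :=
  (⨆ t ∈ I, ENNReal.ofReal (jap t ^ (1 + 3 * delta)) * sobolevNorm k decayExponent (u t))
    + ⨆ t ∈ I, ENNReal.ofReal (jap (t / M) ^ (1 + 3 * delta) * Real.sqrt M)
        * sobolevNorm k decayExponent (v t)

/-- The weighted norm of the profiles `l = e^{-it⟨D⟩} u` and `h = e^{-it⟨D⟩_M} v`. -/
def SNorm (k M : ℝ) (I : Set ℝ) (u v : ℝ → 𝓢'(E3, ℂ)) : ℝ≥0∞ :=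
  (⨆ t ∈ I, weightedNorm (k + 3 / 2) (propagator 1 (-t) (u t)))
    + ENNReal.ofReal (Real.sqrt M)
        * ⨆ t ∈ I, weightedNorm (k + 3 / 2) (propagator M (-t) (v t))

/-- The energy norm. -/
def NNorm (N M : ℝ) (I : Set ℝ) (u v : ℝ → 𝓢'(E3, ℂ)) : ℝ≥0∞ :=
  (⨆ t ∈ I, sobolevNorm N 2 (u t))
    + ENNReal.ofReal (Real.sqrt M) * ⨆ t ∈ I, sobolevNorm N 2 (v t)

/-- The norm `‖(u,v)‖_{X(I)}`. -/
def XNorm (N k M : ℝ) (I : Set ℝ) (u v : ℝ → 𝓢'(E3, ℂ)) : ℝ≥0∞ :=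
  ZNorm k M I u v + SNorm k M I u v + NNorm N M I u v

/-! ### The system -/

/-- The time derivative `∂_t U (t,x)`, one-sided at an endpoint of `I` belonging to `I`. -/
def timeDeriv (I : Set ℝ) (U : ℝ → E3 → ℝ) (t : ℝ) (x : E3) : ℝ :=
  derivWithin (fun s => U s x) I t

/-- `□ U = -∂_t² U + Δ U`. -/
def box (I : Set ℝ) (U : ℝ → E3 → ℝ) (t : ℝ) (x : E3) : ℝ :=
  -derivWithin (fun s => timeDeriv I U s x) I t + Laplacian.laplacian (U t) x

/-- `∂U · ∂U = -(∂_t U)² + |∇U|²`. -/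
def nullForm (I : Set ℝ) (U : ℝ → E3 → ℝ) (t : ℝ) (x : E3) : ℝ :=
  -(timeDeriv I U t x) ^ 2 + ‖gradient (U t) x‖ ^ 2

/-- `(U,V)` is a classical (`C²`) solution on `I × ℝ³` of
`(□ - 1) U = U V - U³/2`, `(□ - M²) V = U² V - U⁴/2 + ∂U·∂U`. -/
structure IsSolution (M : ℝ) (I : Set ℝ) (U V : ℝ → E3 → ℝ) : Prop where
  contDiffOn_light : ContDiffOn ℝ 2 (fun z : ℝ × E3 => U z.1 z.2) (I ×ˢ univ)
  contDiffOn_heavy : ContDiffOn ℝ 2 (fun z : ℝ × E3 => V z.1 z.2) (I ×ˢ univ)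
  light : ∀ t ∈ I, ∀ x : E3, box I U t x - U t x = U t x * V t x - U t x ^ 3 / 2
  heavy : ∀ t ∈ I, ∀ x : E3, box I V t x - M ^ 2 * V t x
    = U t x ^ 2 * V t x - U t x ^ 4 / 2 + nullForm I U t x

/-- `u = (∂_t + i⟨D⟩_m) U` on `I`, where `U(t)` and `∂_t U(t)` are in `L²(ℝ³)`. -/
def IsHalfWave (m : ℝ) (I : Set ℝ) (U : ℝ → E3 → ℝ) (u : ℝ → 𝓢'(E3, ℂ)) : Prop :=
  ∀ t ∈ I, ∃ S T : 𝓢'(E3, ℂ),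
    IsLpFunction 2 S (fun x => ((timeDeriv I U t x : ℝ) : ℂ)) ∧
    IsLpFunction 2 T (fun x => ((U t x : ℝ) : ℂ)) ∧
    u t = S + Complex.I • dispOp m T

end

end KleinGordonEFT

open KleinGordonEFT

/-! The fields and their first derivatives are recovered from the half waves by operators of order
at most zero: `U = ⟨D⟩⁻¹ Im u`, `V = ⟨D⟩_M⁻¹ Im v`, `∂_t U = Re u`, `∂_j U = ∂_j ⟨D⟩⁻¹ Im u`. The
nonlinearity therefore loses no derivatives. Passing to the profiles `l = e^{-it⟨D⟩} u`, `h =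
e^{-it⟨D⟩_M} v` also removes the unbounded generators. What is left is an ordinary differential
equation with a locally Lipschitz field in a Banach space, and the interval is simply `I = [0,1]`.
No dispersion is used.

The Banach space `WSpace N s`, with `s = k + 3/2`, records `⟨ξ⟩^N û` and `⟨ξ⟩^s (x_j u)^` in `L²`. A
Fourier multiplier acts on it when its symbol and the gradient of the symbol are bounded, because
the commutator of `x_j` and `σ(D)` is the multiplier of a derivative of `σ` (`multAmb_mem`,
`norm_multY_le`). The propagator thus has norm at most `1 + |t|`, uniformly in the mass. Products
act because `x_j (fg) = (x_j f) g`, while `H^N · H^N ⊆ H^N` and `H^N · H^s ⊆ H^s` follow from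
Young's inequality on the Fourier side (`lintegral_sq_wconvFun_le`, `prod_mem`).

The unknowns are `u` and `w = √M v`. On a ball of radius `R ≤ 1` the source is at most `C √M R²`
(`norm_sourceY_le`). With `R` of order `E/M` the profile moves during unit time by `O(M^{-3/2})`,
which for large `M` is below one hundredth of `E/M`; this is the Picard–Lindelöf argument
`exists_profile`.

The factor 2 in the conclusion needs explicit constants. The `H^N` norm enters the energy norm with
constant 1 and the decay norm with the Sobolev constant times the time weight. That product is at
most `9/10` (`integral_bracket_neg_twelve_le`, `sobolevNorm_decay_distY_le`, `jap_mul_le`). The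
weighted norm enters once. `XNorm_le` sums this up: at most `19/10` of the data plus a small
multiple of the drift.

For classical regularity, a field is the pairing of the `L²`-valued kernel `e^{i(t⟨ξ⟩_m + 2πx·ξ)}
ω(ξ)`, differentiable in `(t,x)` when `ω` decays (`hasFDerivAt_kern`), with a profile that is `C¹`
in time. In `∂_t U` the Duhamel term is the imaginary part of a real function and disappears; one
time derivative later it produces the source (`Duhamel.jet_field`, `Duhamel.box_field`). The passage
between `WSpace` and tempered distributions is `mem_WSpace_iff` together with `exists_dist_eq`. -/

namespace KleinGordonEFT

noncomputable section

/-! ### The brackets -/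

lemma bracket_sq (m : ℝ) (ξ : E3) : bracket m ξ ^ 2 = m ^ 2 + (2 * Real.pi * ‖ξ‖) ^ 2 :=
  Real.sq_sqrt (by positivity)

lemma bracket_nonneg (m : ℝ) (ξ : E3) : 0 ≤ bracket m ξ := Real.sqrt_nonneg _

lemma le_bracket {m : ℝ} (ξ : E3) : m ≤ bracket m ξ :=
  Real.le_sqrt_of_sq_le (by nlinarith [sq_nonneg (2 * Real.pi * ‖ξ‖)])

lemma norm_le_bracket (m : ℝ) (ξ : E3) : 2 * Real.pi * ‖ξ‖ ≤ bracket m ξ :=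
  Real.le_sqrt_of_sq_le (by nlinarith [sq_nonneg m])

lemma bracket_pos {m : ℝ} (hm : 0 < m) (ξ : E3) : 0 < bracket m ξ := hm.trans_le (le_bracket ξ)

lemma one_le_bracket {m : ℝ} (hm : 1 ≤ m) (ξ : E3) : 1 ≤ bracket m ξ := hm.trans (le_bracket ξ)

lemma bracket_neg (m : ℝ) (ξ : E3) : bracket m (-ξ) = bracket m ξ := by simp [bracket]

lemma bracket_le_mul {m : ℝ} (hm : 1 ≤ m) (ξ : E3) : bracket m ξ ≤ m * bracket 1 ξ := by
  refine Real.sqrt_le_iff.2 ⟨by have := bracket_nonneg 1 ξ; positivity, ?_⟩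
  rw [mul_pow m, bracket_sq]
  nlinarith [mul_nonneg (sub_nonneg.2 (one_le_pow₀ hm (n := 2))) (sq_nonneg (2 * Real.pi * ‖ξ‖))]

lemma continuous_bracket (m : ℝ) : Continuous (bracket m) := by
  unfold bracket; fun_prop

lemma continuous_bracket_rpow (s : ℝ) : Continuous fun ξ : E3 => bracket 1 ξ ^ s :=
  (continuous_bracket 1).rpow_const fun ξ => Or.inl (bracket_pos one_pos ξ).ne'

lemma bracket_add_le (ξ η : E3) : bracket 1 (ξ + η) ≤ bracket 1 ξ + bracket 1 η := by
  refine Real.sqrt_le_iff.2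
    ⟨add_nonneg (bracket_nonneg 1 ξ) (bracket_nonneg 1 η), ?_⟩
  have h1 := mul_le_mul (norm_le_bracket 1 ξ) (norm_le_bracket 1 η) (by positivity)
    (bracket_nonneg 1 ξ)
  have h2 : (2 * Real.pi * ‖ξ + η‖) ^ 2 ≤ (2 * Real.pi * ‖ξ‖ + 2 * Real.pi * ‖η‖) ^ 2 := by
    rw [← mul_add]; gcongr; exact norm_add_le ξ η
  nlinarith [bracket_sq 1 ξ, bracket_sq 1 η]

lemma bracket_rpow_le {r : ℝ} (hr : 0 ≤ r) (ξ η : E3) :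
    bracket 1 (ξ + η) ^ r ≤ 2 ^ r * (bracket 1 ξ ^ r + bracket 1 η ^ r) := by
  have h1 := bracket_nonneg 1 ξ
  have h2 := bracket_nonneg 1 η
  have h3 : bracket 1 (ξ + η) ≤ 2 * max (bracket 1 ξ) (bracket 1 η) := by
    have := bracket_add_le ξ η
    have := le_max_left (bracket 1 ξ) (bracket 1 η)
    have := le_max_right (bracket 1 ξ) (bracket 1 η)
    linarith
  calc bracket 1 (ξ + η) ^ r ≤ (2 * max (bracket 1 ξ) (bracket 1 η)) ^ r :=
        Real.rpow_le_rpow (bracket_nonneg _ _) h3 hr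
    _ = 2 ^ r * max (bracket 1 ξ) (bracket 1 η) ^ r := Real.mul_rpow (by norm_num) (by positivity)
    _ ≤ _ := by
      gcongr
      rcases max_choice (bracket 1 ξ) (bracket 1 η) with h | h <;> rw [h]
      · linarith [Real.rpow_nonneg h2 r]
      · linarith [Real.rpow_nonneg h1 r]

lemma hasFDerivAt_bracket {m : ℝ} (hm : 0 < m) (ξ : E3) :
    HasFDerivAt (bracket m) (((2 * Real.pi) ^ 2 / bracket m ξ) • innerSL ℝ ξ) ξ := by
  have h : HasFDerivAt (fun ξ : E3 => m ^ 2 + (2 * Real.pi * ‖ξ‖) ^ 2)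
      ((2 * Real.pi) ^ 2 • (2 • innerSL ℝ ξ)) ξ := by
    have h1 := ((hasStrictFDerivAt_norm_sq ξ).hasFDerivAt.const_mul ((2 * Real.pi) ^ 2)).const_add
      (m ^ 2)
    simpa only [mul_pow] using h1
  have h2 := h.sqrt (by positivity)
  refine h2.congr_fderiv ?_
  ext v
  simp only [bracket, smul_apply, innerSL_apply_apply, smul_eq_mul, nsmul_eq_mul]
  field_simp
  push_cast
  ring

/-- Group velocities are at most 1 for every mass. The absence of `m` on the right makes the
propagator bounds on the weighted space uniform in `M`. -/
lemma abs_fderiv_bracket_le {m : ℝ} (hm : 0 < m) (ξ v : E3) :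
    |fderiv ℝ (bracket m) ξ v| ≤ 2 * Real.pi * ‖v‖ := by
  rw [(hasFDerivAt_bracket hm ξ).fderiv]
  simp only [smul_apply, innerSL_apply_apply, smul_eq_mul, abs_mul, abs_div,
    abs_of_pos (bracket_pos hm ξ)]
  rw [abs_of_pos (by positivity), div_mul_eq_mul_div, div_le_iff₀ (bracket_pos hm ξ)]
  have h1 := abs_real_inner_le_norm ξ v
  have h2 := norm_le_bracket m ξ
  calc (2 * Real.pi) ^ 2 * |inner ℝ ξ v| ≤ (2 * Real.pi) ^ 2 * (‖ξ‖ * ‖v‖) := by gcongr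
    _ = 2 * Real.pi * ‖v‖ * (2 * Real.pi * ‖ξ‖) := by ring
    _ ≤ _ := by gcongr

lemma bracket_rpow_le_one {s : ℝ} (hs : s ≤ 0) (ξ : E3) : bracket 1 ξ ^ s ≤ 1 :=
  Real.rpow_le_one_of_one_le_of_nonpos (one_le_bracket le_rfl ξ) hs

lemma bracket_rpow_mono {s r : ℝ} (h : s ≤ r) (ξ : E3) : bracket 1 ξ ^ s ≤ bracket 1 ξ ^ r :=
  Real.rpow_le_rpow_of_exponent_le (one_le_bracket le_rfl ξ) h

lemma integrable_bracket_neg_four : Integrable fun ξ : E3 => bracket 1 ξ ^ (-4 : ℝ) := by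
  have h := integrable_rpow_neg_one_add_norm_sq (E := E3) (μ := volume) (r := 4)
    (by simp; norm_num)
  refine h.mono' (continuous_bracket_rpow _).aestronglyMeasurable (ae_of_all _ fun ξ => ?_)
  have h0 := bracket_pos one_pos ξ
  rw [Real.norm_of_nonneg (by positivity)]
  have e : bracket 1 ξ ^ (-4 : ℝ) = (bracket 1 ξ ^ 2) ^ (-4 / 2 : ℝ) := by
    rw [← Real.rpow_natCast, ← Real.rpow_mul h0.le]; norm_num
  rw [e, bracket_sq]
  refine Real.rpow_le_rpow_of_nonpos (by positivity) ?_ (by norm_num)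
  have : 1 ≤ (2 * Real.pi) ^ 2 := by nlinarith [Real.pi_gt_three]
  rw [mul_pow, one_pow]
  nlinarith [sq_nonneg ‖ξ‖]

lemma memLp_bracket_rpow {s : ℝ} (hs : s ≤ -2) :
    MemLp (fun ξ : E3 => bracket 1 ξ ^ s) 2 := by
  have h : MemLp (fun ξ : E3 => bracket 1 ξ ^ (-2 : ℝ)) 2 := by
    rw [memLp_two_iff_integrable_sq (continuous_bracket_rpow _).aestronglyMeasurable]
    refine integrable_bracket_neg_four.congr (ae_of_all _ fun ξ => ?_)
    simp only
    rw [← Real.rpow_natCast, ← Real.rpow_mul (bracket_nonneg 1 ξ)]; norm_num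
  refine h.mono (continuous_bracket_rpow _).aestronglyMeasurable (ae_of_all _ fun ξ => ?_)
  have h0 := bracket_pos one_pos ξ
  rw [Real.norm_of_nonneg (by positivity), Real.norm_of_nonneg (by positivity)]
  exact bracket_rpow_mono hs ξ

lemma integral_inv_one_add_sq_two_pi : ∫ x : ℝ, (1 + (2 * Real.pi * x) ^ 2)⁻¹ = 1 / 2 := by
  rw [Measure.integral_comp_mul_left (fun x : ℝ => (1 + x ^ 2)⁻¹) (2 * Real.pi),
    integral_univ_inv_one_add_sq, abs_of_pos (by positivity), smul_eq_mul]
  field_simp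

lemma integral_prod_inv :
    ∫ ξ : E3, ∏ j, (1 + (2 * Real.pi * ξ j) ^ 2)⁻¹ = 1 / 8 := by
  rw [← (PiLp.volume_preserving_toLp (Fin 3)).integral_comp
    (MeasurableEquiv.toLp 2 _).measurableEmbedding]
  rw [integral_fintype_prod_volume_eq_prod (fun (_ : Fin 3) (x : ℝ) => (1 + (2 * Real.pi * x) ^ 2)⁻¹)]
  simp only [integral_inv_one_add_sq_two_pi]
  norm_num

/-- Each factor `1 + (2πξ_j)²` is at most `⟨ξ⟩²`, so `⟨ξ⟩^{-6}` is dominated by a product of three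
one-dimensional integrands of integral `1/2`. The numerical value matters: it keeps the Sobolev
constant of the decay norm small enough for the final factor 2. -/
lemma integral_bracket_neg_twelve_le : ∫ ξ : E3, bracket 1 ξ ^ (-12 : ℝ) ≤ 1 / 8 := by
  rw [← integral_prod_inv]
  refine integral_mono_of_nonneg (ae_of_all _ fun ξ => Real.rpow_nonneg (bracket_nonneg 1 ξ) _) ?_
    (ae_of_all _ fun ξ => ?_)
  -- Integrability of the product comes for free: a non-integrable function has integral 0 by
  -- convention, whereas this integral is `1/8`.
  · by_contra h
    have := integral_undef h
    rw [integral_prod_inv] at this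
    norm_num at this
  · have h1 := one_le_bracket le_rfl ξ
    have h0 : 0 < bracket 1 ξ := by linarith
    simp only [Finset.prod_inv_distrib]
    rw [Real.rpow_neg h0.le]
    refine inv_anti₀ (Finset.prod_pos fun j _ => by positivity) ?_
    have hj : ∀ j, 1 + (2 * Real.pi * ξ j) ^ 2 ≤ bracket 1 ξ ^ 2 := fun j => by
      rw [bracket_sq, one_pow, mul_pow, mul_pow _ ‖ξ‖, EuclideanSpace.norm_sq_eq]
      gcongr
      have := Finset.single_le_sum (f := fun i => ‖ξ i‖ ^ 2) (fun i _ => sq_nonneg _)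
        (Finset.mem_univ j)
      simpa using this
    calc ∏ j, (1 + (2 * Real.pi * ξ j) ^ 2) ≤ ∏ _j : Fin 3, bracket 1 ξ ^ 2 :=
          Finset.prod_le_prod (fun j _ => by positivity) fun j _ => hj j
      _ = bracket 1 ξ ^ 6 := by simp; ring
      _ ≤ bracket 1 ξ ^ 12 := pow_le_pow_right₀ h1 (by norm_num)
      _ = bracket 1 ξ ^ (12 : ℝ) := by norm_cast

end

end KleinGordonEFT

/-! ### Convolution estimates with polynomial weights. -/

namespace KleinGordonEFT

noncomputable section

/-! ### Young's inequality -/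

lemma sq_lintegral_mul_le {α : Type*} [MeasurableSpace α] (μ : Measure α) {f g : α → ℝ≥0∞}
    (hf : AEMeasurable f μ) (hg : AEMeasurable g μ) :
    (∫⁻ x, f x * g x ∂μ) ^ 2 ≤ (∫⁻ x, f x ^ 2 ∂μ) * ∫⁻ x, g x ^ 2 ∂μ := by
  have h := ENNReal.lintegral_mul_le_Lp_mul_Lq μ Real.HolderConjugate.two_two hf hg
  have h2 := ENNReal.pow_le_pow_left (n := 2) h
  refine h2.trans_eq ?_
  rw [mul_pow, ← ENNReal.rpow_natCast, ← ENNReal.rpow_natCast, ← ENNReal.rpow_mul,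
    ← ENNReal.rpow_mul]
  norm_num

/-- Young's inequality `L¹ * L² ⊆ L²`: Cauchy–Schwarz after splitting `f = f^{1/2} f^{1/2}`, then
Tonelli and translation invariance. -/
lemma lintegral_sq_convolution_le {f g : E3 → ℝ≥0∞} (hf : Measurable f) (hg : Measurable g) :
    ∫⁻ ξ, (∫⁻ η, f η * g (ξ - η)) ^ 2 ≤ (∫⁻ η, f η) ^ 2 * ∫⁻ ξ, g ξ ^ 2 := by
  have h1 : ∀ ξ, (∫⁻ η, f η * g (ξ - η)) ^ 2 ≤ (∫⁻ η, f η) * ∫⁻ η, f η * g (ξ - η) ^ 2 := fun ξ => by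
    have hg' : Measurable fun η => g (ξ - η) := hg.comp (measurable_const.sub measurable_id)
    have h := sq_lintegral_mul_le volume (f := fun η => f η ^ (1 / 2 : ℝ))
      (g := fun η => f η ^ (1 / 2 : ℝ) * g (ξ - η)) (hf.pow_const _).aemeasurable
      ((hf.pow_const _).mul hg').aemeasurable
    have e : ∀ x : ℝ≥0∞, x ^ (1 / 2 : ℝ) * x ^ (1 / 2 : ℝ) = x := fun x => by
      rw [← ENNReal.rpow_add_of_nonneg _ _ (by norm_num) (by norm_num)]; norm_num
    simpa only [mul_pow, ← mul_assoc, sq (_ ^ (1 / 2 : ℝ)), e] using h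
  have hm : Measurable (Function.uncurry fun ξ η : E3 => f η * g (ξ - η) ^ 2) :=
    (hf.comp measurable_snd).mul ((hg.comp (measurable_fst.sub measurable_snd)).pow_const 2)
  calc ∫⁻ ξ, (∫⁻ η, f η * g (ξ - η)) ^ 2
      ≤ ∫⁻ ξ, (∫⁻ η, f η) * ∫⁻ η, f η * g (ξ - η) ^ 2 := lintegral_mono h1
    _ = (∫⁻ η, f η) * ∫⁻ ξ, ∫⁻ η, f η * g (ξ - η) ^ 2 :=
      lintegral_const_mul _ hm.lintegral_prod_right
    _ = (∫⁻ η, f η) * ∫⁻ η, ∫⁻ ξ, f η * g (ξ - η) ^ 2 := by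
      rw [lintegral_lintegral_swap hm.aemeasurable]
    _ = (∫⁻ η, f η) * ∫⁻ η, f η * ∫⁻ ξ, g ξ ^ 2 := by
      congr 1
      refine lintegral_congr fun η => ?_
      have hg' : Measurable fun ξ => g (ξ - η) ^ 2 :=
        (hg.comp (measurable_id.sub measurable_const)).pow_const 2
      rw [lintegral_const_mul _ hg', lintegral_sub_right_eq_self (fun ξ => g ξ ^ 2) η]
    _ = _ := by rw [lintegral_mul_const _ hf]; ring

lemma lintegral_convolution_comm (f g : E3 → ℝ≥0∞) (ξ : E3) :
    ∫⁻ η, f η * g (ξ - η) = ∫⁻ η, g η * f (ξ - η) := by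
  rw [← lintegral_sub_left_eq_self (fun η => f η * g (ξ - η)) ξ]
  simp [mul_comm]

/-- The convolution of complex functions on frequency space. -/
def conv (f g : E3 → ℂ) (ξ : E3) : ℂ := ∫ η, f η * g (ξ - η)

lemma measurable_conv {f g : E3 → ℂ} (hf : Measurable f) (hg : Measurable g) :
    StronglyMeasurable (conv f g) := by
  have : StronglyMeasurable (Function.uncurry fun ξ η : E3 => f η * g (ξ - η)) :=
    ((hf.comp measurable_snd).mul
      (hg.comp (measurable_fst.sub measurable_snd))).stronglyMeasurable
  exact this.integral_prod_right

lemma enorm_weight_conv_le {r : ℝ} (hr : 0 ≤ r) {f g : E3 → ℂ} (hf : Measurable f)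
    (hg : Measurable g) (ξ : E3) :
    ‖((bracket 1 ξ ^ r : ℝ) : ℂ) * conv f g ξ‖ₑ ≤ ENNReal.ofReal (2 ^ r) *
      ((∫⁻ η, ‖((bracket 1 η ^ r : ℝ) : ℂ) * f η‖ₑ * ‖g (ξ - η)‖ₑ) +
        ∫⁻ η, ‖f η‖ₑ * ‖((bracket 1 (ξ - η) ^ r : ℝ) : ℂ) * g (ξ - η)‖ₑ) := by
  have hw : Measurable fun η : E3 => ((bracket 1 η ^ r : ℝ) : ℂ) :=
    Complex.measurable_ofReal.comp (continuous_bracket_rpow r).measurable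
  have hs : Measurable fun η : E3 => ξ - η := measurable_const.sub measurable_id
  have hpos : ∀ η : E3, 0 ≤ bracket 1 η ^ r := fun η => Real.rpow_nonneg (bracket_nonneg 1 η) r
  have he : ∀ η : E3, ‖((bracket 1 η ^ r : ℝ) : ℂ)‖ₑ = ENNReal.ofReal (bracket 1 η ^ r) := fun η => by
    rw [← ofReal_norm, Complex.norm_of_nonneg (hpos η)]
  calc ‖((bracket 1 ξ ^ r : ℝ) : ℂ) * conv f g ξ‖ₑ
      = ENNReal.ofReal (bracket 1 ξ ^ r) * ‖conv f g ξ‖ₑ := by rw [enorm_mul, he]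
    _ ≤ ENNReal.ofReal (bracket 1 ξ ^ r) * ∫⁻ η, ‖f η * g (ξ - η)‖ₑ := by
      gcongr; exact enorm_integral_le_lintegral_enorm _
    _ = ∫⁻ η, ENNReal.ofReal (bracket 1 ξ ^ r) * ‖f η * g (ξ - η)‖ₑ := by
      rw [lintegral_const_mul]; exact (hf.mul (hg.comp hs)).enorm
    _ ≤ ∫⁻ η, ENNReal.ofReal (2 ^ r) * (‖((bracket 1 η ^ r : ℝ) : ℂ) * f η‖ₑ * ‖g (ξ - η)‖ₑ +
        ‖f η‖ₑ * ‖((bracket 1 (ξ - η) ^ r : ℝ) : ℂ) * g (ξ - η)‖ₑ) := by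
      refine lintegral_mono fun η => ?_
      have h := bracket_rpow_le hr η (ξ - η)
      rw [add_sub_cancel] at h
      have h' := ENNReal.ofReal_le_ofReal h
      rw [ENNReal.ofReal_mul (by positivity), ENNReal.ofReal_add (hpos _) (hpos _)] at h'
      simp only [enorm_mul, he]
      calc _ ≤ _ := mul_le_mul_left h' _
        _ = _ := by ring
    _ = _ := by
      rw [lintegral_const_mul, lintegral_add_left]
      · exact (hw.mul hf).enorm.mul (hg.comp hs).enorm
      · exact ((hw.mul hf).enorm.mul (hg.comp hs).enorm).add
          (hf.enorm.mul ((hw.comp hs).mul (hg.comp hs)).enorm)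

/-- The weight falls on one of the two factors. When it falls on `g`, Young's inequality is applied
with `f` in `L¹`. When it falls on `f`, the convolution is left as it is, since which factor should
be taken in `L¹` depends on the exponents. -/
lemma lintegral_sq_weight_conv_le {r : ℝ} (hr : 0 ≤ r) {f g : E3 → ℂ} (hf : Measurable f)
    (hg : Measurable g) :
    ∫⁻ ξ, ‖((bracket 1 ξ ^ r : ℝ) : ℂ) * conv f g ξ‖ₑ ^ 2 ≤
      2 * ENNReal.ofReal (2 ^ r) ^ 2 *
      ((∫⁻ ξ, (∫⁻ η, ‖((bracket 1 η ^ r : ℝ) : ℂ) * f η‖ₑ * ‖g (ξ - η)‖ₑ) ^ 2) +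
        (∫⁻ η, ‖f η‖ₑ) ^ 2 * ∫⁻ ξ, ‖((bracket 1 ξ ^ r : ℝ) : ℂ) * g ξ‖ₑ ^ 2) := by
  have hw : Measurable fun η : E3 => ((bracket 1 η ^ r : ℝ) : ℂ) :=
    Complex.measurable_ofReal.comp (continuous_bracket_rpow r).measurable
  have hm : ∀ {F G : E3 → ℂ}, Measurable F → Measurable G →
      Measurable fun ξ : E3 => (∫⁻ η, ‖F η‖ₑ * ‖G (ξ - η)‖ₑ) ^ 2 := fun hF hG =>
    (Measurable.lintegral_prod_right ((hF.comp measurable_snd).enorm.mul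
      (hG.comp (measurable_fst.sub measurable_snd)).enorm)).pow_const 2
  refine (lintegral_mono fun ξ => ENNReal.pow_le_pow_left (n := 2)
    (enorm_weight_conv_le hr hf hg ξ)).trans ?_
  have hsq : ∀ x y : ℝ≥0∞, (x + y) ^ 2 ≤ 2 * (x ^ 2 + y ^ 2) := fun x y => by
    have h := ENNReal.rpow_add_le_mul_rpow_add_rpow x y (p := 2) one_le_two
    norm_num at h
    exact_mod_cast h
  calc ∫⁻ ξ, (ENNReal.ofReal (2 ^ r) *
      ((∫⁻ η, ‖((bracket 1 η ^ r : ℝ) : ℂ) * f η‖ₑ * ‖g (ξ - η)‖ₑ) +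
        ∫⁻ η, ‖f η‖ₑ * ‖((bracket 1 (ξ - η) ^ r : ℝ) : ℂ) * g (ξ - η)‖ₑ)) ^ 2
      ≤ ∫⁻ ξ, 2 * ENNReal.ofReal (2 ^ r) ^ 2 *
        ((∫⁻ η, ‖((bracket 1 η ^ r : ℝ) : ℂ) * f η‖ₑ * ‖g (ξ - η)‖ₑ) ^ 2 +
        (∫⁻ η, ‖f η‖ₑ * ‖((bracket 1 (ξ - η) ^ r : ℝ) : ℂ) * g (ξ - η)‖ₑ) ^ 2) := by
        refine lintegral_mono fun ξ => ?_
        rw [mul_pow, mul_comm 2, mul_assoc]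
        gcongr
        exact hsq _ _
    _ ≤ _ := by
      have h1 := hm (F := fun η => ((bracket 1 η ^ r : ℝ) : ℂ) * f η) (hw.mul hf) hg
      have h2 := hm (G := fun η => ((bracket 1 η ^ r : ℝ) : ℂ) * g η) hf (hw.mul hg)
      rw [lintegral_const_mul' _ _ (by finiteness), lintegral_add_left h1]
      gcongr
      exact lintegral_sq_convolution_le (g := fun ξ => ‖((bracket 1 ξ ^ r : ℝ) : ℂ) * g ξ‖ₑ)
        hf.enorm (hw.mul hg).enorm

end

end KleinGordonEFT

/-! ### Multiplication, conjugation and weighted convolution on the Fourier side. -/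

namespace KleinGordonEFT

noncomputable section

/-! ### Operators on `L²` of frequency space -/

/-- Square integrable complex functions on frequency space. -/
abbrev L2 : Type := Lp ℂ 2 (volume : Measure E3)

/-- Bounded continuous functions. -/
def BddCont (σ : E3 → ℂ) : Prop := Continuous σ ∧ ∃ C, ∀ ξ, ‖σ ξ‖ ≤ C

lemma BddCont.memLp {σ : E3 → ℂ} (h : BddCont σ) : MemLp σ ∞ (volume : Measure E3) :=
  memLp_top_of_bound h.1.aestronglyMeasurable h.2.choose (ae_of_all _ h.2.choose_spec)

lemma BddCont.mul {σ τ : E3 → ℂ} (h : BddCont σ) (h' : BddCont τ) :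
    BddCont fun ξ => σ ξ * τ ξ := by
  obtain ⟨hc, C, hC⟩ := h
  obtain ⟨hc', C', hC'⟩ := h'
  refine ⟨hc.mul hc', C * C', fun ξ => ?_⟩
  rw [norm_mul]
  exact mul_le_mul (hC ξ) (hC' ξ) (norm_nonneg _) ((norm_nonneg _).trans (hC ξ))

lemma bddCont_bracket_rpow {s : ℝ} (hs : s ≤ 0) :
    BddCont fun ξ => ((bracket 1 ξ ^ s : ℝ) : ℂ) := by
  refine ⟨Complex.continuous_ofReal.comp (continuous_bracket_rpow s), 1, fun ξ => ?_⟩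
  rw [Complex.norm_of_nonneg (Real.rpow_nonneg (bracket_nonneg 1 ξ) _)]
  exact bracket_rpow_le_one hs ξ

open Classical in
/-- Multiplication by a bounded function. -/
def mulL2 (σ : E3 → ℂ) : L2 →L[ℝ] L2 :=
  if h : MemLp σ ∞ (volume : Measure E3) then
    (ContinuousLinearMap.mul ℝ ℂ).holderL volume ∞ 2 2 (h.toLp σ) else 0

lemma mulL2_ae {σ : E3 → ℂ} (h : BddCont σ) (a : L2) :
    mulL2 σ a =ᵐ[volume] fun ξ => σ ξ * a ξ := by
  rw [mulL2, dif_pos h.memLp]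
  filter_upwards [ContinuousLinearMap.coeFn_holder (r := 2) (ContinuousLinearMap.mul ℝ ℂ)
    (h.memLp.toLp σ) a, h.memLp.coeFn_toLp] with ξ h1 h2
  rw [ContinuousLinearMap.holderL_apply_apply, h1, h2]; rfl

lemma norm_mulL2_le {σ : E3 → ℂ} (h : BddCont σ) {C : ℝ} (hC : ∀ ξ, ‖σ ξ‖ ≤ C) (a : L2) :
    ‖mulL2 σ a‖ ≤ C * ‖a‖ := by
  refine Lp.norm_le_mul_norm_of_ae_le_mul ?_
  filter_upwards [mulL2_ae h a] with ξ hξ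
  rw [hξ, norm_mul]
  exact mul_le_mul_of_nonneg_right (hC ξ) (norm_nonneg _)

lemma norm_mulL2_eq {σ : E3 → ℂ} (h : BddCont σ) (hC : ∀ ξ, ‖σ ξ‖ = 1) (a : L2) :
    ‖mulL2 σ a‖ = ‖a‖ := by
  rw [Lp.norm_def, Lp.norm_def]
  congr 1
  refine eLpNorm_congr_norm_ae ?_
  filter_upwards [mulL2_ae h a] with ξ hξ
  rw [hξ, norm_mul, hC, one_mul]

lemma mulL2_mulL2 {σ τ : E3 → ℂ} (h : BddCont σ) (h' : BddCont τ) (a : L2) :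
    mulL2 σ (mulL2 τ a) = mulL2 (fun ξ => σ ξ * τ ξ) a := by
  refine Lp.ext ?_
  filter_upwards [mulL2_ae h (mulL2 τ a), mulL2_ae h' a, mulL2_ae (h.mul h') a] with ξ h1 h2 h3
  rw [h1, h2, h3, mul_assoc]

lemma measurePreserving_neg_volume : MeasurePreserving (Neg.neg : E3 → E3) volume volume :=
  Measure.measurePreserving_neg volume

/-- The operator `a ↦ conj a(-·)`, which is complex conjugation in physical space. -/
def conjL2 : L2 →L[ℝ] L2 :=
  (ContinuousLinearMap.compLpL 2 volume Complex.conjCLE.toContinuousLinearMap).comp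
    (Lp.compMeasurePreservingₗᵢ ℝ Neg.neg measurePreserving_neg_volume).toContinuousLinearMap

lemma conjL2_ae (a : L2) : conjL2 a =ᵐ[volume] fun ξ => (starRingEnd ℂ) (a (-ξ)) := by
  have h2 := Lp.coeFn_compMeasurePreserving a measurePreserving_neg_volume
  filter_upwards [ContinuousLinearMap.coeFn_compLpL (p := 2) (μ := volume)
    Complex.conjCLE.toContinuousLinearMap
    (Lp.compMeasurePreservingₗᵢ ℝ Neg.neg measurePreserving_neg_volume a), h2] with ξ h1 h2
  simp only [conjL2, ContinuousLinearMap.comp_apply]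
  refine h1.trans ?_
  simp only [ContinuousLinearEquiv.coe_coe, Complex.conjCLE_apply]
  exact congrArg _ h2

lemma ae_neg {p : E3 → Prop} (h : ∀ᵐ ξ : E3, p ξ) : ∀ᵐ ξ : E3, p (-ξ) :=
  measurePreserving_neg_volume.quasiMeasurePreserving.ae h

lemma norm_conjL2 (a : L2) : ‖conjL2 a‖ = ‖a‖ := by
  have h1 : ‖conjL2 a‖ = ‖Lp.compMeasurePreservingₗᵢ ℝ Neg.neg measurePreserving_neg_volume a‖ := by
    rw [Lp.norm_def, Lp.norm_def]
    congr 1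
    refine eLpNorm_congr_norm_ae ?_
    filter_upwards [conjL2_ae a, Lp.coeFn_compMeasurePreserving a measurePreserving_neg_volume]
      with ξ h1 h2
    rw [h1, RCLike.norm_conj]
    exact congrArg _ h2.symm
  rw [h1, LinearIsometry.norm_map]

lemma conjL2_conjL2 (a : L2) : conjL2 (conjL2 a) = a := by
  refine Lp.ext ?_
  filter_upwards [conjL2_ae (conjL2 a), ae_neg (conjL2_ae a)] with ξ h1 h2
  rw [h1, h2, neg_neg, Complex.conj_conj]

lemma conjL2_mulL2 {σ τ : E3 → ℂ} (hσ : BddCont σ) (hτ : BddCont τ)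
    (h : ∀ ξ, (starRingEnd ℂ) (σ (-ξ)) = τ ξ) (a : L2) :
    conjL2 (mulL2 σ a) = mulL2 τ (conjL2 a) := by
  refine Lp.ext ?_
  filter_upwards [conjL2_ae (mulL2 σ a), ae_neg (mulL2_ae hσ a), mulL2_ae hτ (conjL2 a),
    conjL2_ae a] with ξ h1 h2 h3 h4
  rw [h1, h2, h3, h4, map_mul, h]

/-- The bilinear pairing `∫ f a`. -/
def pairL2 : L2 →L[ℝ] L2 →L[ℝ] ℂ := (ContinuousLinearMap.mul ℝ ℂ).lpPairing volume 2 2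

lemma pairL2_apply (f a : L2) : pairL2 f a = ∫ ξ, f ξ * a ξ :=
  ContinuousLinearMap.lpPairing_eq_integral _ f a

lemma pairL2_toLp {f : E3 → ℂ} (hf : MemLp f 2) (a : L2) :
    pairL2 (hf.toLp f) a = ∫ ξ, f ξ * a ξ := by
  rw [pairL2_apply]
  refine integral_congr_ae ?_
  filter_upwards [hf.coeFn_toLp] with ξ h
  rw [h]

lemma enorm_sq_eq_lintegral (a : L2) : ‖a‖ₑ ^ 2 = ∫⁻ ξ, ‖a ξ‖ₑ ^ 2 := by
  rw [Lp.enorm_def, eLpNorm_eq_lintegral_rpow_enorm_toReal two_ne_zero ENNReal.ofNat_ne_top,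
    ← ENNReal.rpow_natCast, ← ENNReal.rpow_mul]
  norm_num

/-- The symbol `⟨ξ⟩^s` as a complex function. -/
def wt (s : ℝ) (ξ : E3) : ℂ := ((bracket 1 ξ ^ s : ℝ) : ℂ)

lemma wt_mul (s r : ℝ) (ξ : E3) : wt s ξ * wt r ξ = wt (s + r) ξ := by
  rw [wt, wt, wt, ← Complex.ofReal_mul, Real.rpow_add (bracket_pos one_pos ξ)]

lemma wt_zero (ξ : E3) : wt 0 ξ = 1 := by simp [wt]

lemma norm_wt (s : ℝ) (ξ : E3) : ‖wt s ξ‖ = bracket 1 ξ ^ s :=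
  Complex.norm_of_nonneg (Real.rpow_nonneg (bracket_nonneg 1 ξ) _)

lemma continuous_wt (s : ℝ) : Continuous (wt s) :=
  Complex.continuous_ofReal.comp (continuous_bracket_rpow s)

lemma wt_neg (s : ℝ) (ξ : E3) : wt s (-ξ) = wt s ξ := by rw [wt, wt, bracket_neg]

lemma conj_wt (s : ℝ) (ξ : E3) : (starRingEnd ℂ) (wt s ξ) = wt s ξ := Complex.conj_ofReal _

lemma bddCont_wt {s : ℝ} (hs : s ≤ 0) : BddCont (wt s) := bddCont_bracket_rpow hs

lemma memLp_wt {s : ℝ} (hs : s ≤ -2) : MemLp (wt s) 2 :=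
  (memLp_bracket_rpow hs).ofReal

lemma measurable_coe (a : L2) : Measurable a := (Lp.stronglyMeasurable a).measurable

lemma memLp_wt_mul {s : ℝ} (hs : s ≤ 0) (a : L2) : MemLp (fun ξ => wt s ξ * a ξ) 2 :=
  (memLp_congr_ae (mulL2_ae (bddCont_wt hs) a)).1 (Lp.memLp _)

lemma integrable_wt_mul {s : ℝ} (hs : s ≤ -2) (a : L2) : Integrable fun ξ => wt s ξ * a ξ :=
  (memLp_wt hs).integrable_mul (Lp.memLp a)

/-! ### Weighted convolution -/

lemma conv_congr {f f' g g' : E3 → ℂ} (hf : f =ᵐ[volume] f') (hg : g =ᵐ[volume] g') :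
    conv f g = conv f' g' := by
  funext ξ
  refine integral_congr_ae ?_
  have := (Measure.measurePreserving_sub_left (volume : Measure E3) ξ).quasiMeasurePreserving.ae hg
  filter_upwards [hf, this] with η h1 h2
  rw [h1, h2]

lemma integrable_conv {f g : E3 → ℂ} (hf : MemLp f 2) (hg : MemLp g 2) (ξ : E3) :
    Integrable fun η => f η * g (ξ - η) :=
  hf.integrable_mul (hg.comp_measurePreserving (Measure.measurePreserving_sub_left volume ξ))

lemma conv_add_left {f f' g : E3 → ℂ} (hf : MemLp f 2) (hf' : MemLp f' 2) (hg : MemLp g 2) :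
    conv (fun ξ => f ξ + f' ξ) g = fun ξ => conv f g ξ + conv f' g ξ := by
  funext ξ
  simp only [conv, add_mul]
  exact integral_add (integrable_conv hf hg ξ) (integrable_conv hf' hg ξ)

lemma conv_add_right {f g g' : E3 → ℂ} (hf : MemLp f 2) (hg : MemLp g 2) (hg' : MemLp g' 2) :
    conv f (fun ξ => g ξ + g' ξ) = fun ξ => conv f g ξ + conv f g' ξ := by
  funext ξ
  simp only [conv, mul_add]
  exact integral_add (integrable_conv hf hg ξ) (integrable_conv hf hg' ξ)

lemma conv_smul_left (c : ℂ) (f g : E3 → ℂ) :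
    conv (fun ξ => c * f ξ) g = fun ξ => c * conv f g ξ := by
  funext ξ
  simp only [conv, mul_assoc]
  exact integral_const_mul c _

lemma conv_smul_right (c : ℂ) (f g : E3 → ℂ) :
    conv f (fun ξ => c * g ξ) = fun ξ => c * conv f g ξ := by
  funext ξ
  simp only [conv, mul_left_comm _ c]
  exact integral_const_mul c _

/-- The admissible pairs of exponents for the product of `H^N` and `H^r`. -/
def ConvExp (N r : ℝ) : Prop := 0 ≤ r ∧ 2 ≤ N ∧ (r = N ∨ r + 2 ≤ N)

/-- The function representing the weighted convolution. -/
def wconvFun (N r : ℝ) (a b : L2) (ξ : E3) : ℂ :=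
  wt r ξ * conv (fun η => wt (-N) η * a η) (fun η => wt (-r) η * b η) ξ

/-- The square of the bound of the weighted convolution. -/
def wconvConst (r : ℝ) : ℝ≥0∞ :=
  2 * ENNReal.ofReal (2 ^ r) ^ 2 * (2 * ∫⁻ ξ : E3, ‖wt (-2) ξ‖ₑ ^ 2)

lemma lintegral_enorm_sq_lt_top {f : E3 → ℂ} (hf : MemLp f 2) : ∫⁻ ξ, ‖f ξ‖ₑ ^ 2 < ∞ := by
  have h := lintegral_rpow_enorm_lt_top_of_eLpNorm_lt_top two_ne_zero ENNReal.ofNat_ne_top hf.2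
  simpa using h

lemma wconvConst_lt_top (r : ℝ) : wconvConst r < ∞ := by
  have := lintegral_enorm_sq_lt_top (memLp_wt le_rfl)
  unfold wconvConst
  finiteness

/-- In dimension three `⟨ξ⟩^{-2}` is square integrable, so two powers of the bracket carry `L²` into
`L¹` by Cauchy–Schwarz. -/
lemma sq_lintegral_wt_mul_le {s : ℝ} (hs : s ≤ -2) (a : L2) :
    (∫⁻ ξ, ‖wt s ξ * a ξ‖ₑ) ^ 2 ≤ (∫⁻ ξ : E3, ‖wt (-2) ξ‖ₑ ^ 2) * ‖a‖ₑ ^ 2 := by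
  rw [enorm_sq_eq_lintegral]
  refine le_trans ?_ (sq_lintegral_mul_le volume (continuous_wt (-2)).measurable.enorm.aemeasurable
    (measurable_coe a).enorm.aemeasurable)
  gcongr with ξ
  rw [enorm_mul]
  gcongr
  rw [enorm_le_iff_norm_le, norm_wt, norm_wt]
  exact bracket_rpow_mono hs ξ

lemma lintegral_sq_wt_mul_le {s : ℝ} (hs : s ≤ 0) (a : L2) :
    ∫⁻ ξ, ‖wt s ξ * a ξ‖ₑ ^ 2 ≤ ‖a‖ₑ ^ 2 := by
  rw [enorm_sq_eq_lintegral]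
  gcongr with ξ
  rw [enorm_le_iff_norm_le, norm_mul, norm_wt]
  exact mul_le_of_le_one_left (norm_nonneg _) (bracket_rpow_le_one hs ξ)

/-- The multiplication law `H^N · H^r ⊆ H^r`. Of the two factors of each convolution one must keep
two spare powers of `⟨ξ⟩`, to be placed in `L¹`. -/
lemma lintegral_sq_wconvFun_le {N r : ℝ} (h : ConvExp N r) (a b : L2) :
    ∫⁻ ξ, ‖wconvFun N r a b ξ‖ₑ ^ 2 ≤ wconvConst r * (‖a‖ₑ ^ 2 * ‖b‖ₑ ^ 2) := by
  obtain ⟨hr, hN, h⟩ := h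
  have hf : Measurable fun η => wt (-N) η * a η :=
    (continuous_wt _).measurable.mul (measurable_coe a)
  have hg : Measurable fun η => wt (-r) η * b η :=
    (continuous_wt _).measurable.mul (measurable_coe b)
  have e : ∀ (s : ℝ) (c : L2) (η : E3),
      ((bracket 1 η ^ r : ℝ) : ℂ) * (wt s η * c η) = wt (r + s) η * c η := fun s c η => by
    rw [← mul_assoc, ← wt_mul]; rfl
  refine (lintegral_sq_weight_conv_le hr hf hg).trans ?_
  simp only [e]
  rw [wconvConst, mul_assoc (2 * ENNReal.ofReal (2 ^ r) ^ 2)]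
  gcongr
  set K := ∫⁻ ξ : E3, ‖wt (-2) ξ‖ₑ ^ 2
  have h2 : (∫⁻ η, ‖wt (-N) η * a η‖ₑ) ^ 2 * ∫⁻ ξ, ‖wt (r + -r) ξ * b ξ‖ₑ ^ 2 ≤
      K * (‖a‖ₑ ^ 2 * ‖b‖ₑ ^ 2) := by
    rw [← mul_assoc]
    exact mul_le_mul' (sq_lintegral_wt_mul_le (by linarith) a)
      (lintegral_sq_wt_mul_le (by linarith) b)
  have h1 : ∫⁻ ξ, (∫⁻ η, ‖wt (r + -N) η * a η‖ₑ * ‖wt (-r) (ξ - η) * b (ξ - η)‖ₑ) ^ 2 ≤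
      K * (‖a‖ₑ ^ 2 * ‖b‖ₑ ^ 2) := by
    have hf' : Measurable fun η => wt (r + -N) η * a η :=
      (continuous_wt _).measurable.mul (measurable_coe a)
    rcases h with h | h
    -- If `r = N` the weighted factor `a` has no decay left, so `b`, with its `r ≥ 2` powers, goes
    -- into `L¹`; if `r + 2 ≤ N` the factor `a` still has two powers and plays that role.
    · have hc : ∀ ξ, ∫⁻ η, ‖wt (r + -N) η * a η‖ₑ * ‖wt (-r) (ξ - η) * b (ξ - η)‖ₑ =
          ∫⁻ η, ‖wt (-r) η * b η‖ₑ * ‖wt (r + -N) (ξ - η) * a (ξ - η)‖ₑ := fun ξ =>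
        lintegral_convolution_comm (fun η => ‖wt (r + -N) η * a η‖ₑ)
          (fun η => ‖wt (-r) η * b η‖ₑ) ξ
      simp only [hc]
      refine (lintegral_sq_convolution_le hg.enorm hf'.enorm).trans ?_
      rw [mul_comm (‖a‖ₑ ^ 2), ← mul_assoc]
      exact mul_le_mul' (sq_lintegral_wt_mul_le (by linarith) b)
        (lintegral_sq_wt_mul_le (by linarith) a)
    · refine (lintegral_sq_convolution_le hf'.enorm hg.enorm).trans ?_
      rw [← mul_assoc]
      exact mul_le_mul' (sq_lintegral_wt_mul_le (by linarith) a)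
        (lintegral_sq_wt_mul_le (by linarith) b)
  calc _ ≤ K * (‖a‖ₑ ^ 2 * ‖b‖ₑ ^ 2) + K * (‖a‖ₑ ^ 2 * ‖b‖ₑ ^ 2) := add_le_add h1 h2
    _ = _ := by ring

lemma eLpNorm_two_sq (f : E3 → ℂ) : eLpNorm f 2 volume ^ 2 = ∫⁻ ξ, ‖f ξ‖ₑ ^ 2 := by
  rw [eLpNorm_eq_lintegral_rpow_enorm_toReal two_ne_zero ENNReal.ofNat_ne_top,
    ← ENNReal.rpow_natCast, ← ENNReal.rpow_mul]
  norm_num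

lemma memLp_wconvFun {N r : ℝ} (h : ConvExp N r) (a b : L2) : MemLp (wconvFun N r a b) 2 := by
  refine ⟨((continuous_wt r).stronglyMeasurable.mul (measurable_conv
    ((continuous_wt _).measurable.mul (measurable_coe a))
    ((continuous_wt _).measurable.mul (measurable_coe b)))).aestronglyMeasurable, ?_⟩
  have h1 := (lintegral_sq_wconvFun_le h a b).trans_lt
    (ENNReal.mul_lt_top (wconvConst_lt_top r) (by finiteness))
  rw [← eLpNorm_two_sq] at h1
  by_contra h2
  simp [not_lt_top_iff.1 h2] at h1

/-- `⟨ξ⟩^r ((⟨ξ⟩^{-N} a) * (⟨ξ⟩^{-r} b))`: the product of functions in `H^N` and `H^r`. -/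
def wconv {N r : ℝ} (h : ConvExp N r) : L2 →L[ℝ] L2 →L[ℝ] L2 :=
  LinearMap.mkContinuous₂
    (LinearMap.mk₂ ℝ (fun a b => (memLp_wconvFun h a b).toLp _)
      (fun a a' b => by
        rw [← MemLp.toLp_add]
        congr 1
        funext ξ
        have e : (fun η => wt (-N) η * (a + a' : L2) η) =ᵐ[volume]
            fun η => wt (-N) η * a η + wt (-N) η * a' η := by
          filter_upwards [Lp.coeFn_add a a'] with η hη
          rw [hη, Pi.add_apply, mul_add]
        simp only [wconvFun, Pi.add_apply]
        rw [conv_congr e (ae_eq_refl _), conv_add_left (memLp_wt_mul (by linarith [h.2.1]) a)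
          (memLp_wt_mul (by linarith [h.2.1]) a') (memLp_wt_mul (by linarith [h.1]) b), mul_add])
      (fun c a b => by
        rw [← MemLp.toLp_const_smul]
        congr 1
        funext ξ
        have e : (fun η => wt (-N) η * (c • a : L2) η) =ᵐ[volume]
            fun η => (c : ℂ) * (wt (-N) η * a η) := by
          filter_upwards [Lp.coeFn_smul c a] with η hη
          rw [hη, Pi.smul_apply, Complex.real_smul]; ring
        simp only [wconvFun, Pi.smul_apply, Complex.real_smul]
        rw [conv_congr e (ae_eq_refl _), conv_smul_left]; ring)
      (fun a b b' => by
        rw [← MemLp.toLp_add]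
        congr 1
        funext ξ
        have e : (fun η => wt (-r) η * (b + b' : L2) η) =ᵐ[volume]
            fun η => wt (-r) η * b η + wt (-r) η * b' η := by
          filter_upwards [Lp.coeFn_add b b'] with η hη
          rw [hη, Pi.add_apply, mul_add]
        simp only [wconvFun, Pi.add_apply]
        rw [conv_congr (ae_eq_refl _) e, conv_add_right (memLp_wt_mul (by linarith [h.2.1]) a)
          (memLp_wt_mul (by linarith [h.1]) b) (memLp_wt_mul (by linarith [h.1]) b'), mul_add])
      (fun c a b => by
        rw [← MemLp.toLp_const_smul]
        congr 1
        funext ξ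
        have e : (fun η => wt (-r) η * (c • b : L2) η) =ᵐ[volume]
            fun η => (c : ℂ) * (wt (-r) η * b η) := by
          filter_upwards [Lp.coeFn_smul c b] with η hη
          rw [hη, Pi.smul_apply, Complex.real_smul]; ring
        simp only [wconvFun, Pi.smul_apply, Complex.real_smul]
        rw [conv_congr (ae_eq_refl _) e, conv_smul_right]; ring))
    (Real.sqrt (wconvConst r).toReal)
    (fun a b => by
      have h1 := lintegral_sq_wconvFun_le h a b
      rw [← eLpNorm_two_sq] at h1
      have h2 := ENNReal.toReal_mono (ENNReal.mul_ne_top (wconvConst_lt_top r).ne (by finiteness)) h1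
      simp only [ENNReal.toReal_mul, ENNReal.toReal_pow, toReal_enorm] at h2
      rw [LinearMap.mk₂_apply, Lp.norm_toLp]
      refine (Real.le_sqrt_of_sq_le h2).trans_eq ?_
      rw [Real.sqrt_mul ENNReal.toReal_nonneg, ← mul_pow, Real.sqrt_sq (by positivity), mul_assoc])

lemma wconv_ae {N r : ℝ} (h : ConvExp N r) (a b : L2) :
    wconv h a b =ᵐ[volume] wconvFun N r a b :=
  (memLp_wconvFun h a b).coeFn_toLp

lemma wt_neg_mul_wconv_ae {N r : ℝ} (h : ConvExp N r) (a b : L2) :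
    (fun ξ => wt (-r) ξ * wconv h a b ξ) =ᵐ[volume]
      conv (fun η => wt (-N) η * a η) (fun η => wt (-r) η * b η) := by
  filter_upwards [wconv_ae h a b] with ξ hξ
  rw [hξ, wconvFun, ← mul_assoc, wt_mul, neg_add_cancel, wt_zero, one_mul]

lemma conjL2_wconv {N r : ℝ} (h : ConvExp N r) (a b : L2) :
    conjL2 (wconv h a b) = wconv h (conjL2 a) (conjL2 b) := by
  refine Lp.ext ?_
  have e : ∀ (s : ℝ) (c : L2), (fun η => wt s η * conjL2 c η) =ᵐ[volume]
      fun η => (starRingEnd ℂ) (wt s (-η) * c (-η)) := fun s c => by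
    filter_upwards [conjL2_ae c] with η hη
    rw [hη, map_mul, conj_wt, wt_neg]
  filter_upwards [conjL2_ae (wconv h a b), ae_neg (wconv_ae h a b),
    wconv_ae h (conjL2 a) (conjL2 b)] with ξ h1 h2 h3
  rw [h1, h2, h3, wconvFun, wconvFun, conv_congr (e _ a) (e _ b), map_mul, conj_wt, wt_neg]
  congr 1
  rw [conv, conv, ← integral_conj, ← integral_neg_eq_self]
  simp only [map_mul, neg_sub, sub_neg_eq_add, neg_add_eq_sub]

end

end KleinGordonEFT

/-! ### The Banach space of weighted half waves: multipliers, conjugation, products. -/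

namespace KleinGordonEFT

noncomputable section

open scoped LineDeriv

/-! ### The weighted space -/

/-- The standard basis of frequency space. -/
abbrev ej (j : Fin 3) : E3 := EuclideanSpace.single j 1

/-- The constant `2πi`. -/
abbrev tpi : ℂ := 2 * Real.pi * Complex.I

lemma tpi_ne_zero : tpi ≠ 0 := by
  simp [tpi, Real.pi_ne_zero]

/-- The pairing of `L²` with a Schwartz function. -/
def pairS (ψ : 𝓢(E3, ℂ)) : L2 →L[ℝ] ℂ := pairL2 (ψ.toLp 2 volume)

lemma pairS_apply (ψ : 𝓢(E3, ℂ)) (a : L2) : pairS ψ a = ∫ ξ, ψ ξ * a ξ :=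
  pairL2_toLp (ψ.memLp 2 volume) a

lemma pairS_congr (ψ : 𝓢(E3, ℂ)) {a : L2} {f : E3 → ℂ} (h : a =ᵐ[volume] f) :
    pairS ψ a = ∫ ξ, ψ ξ * f ξ := by
  rw [pairS_apply]
  refine integral_congr_ae ?_
  filter_upwards [h] with ξ hξ
  rw [hξ]

/-- Pairs `(a, b)` with `a = ⟨ξ⟩^N û`, `b_j = ⟨ξ⟩^s (x_j u)^`, so that `(2πi)⟨ξ⟩^{-s} b_j` is minus the
weak derivative of `⟨ξ⟩^{-N} a`. -/
def WSpace (N s : ℝ) : Submodule ℝ (L2 × (Fin 3 → L2)) where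
  carrier := {y | ∀ (j : Fin 3) (ψ : 𝓢(E3, ℂ)),
    tpi * pairS ψ (mulL2 (wt (-s)) (y.2 j)) = pairS (∂_{ej j} ψ) (mulL2 (wt (-N)) y.1)}
  add_mem' := fun {y z} hy hz j ψ => by
    simp only [Prod.snd_add, Pi.add_apply, Prod.fst_add, map_add, mul_add, hy j ψ, hz j ψ]
  zero_mem' := fun j ψ => by simp
  smul_mem' := fun c y hy j ψ => by
    simp only [Prod.smul_snd, Pi.smul_apply, Prod.smul_fst, map_smul, ← hy j ψ, mul_smul_comm]

/-- The relation between `a` and `b` is tested weakly against Schwartz functions, hence is an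
intersection of closed conditions. The space is then complete, as the fixed point argument requires.
-/
lemma isClosed_WSpace (N s : ℝ) : IsClosed (WSpace N s : Set (L2 × (Fin 3 → L2))) := by
  have : (WSpace N s : Set (L2 × (Fin 3 → L2))) = ⋂ (j : Fin 3) (ψ : 𝓢(E3, ℂ)),
      {y | tpi * pairS ψ (mulL2 (wt (-s)) (y.2 j)) = pairS (∂_{ej j} ψ) (mulL2 (wt (-N)) y.1)} := by
    ext y; simp [WSpace]
  rw [this]
  refine isClosed_iInter fun j => isClosed_iInter fun ψ => isClosed_eq ?_ ?_
  · have h : Continuous fun y : L2 × (Fin 3 → L2) => y.2 j := by fun_prop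
    exact continuous_const.mul ((pairS ψ).continuous.comp ((mulL2 _).continuous.comp h))
  · exact (pairS _).continuous.comp ((mulL2 _).continuous.comp continuous_fst)

instance (N s : ℝ) : CompleteSpace (WSpace N s) := (isClosed_WSpace N s).completeSpace_coe

/-- The conditions on the exponents `N` of the energy norm and `s` of the weighted norm. -/
class Exps (N s : ℝ) : Prop where
  nonneg : 0 ≤ s
  le : s + 2 ≤ N
  six_lt : 6 < N

/-- Smooth symbols that are bounded together with their first derivatives. -/
structure IsSymbol (σ : E3 → ℂ) : Prop where
  temperate : σ.HasTemperateGrowth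
  bdd : ∃ A, ∀ ξ, ‖σ ξ‖ ≤ A
  bdd_deriv : ∃ B, ∀ j ξ, ‖fderiv ℝ σ ξ (ej j)‖ ≤ B

lemma IsSymbol.bddCont {σ : E3 → ℂ} (h : IsSymbol σ) : BddCont σ :=
  ⟨h.temperate.1.continuous, h.bdd⟩

lemma IsSymbol.bddCont_deriv {σ : E3 → ℂ} (h : IsSymbol σ) (j : Fin 3) :
    BddCont fun ξ => fderiv ℝ σ ξ (ej j) :=
  ⟨(h.temperate.1.continuous_fderiv (by simp)).clm_apply continuous_const,
    h.bdd_deriv.imp fun _ hB => hB j⟩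

/-- The symbol by which `σ(D)` and `x_j` fail to commute, with weights. -/
def dcoef (N s : ℝ) (σ : E3 → ℂ) (j : Fin 3) (ξ : E3) : ℂ :=
  tpi⁻¹ * (wt (s - N) ξ * fderiv ℝ σ ξ (ej j))

lemma bddCont_const (c : ℂ) : BddCont fun _ => c := ⟨continuous_const, ‖c‖, fun _ => le_rfl⟩

lemma Exps.sub_nonpos (N s : ℝ) [h : Exps N s] : s - N ≤ 0 := by linarith [h.le]

lemma IsSymbol.bddCont_dcoef {N s : ℝ} [Exps N s] {σ : E3 → ℂ} (h : IsSymbol σ) (j : Fin 3) :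
    BddCont (dcoef N s σ j) :=
  (bddCont_const _).mul ((bddCont_wt (Exps.sub_nonpos N s)).mul (h.bddCont_deriv j))

lemma norm_dcoef_le {N s : ℝ} [Exps N s] {σ : E3 → ℂ} {j : Fin 3} {ξ : E3} {B : ℝ}
    (h : ‖fderiv ℝ σ ξ (ej j)‖ ≤ 2 * Real.pi * B) : ‖dcoef N s σ j ξ‖ ≤ B := by
  have h1 : ‖tpi‖ = 2 * Real.pi := by simp [tpi, abs_of_pos Real.pi_pos]
  have h2 := bracket_rpow_le_one (Exps.sub_nonpos N s) ξ
  rw [dcoef, norm_mul, norm_mul, norm_inv, h1, norm_wt, inv_mul_le_iff₀ (by positivity)]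
  exact (mul_le_of_le_one_left (norm_nonneg _) h2).trans h

lemma pairL2_mulL2 {σ : E3 → ℂ} (h : BddCont σ) (f a : L2) :
    pairL2 f (mulL2 σ a) = pairL2 (mulL2 σ f) a := by
  rw [pairL2_apply, pairL2_apply]
  refine integral_congr_ae ?_
  filter_upwards [mulL2_ae h a, mulL2_ae h f] with ξ h1 h2
  rw [h1, h2]; ring

lemma mulL2_comm {σ τ : E3 → ℂ} (h : BddCont σ) (h' : BddCont τ) (a : L2) :
    mulL2 σ (mulL2 τ a) = mulL2 τ (mulL2 σ a) := by
  rw [mulL2_mulL2 h h', mulL2_mulL2 h' h]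
  simp only [mul_comm]

lemma pairS_mulL2_const (ψ : 𝓢(E3, ℂ)) {σ : E3 → ℂ} (h : BddCont σ) (c : ℂ) (a : L2) :
    pairS ψ (mulL2 (fun ξ => c * σ ξ) a) = c * pairS ψ (mulL2 σ a) := by
  rw [pairS_congr _ (mulL2_ae ((bddCont_const c).mul h) a), pairS_congr _ (mulL2_ae h a),
    ← integral_const_mul]
  simp only [mul_assoc, mul_left_comm c]

lemma mulL2_toLp {σ : E3 → ℂ} (h : IsSymbol σ) (ψ : 𝓢(E3, ℂ)) :
    mulL2 σ (ψ.toLp 2 volume) = (SchwartzMap.smulLeftCLM ℂ σ ψ).toLp 2 volume := by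
  refine Lp.ext ?_
  filter_upwards [mulL2_ae h.bddCont (ψ.toLp 2 volume), ψ.coeFn_toLp 2 volume,
    (SchwartzMap.smulLeftCLM ℂ σ ψ).coeFn_toLp 2 volume] with ξ h1 h2 h3
  rw [h1, h2, h3, SchwartzMap.smulLeftCLM_apply_apply h.temperate, smul_eq_mul]

lemma lineDeriv_smulLeft {σ : E3 → ℂ} (h : σ.HasTemperateGrowth) (ψ : 𝓢(E3, ℂ)) (j : Fin 3) (ξ : E3) :
    (∂_{ej j} (SchwartzMap.smulLeftCLM ℂ σ ψ)) ξ =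
      σ ξ * (∂_{ej j} ψ) ξ + fderiv ℝ σ ξ (ej j) * ψ ξ := by
  have e : ⇑(SchwartzMap.smulLeftCLM ℂ σ ψ) = fun ξ => σ ξ * ψ ξ := by
    funext ξ; rw [SchwartzMap.smulLeftCLM_apply_apply h, smul_eq_mul]
  rw [SchwartzMap.lineDerivOp_apply_eq_fderiv, e,
    fderiv_fun_mul (h.1.differentiable (by simp) ξ) ψ.differentiableAt,
    SchwartzMap.lineDerivOp_apply_eq_fderiv]
  simp [mul_comm]

lemma toLp_lineDeriv_smulLeft {σ : E3 → ℂ} (h : IsSymbol σ) (ψ : 𝓢(E3, ℂ)) (j : Fin 3) :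
    (∂_{ej j} (SchwartzMap.smulLeftCLM ℂ σ ψ)).toLp 2 volume =
      mulL2 σ ((∂_{ej j} ψ).toLp 2 volume) +
        mulL2 (fun ξ => fderiv ℝ σ ξ (ej j)) (ψ.toLp 2 volume) := by
  refine Lp.ext ?_
  filter_upwards [Lp.coeFn_add (mulL2 σ ((∂_{ej j} ψ).toLp 2 volume))
      (mulL2 (fun ξ => fderiv ℝ σ ξ (ej j)) (ψ.toLp 2 volume)),
    mulL2_ae h.bddCont ((∂_{ej j} ψ).toLp 2 volume),
    mulL2_ae (h.bddCont_deriv j) (ψ.toLp 2 volume),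
    (∂_{ej j} (SchwartzMap.smulLeftCLM ℂ σ ψ)).coeFn_toLp 2 volume,
    (∂_{ej j} ψ).coeFn_toLp 2 volume, ψ.coeFn_toLp 2 volume] with ξ h1 h2 h3 h4 h5 h6
  rw [h1, Pi.add_apply, h2, h3, h4, h5, h6, lineDeriv_smulLeft h.temperate]

/-- The action of a Fourier multiplier on `L² × (L²)³`. -/
def multAmb (N s : ℝ) (σ : E3 → ℂ) : (L2 × (Fin 3 → L2)) →L[ℝ] L2 × (Fin 3 → L2) :=
  ((mulL2 σ).comp (ContinuousLinearMap.fst ℝ _ _)).prod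
    (ContinuousLinearMap.pi fun j =>
      (mulL2 σ).comp ((ContinuousLinearMap.proj j).comp (ContinuousLinearMap.snd ℝ _ _)) -
        (mulL2 (dcoef N s σ j)).comp (ContinuousLinearMap.fst ℝ _ _))

variable {N s : ℝ}

lemma norm_fst_le (y : WSpace N s) : ‖y.1.1‖ ≤ ‖y‖ := _root_.norm_fst_le y.1

lemma norm_snd_le (y : WSpace N s) (j : Fin 3) : ‖y.1.2 j‖ ≤ ‖y‖ :=
  (norm_le_pi_norm _ j).trans (_root_.norm_snd_le y.1)

lemma norm_WSpace_le {y : WSpace N s} {C : ℝ} (h1 : ‖y.1.1‖ ≤ C) (h2 : ∀ j, ‖y.1.2 j‖ ≤ C) :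
    ‖y‖ ≤ C :=
  max_le h1 ((pi_norm_le_iff_of_nonneg ((norm_nonneg _).trans h1)).2 h2)

variable [hNs : Exps N s]

/-- Leibniz's rule on the Fourier side: `x_j σ(D) u` has transform `σ (x_j u)^ - (2πi)⁻¹ (∂_j σ) û`.
The second term, rewritten with the weights, is the correction by `dcoef`, bounded because `s ≤ N`.
-/
lemma multAmb_mem {σ : E3 → ℂ} (h : IsSymbol σ) {y : L2 × (Fin 3 → L2)} (hy : y ∈ WSpace N s) :
    multAmb N s σ y ∈ WSpace N s := by
  intro j ψ
  have hs := hNs.nonneg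
  have hN := hNs.six_lt
  have hwN : BddCont (wt (-N)) := bddCont_wt (by linarith)
  have hws : BddCont (wt (-s)) := bddCont_wt (by linarith)
  have hd := h.bddCont_deriv j
  -- The defining relation of `y` is tested with `σψ`, which is Schwartz since `σ` has temperate
  -- growth; differentiating `σψ` produces the commutator.
  have key := hy j (SchwartzMap.smulLeftCLM ℂ σ ψ)
  rw [pairS, pairS, toLp_lineDeriv_smulLeft h, ← mulL2_toLp h, map_add, add_apply,
    ← pairL2_mulL2 h.bddCont, ← pairL2_mulL2 h.bddCont, ← pairL2_mulL2 hd] at key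
  change tpi * pairS ψ (mulL2 (wt (-s)) (mulL2 σ (y.2 j) - mulL2 (dcoef N s σ j) y.1)) =
    pairS (∂_{ej j} ψ) (mulL2 (wt (-N)) (mulL2 σ y.1))
  rw [map_sub, map_sub, mulL2_mulL2 hws (h.bddCont_dcoef j)]
  have e : (fun ξ => wt (-s) ξ * dcoef N s σ j ξ) =
      fun ξ => tpi⁻¹ * (fderiv ℝ σ ξ (ej j) * wt (-N) ξ) := by
    funext ξ
    have : wt (-s) ξ * wt (s - N) ξ = wt (-N) ξ := by rw [wt_mul]; congr 1; ring
    rw [dcoef, ← this]; ring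
  rw [e, pairS_mulL2_const ψ (hd.mul hwN), ← mulL2_mulL2 hd hwN, mul_sub, ← mul_assoc,
    mul_inv_cancel₀ tpi_ne_zero, one_mul, mulL2_comm hws h.bddCont, mulL2_comm hwN h.bddCont]
  simp only [pairS]
  rw [key]
  ring

/-- The action of a Fourier multiplier on the weighted space. -/
def multY {σ : E3 → ℂ} (h : IsSymbol σ) : WSpace N s →L[ℝ] WSpace N s :=
  ((multAmb N s σ).comp (WSpace N s).subtypeL).codRestrict _ fun y => multAmb_mem h y.2

lemma multY_fst {σ : E3 → ℂ} (h : IsSymbol σ) (y : WSpace N s) :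
    (multY h y).1.1 = mulL2 σ y.1.1 := rfl

lemma multY_snd {σ : E3 → ℂ} (h : IsSymbol σ) (y : WSpace N s) (j : Fin 3) :
    (multY h y).1.2 j = mulL2 σ (y.1.2 j) - mulL2 (dcoef N s σ j) y.1.1 := rfl

lemma norm_multY_le {σ : E3 → ℂ} (h : IsSymbol σ) {A B : ℝ} (hA : ∀ ξ, ‖σ ξ‖ ≤ A)
    (hB : ∀ j ξ, ‖fderiv ℝ σ ξ (ej j)‖ ≤ 2 * Real.pi * B) (y : WSpace N s) :
    ‖multY h y‖ ≤ (A + B) * ‖y‖ := by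
  have hA0 : 0 ≤ A := (norm_nonneg _).trans (hA 0)
  have hB0 : 0 ≤ B := by
    have := (norm_nonneg _).trans (hB 0 0)
    exact nonneg_of_mul_nonneg_right this (by positivity)
  have h1 := norm_mulL2_le h.bddCont hA
  have h2 := fun j => norm_mulL2_le (h.bddCont_dcoef (N := N) (s := s) j)
    (fun ξ => norm_dcoef_le (hB j ξ))
  refine norm_WSpace_le ?_ fun j => ?_
  · rw [multY_fst]
    calc _ ≤ A * ‖y.1.1‖ := h1 _
      _ ≤ (A + B) * ‖y‖ := mul_le_mul (by linarith) (norm_fst_le y) (norm_nonneg _) (by linarith)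
  · rw [multY_snd]
    calc _ ≤ A * ‖y.1.2 j‖ + B * ‖y.1.1‖ := (norm_sub_le _ _).trans (add_le_add (h1 _) (h2 j _))
      _ ≤ A * ‖y‖ + B * ‖y‖ := by
        gcongr
        · exact norm_snd_le y j
        · exact norm_fst_le y
      _ = _ := by ring

/-! ### Complex conjugation -/

/-- The Schwartz function `conj ψ(-·)`. -/
def conjS (ψ : 𝓢(E3, ℂ)) : 𝓢(E3, ℂ) :=
  (SchwartzMap.compCLMOfContinuousLinearEquiv ℝ (ContinuousLinearEquiv.neg ℝ) ψ).postcompCLM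
    Complex.conjCLE.toContinuousLinearMap

lemma conjS_apply (ψ : 𝓢(E3, ℂ)) (ξ : E3) : conjS ψ ξ = (starRingEnd ℂ) (ψ (-ξ)) := rfl

/-- The sign from the reflection `ξ ↦ -ξ` is matched by the conjugate of `2πi`, which is why
conjugation preserves the weighted space. -/
lemma lineDeriv_conjS (ψ : 𝓢(E3, ℂ)) (j : Fin 3) :
    ∂_{ej j} (conjS ψ) = -conjS (∂_{ej j} ψ) := by
  ext ξ
  have h1 : HasFDerivAt (fun ξ : E3 => ψ (-ξ)) ((fderiv ℝ ψ (-ξ)).comp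
      (-ContinuousLinearMap.id ℝ E3)) ξ :=
    HasFDerivAt.comp ξ ψ.differentiableAt.hasFDerivAt (hasFDerivAt_id ξ).neg
  have h2 := Complex.conjCLE.toContinuousLinearMap.hasFDerivAt.comp ξ h1
  have h3 : HasFDerivAt (conjS ψ) _ ξ := h2
  rw [SchwartzMap.lineDerivOp_apply_eq_fderiv, h3.fderiv, neg_apply, conjS_apply,
    SchwartzMap.lineDerivOp_apply_eq_fderiv]
  simp

lemma conjL2_toLp (ψ : 𝓢(E3, ℂ)) : conjL2 (ψ.toLp 2 volume) = (conjS ψ).toLp 2 volume := by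
  refine Lp.ext ?_
  filter_upwards [conjL2_ae (ψ.toLp 2 volume), ae_neg (ψ.coeFn_toLp 2 volume),
    (conjS ψ).coeFn_toLp 2 volume] with ξ h1 h2 h3
  rw [h1, h2, h3, conjS_apply]

lemma pairL2_conjL2 (f a : L2) :
    pairL2 f (conjL2 a) = (starRingEnd ℂ) (pairL2 (conjL2 f) a) := by
  rw [pairL2_apply, pairL2_apply, ← integral_conj, ← integral_neg_eq_self]
  refine integral_congr_ae ?_
  filter_upwards [ae_neg (conjL2_ae a), conjL2_ae f] with ξ h1 h2
  rw [h1, h2, neg_neg, map_mul, Complex.conj_conj]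

lemma pairS_conjL2 (ψ : 𝓢(E3, ℂ)) (a : L2) :
    pairS ψ (conjL2 a) = (starRingEnd ℂ) (pairS (conjS ψ) a) := by
  rw [pairS, pairL2_conjL2, conjL2_toLp, pairS]

lemma conjL2_mulL2_wt {r : ℝ} (hr : r ≤ 0) (a : L2) :
    mulL2 (wt r) (conjL2 a) = conjL2 (mulL2 (wt r) a) :=
  (conjL2_mulL2 (bddCont_wt hr) (bddCont_wt hr) (fun ξ => by rw [conj_wt, wt_neg]) a).symm

/-- Complex conjugation in physical space, on the weighted space. -/
def conjY : WSpace N s →L[ℝ] WSpace N s :=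
  (((conjL2.comp (ContinuousLinearMap.fst ℝ _ _)).prod
    (ContinuousLinearMap.pi fun j =>
      conjL2.comp ((ContinuousLinearMap.proj j).comp (ContinuousLinearMap.snd ℝ _ _)))).comp
    (WSpace N s).subtypeL).codRestrict _ fun y j ψ => by
      have hs := hNs.nonneg
      have hN := hNs.six_lt
      change tpi * pairS ψ (mulL2 (wt (-s)) (conjL2 (y.1.2 j))) =
        pairS (∂_{ej j} ψ) (mulL2 (wt (-N)) (conjL2 y.1.1))
      rw [conjL2_mulL2_wt (by linarith), conjL2_mulL2_wt (by linarith), pairS_conjL2, pairS_conjL2]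
      have key := y.2 j (conjS ψ)
      have e : pairS (∂_{ej j} (conjS ψ)) = -pairS (conjS (∂_{ej j} ψ)) := by
        ext a
        rw [lineDeriv_conjS, neg_apply, pairS_apply, pairS_apply, ← integral_neg]
        simp
      rw [e, neg_apply] at key
      have := congrArg (starRingEnd ℂ) key
      simp only [map_mul, map_neg, Complex.conj_I, Complex.conj_ofReal, map_ofNat] at this
      simp only [tpi]
      linear_combination -this

lemma conjY_fst (y : WSpace N s) : (conjY y).1.1 = conjL2 y.1.1 := rfl

lemma norm_conjY_le (y : WSpace N s) : ‖conjY y‖ ≤ ‖y‖ := by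
  refine norm_WSpace_le ?_ fun j => ?_
  · rw [conjY_fst, norm_conjL2]; exact norm_fst_le y
  · change ‖conjL2 (y.1.2 j)‖ ≤ _
    rw [norm_conjL2]; exact norm_snd_le y j

/-! ### Products -/

lemma ennreal_mul_le_sq_add_sq (x y : ℝ≥0∞) : x * y ≤ x ^ 2 + y ^ 2 := by
  rcases le_total x y with h | h
  · exact (mul_le_mul_left h y).trans (by rw [sq y]; exact le_add_self)
  · exact (mul_le_mul_right h x).trans (by rw [sq x]; exact le_self_add)

lemma integrable_schwartz_conv (ψ : 𝓢(E3, ℂ)) {h w : E3 → ℂ} (hm : Measurable h)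
    (wm : Measurable w) (hi : Integrable h) (hw : MemLp w 2) :
    Integrable (fun p : E3 × E3 => ψ p.1 * (h p.2 * w (p.1 - p.2))) (volume.prod volume) := by
  have hψ : Measurable ψ := ψ.continuous.measurable
  have hmeas : Measurable fun p : E3 × E3 => ψ p.1 * (h p.2 * w (p.1 - p.2)) :=
    (hψ.comp measurable_fst).mul
      ((hm.comp measurable_snd).mul (wm.comp (measurable_fst.sub measurable_snd)))
  refine ⟨hmeas.aestronglyMeasurable, ?_⟩
  rw [HasFiniteIntegral, lintegral_prod_symm _ hmeas.enorm.aemeasurable]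
  have h1 : ∀ η, ∫⁻ ξ, ‖ψ ξ * (h η * w (ξ - η))‖ₑ ≤
      ‖h η‖ₑ * ((∫⁻ ξ, ‖ψ ξ‖ₑ ^ 2) + ∫⁻ ξ, ‖w ξ‖ₑ ^ 2) := fun η => by
    rw [← lintegral_sub_right_eq_self (fun ξ => ‖w ξ‖ₑ ^ 2) η,
      ← lintegral_add_left (hψ.enorm.pow_const 2), ← lintegral_const_mul' _ _ enorm_ne_top]
    refine lintegral_mono fun ξ => ?_
    rw [enorm_mul, enorm_mul, mul_left_comm]
    gcongr
    exact ennreal_mul_le_sq_add_sq _ _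
  refine (lintegral_mono h1).trans_lt ?_
  rw [lintegral_mul_const _ hm.enorm]
  exact ENNReal.mul_lt_top hi.2 (ENNReal.add_lt_top.2
    ⟨lintegral_enorm_sq_lt_top (ψ.memLp 2 volume), lintegral_enorm_sq_lt_top hw⟩)

/-- Testing a convolution amounts to averaging tests of `w` against translates of `ψ`. Weak
derivatives of `w` therefore pass to `h * w` without differentiating `h`. -/
lemma integral_schwartz_conv (ψ : 𝓢(E3, ℂ)) {h w : E3 → ℂ} (hm : Measurable h)
    (wm : Measurable w) (hi : Integrable h) (hw : MemLp w 2) :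
    ∫ ξ, ψ ξ * conv h w ξ = ∫ η, h η * ∫ ξ, ψ (ξ + η) * w ξ := by
  simp only [conv, ← integral_const_mul]
  rw [integral_integral_swap (integrable_schwartz_conv ψ hm wm hi hw)]
  refine integral_congr_ae (ae_of_all _ fun η => ?_)
  simp only
  rw [← integral_add_right_eq_self (fun ξ => ψ ξ * (h η * w (ξ - η))) η]
  simp only [add_sub_cancel_right]
  exact integral_congr_ae (ae_of_all _ fun ξ => by ring)

lemma Exps.convExp_self {N s : ℝ} (hNs : Exps N s) : ConvExp N N :=
  ⟨by linarith [hNs.six_lt], by linarith [hNs.six_lt], Or.inl rfl⟩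

lemma Exps.convExp {N s : ℝ} (hNs : Exps N s) : ConvExp N s := ⟨hNs.nonneg, by linarith [hNs.six_lt], Or.inr hNs.le⟩

lemma pairS_translate (ψ : 𝓢(E3, ℂ)) (η : E3) {a : L2} {f : E3 → ℂ} (h : a =ᵐ[volume] f) :
    ∫ ξ, ψ (ξ + η) * f ξ = pairS (ψ.compSubConstCLM ℝ (-η)) a := by
  rw [pairS_congr _ h]
  simp

lemma lineDeriv_translate (ψ : 𝓢(E3, ℂ)) (η : E3) (j : Fin 3) :
    ∂_{ej j} (ψ.compSubConstCLM ℝ η) = (∂_{ej j} ψ).compSubConstCLM ℝ η := by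
  ext ξ
  have e : ⇑(ψ.compSubConstCLM ℝ η) = fun x => ψ (x - η) := rfl
  rw [SchwartzMap.lineDerivOp_apply_eq_fderiv, e, fderiv_comp_sub, SchwartzMap.compSubConstCLM_apply,
    SchwartzMap.lineDerivOp_apply_eq_fderiv]

/-- This is `x_j (fg) = (x_j f) g`: the coordinate is given to `y` alone, and `z` enters only
through its `H^N` component. On the Fourier side, the relation for `y` is applied to each translate
of the test function and integrated against the transform of `z`. -/
lemma prod_mem (y z : WSpace N s) :
    ((wconv hNs.convExp_self z.1.1 y.1.1,
      fun j => wconv hNs.convExp z.1.1 (y.1.2 j)) : L2 × (Fin 3 → L2)) ∈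
      WSpace N s := by
  intro j ψ
  have hs := hNs.nonneg
  have hN := hNs.six_lt
  have hwN : BddCont (wt (-N)) := bddCont_wt (by linarith)
  have hws : BddCont (wt (-s)) := bddCont_wt (by linarith)
  have m : ∀ (r : ℝ) (c : L2), Measurable fun η => wt r η * c η := fun r c =>
    (continuous_wt r).measurable.mul (measurable_coe c)
  simp only
  rw [pairS_congr ψ ((mulL2_ae hws _).trans (wt_neg_mul_wconv_ae hNs.convExp z.1.1 (y.1.2 j))),
    pairS_congr _ ((mulL2_ae hwN _).trans (wt_neg_mul_wconv_ae hNs.convExp_self z.1.1 y.1.1)),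
    integral_schwartz_conv ψ (m _ _) (m _ _) (integrable_wt_mul (by linarith) _)
      (memLp_wt_mul (by linarith) _),
    integral_schwartz_conv _ (m _ _) (m _ _) (integrable_wt_mul (by linarith) _)
      (memLp_wt_mul (by linarith) _), ← integral_const_mul]
  refine integral_congr_ae (ae_of_all _ fun η => ?_)
  simp only
  rw [pairS_translate ψ η (mulL2_ae hws _), pairS_translate _ η (mulL2_ae hwN _),
    ← lineDeriv_translate, ← y.2 j]
  ring

/-- The bound of the product. -/
def prodConst (N s : ℝ) [hNs : Exps N s] : ℝ :=
  ‖wconv hNs.convExp_self‖ + ‖wconv hNs.convExp‖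

lemma prodConst_nonneg (N s : ℝ) [hNs : Exps N s] : 0 ≤ prodConst N s :=
  add_nonneg (norm_nonneg (wconv hNs.convExp_self)) (norm_nonneg (wconv hNs.convExp))

lemma norm_prod_le (y z : WSpace N s) :
    ‖(⟨_, prod_mem y z⟩ : WSpace N s)‖ ≤ prodConst N s * ‖y‖ * ‖z‖ := by
  have h0 := norm_nonneg (wconv hNs.convExp_self)
  have h1 := norm_nonneg (wconv hNs.convExp)
  have h2 : 0 ≤ prodConst N s := add_nonneg h0 h1
  refine norm_WSpace_le ?_ fun j => ?_
  · calc _ ≤ _ := ContinuousLinearMap.le_opNorm₂ (wconv hNs.convExp_self) z.1.1 y.1.1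
      _ ≤ prodConst N s * ‖z‖ * ‖y‖ := by
        gcongr
        · exact le_add_of_nonneg_right h1
        · exact norm_fst_le z
        · exact norm_fst_le y
      _ = _ := by ring
  · calc _ ≤ _ := ContinuousLinearMap.le_opNorm₂ (wconv hNs.convExp) z.1.1 (y.1.2 j)
      _ ≤ prodConst N s * ‖z‖ * ‖y‖ := by
        gcongr
        · exact le_add_of_nonneg_left h0
        · exact norm_fst_le z
        · exact norm_snd_le y j
      _ = _ := by ring

/-- The pointwise product in physical space, on the weighted space. -/
def prodY : WSpace N s →L[ℝ] WSpace N s →L[ℝ] WSpace N s :=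
  LinearMap.mkContinuous₂
    (LinearMap.mk₂ ℝ (fun y z => (⟨_, prod_mem y z⟩ : WSpace N s))
      (fun y y' z => by ext1; simp; rfl)
      (fun c y z => by ext1; simp; rfl)
      (fun y z z' => by ext1; simp; rfl)
      (fun c y z => by ext1; simp; rfl))
    (prodConst N s) norm_prod_le

lemma norm_prodY_le (y z : WSpace N s) : ‖prodY y z‖ ≤ prodConst N s * ‖y‖ * ‖z‖ :=
  norm_prod_le y z

lemma prodY_fst (y z : WSpace N s) :
    (prodY y z).1.1 = wconv hNs.convExp_self z.1.1 y.1.1 := rfl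

end

end KleinGordonEFT

/-! ### Operators of the system, with bounds uniform in the mass. -/

namespace KleinGordonEFT

noncomputable section

/-! ### The symbols of the system -/

lemma hasFDerivAt_mul_ofReal (c : ℂ) {f : E3 → ℝ} {f' : E3 →L[ℝ] ℝ} {ξ : E3}
    (h : HasFDerivAt f f' ξ) :
    HasFDerivAt (fun ξ => c * (f ξ : ℂ)) (c • Complex.ofRealCLM.comp f') ξ :=
  (Complex.ofRealCLM.hasFDerivAt.comp ξ h).const_mul c

lemma norm_fderiv_mul_ofReal_le (c : ℂ) {f : E3 → ℝ} {f' : E3 →L[ℝ] ℝ} {ξ : E3}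
    (h : HasFDerivAt f f' ξ) {B : ℝ} {v : E3} (hB : |f' v| ≤ B) :
    ‖fderiv ℝ (fun ξ => c * (f ξ : ℂ)) ξ v‖ ≤ ‖c‖ * B := by
  rw [(hasFDerivAt_mul_ofReal c h).fderiv]
  simp only [smul_apply, ContinuousLinearMap.comp_apply, smul_eq_mul, norm_mul,
    Complex.ofRealCLM_apply, Complex.norm_real, Real.norm_eq_abs]
  gcongr

lemma norm_ej (j : Fin 3) : ‖ej j‖ = 1 := by simp [ej]

/-- The symbol of `(2i⟨D⟩_m)^{-1}`. -/
def fieldSym (m : ℝ) (ξ : E3) : ℂ := -(Complex.I / 2) * (((bracket m ξ)⁻¹ : ℝ) : ℂ)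

lemma hasFDerivAt_inv_bracket {m : ℝ} (hm : 0 < m) (ξ : E3) :
    HasFDerivAt (fun ξ => (bracket m ξ)⁻¹)
      (-(bracket m ξ ^ 2)⁻¹ • fderiv ℝ (bracket m) ξ) ξ := by
  have h := (hasDerivAt_inv (bracket_pos hm ξ).ne').comp_hasFDerivAt ξ
    (hasFDerivAt_bracket hm ξ).differentiableAt.hasFDerivAt
  exact h

lemma inv_bracket_le_one {m : ℝ} (hm : 1 ≤ m) (ξ : E3) : (bracket m ξ)⁻¹ ≤ 1 :=
  inv_le_one_of_one_le₀ (one_le_bracket hm ξ)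

lemma hasTemperateGrowth_inv_bracket {m : ℝ} (hm : 0 < m) :
    (fun ξ : E3 => (bracket m ξ)⁻¹).HasTemperateGrowth := by
  simpa only [Real.rpow_neg_one] using hasTemperateGrowth_bracket_rpow hm (-1)

lemma hasTemperateGrowth_mul_ofReal (c : ℂ) {f : E3 → ℝ} (h : f.HasTemperateGrowth) :
    (fun ξ => c * (f ξ : ℂ)).HasTemperateGrowth :=
  (Function.HasTemperateGrowth.const c).mul (Complex.ofRealCLM.hasTemperateGrowth.comp h)

lemma norm_fieldSym_le {m : ℝ} (hm : 1 ≤ m) (ξ : E3) : ‖fieldSym m ξ‖ ≤ 1 / 2 := by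
  have h := bracket_pos (one_pos.trans_le hm) ξ
  rw [fieldSym, norm_mul, Complex.norm_of_nonneg (by positivity)]
  have := inv_bracket_le_one hm ξ
  norm_num
  linarith

/-- Only `⟨ξ⟩_m ≥ 1` is used. The gain of `1/M` that `⟨D⟩_M⁻¹` offers on the heavy field is given up
here; the smallness of the data suffices. -/
lemma norm_fderiv_fieldSym_le {m : ℝ} (hm : 1 ≤ m) (j : Fin 3) (ξ : E3) :
    ‖fderiv ℝ (fieldSym m) ξ (ej j)‖ ≤ 2 * Real.pi * (1 / 2) := by
  have hm0 := one_pos.trans_le hm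
  have h := bracket_pos hm0 ξ
  have h1 : |(-(bracket m ξ ^ 2)⁻¹ • fderiv ℝ (bracket m) ξ) (ej j)| ≤ 2 * Real.pi := by
    have h2 := abs_fderiv_bracket_le hm0 ξ (ej j)
    rw [norm_ej, mul_one] at h2
    rw [smul_apply, smul_eq_mul, abs_mul, abs_neg, abs_of_pos (by positivity)]
    exact (mul_le_of_le_one_left (abs_nonneg _)
      (inv_le_one_of_one_le₀ (one_le_pow₀ (one_le_bracket hm ξ)))).trans h2
  refine (norm_fderiv_mul_ofReal_le _ (hasFDerivAt_inv_bracket hm0 ξ) h1).trans_eq ?_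
  norm_num; ring

lemma isSymbol_fieldSym {m : ℝ} (hm : 1 ≤ m) : IsSymbol (fieldSym m) :=
  ⟨hasTemperateGrowth_mul_ofReal _ (hasTemperateGrowth_inv_bracket (one_pos.trans_le hm)),
    ⟨_, norm_fieldSym_le hm⟩, ⟨_, norm_fderiv_fieldSym_le hm⟩⟩

/-- The symbol of `∂_j (2i⟨D⟩)^{-1}`. -/
def derSym (j : Fin 3) (ξ : E3) : ℂ := (Real.pi : ℂ) * ((ξ j * (bracket 1 ξ)⁻¹ : ℝ) : ℂ)

lemma abs_coord_le (ξ : E3) (j : Fin 3) : |ξ j| ≤ ‖ξ‖ := by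
  simpa using PiLp.norm_apply_le ξ j

lemma norm_derSym_le (j : Fin 3) (ξ : E3) : ‖derSym j ξ‖ ≤ 1 / 2 := by
  have h := bracket_pos one_pos ξ
  rw [derSym, norm_mul, Complex.norm_of_nonneg Real.pi_pos.le, Complex.norm_real, Real.norm_eq_abs,
    abs_mul, abs_inv, abs_of_pos h, ← mul_assoc, ← div_eq_mul_inv, div_le_iff₀ h]
  have h1 := norm_le_bracket 1 ξ
  have h2 := abs_coord_le ξ j
  nlinarith [Real.pi_pos]

lemma norm_fderiv_derSym_le (j i : Fin 3) (ξ : E3) :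
    ‖fderiv ℝ (derSym j) ξ (ej i)‖ ≤ 2 * Real.pi * 1 := by
  have h := bracket_pos one_pos ξ
  have hb := one_le_bracket le_rfl ξ
  have h0 : HasFDerivAt (fun ξ : E3 => ξ j) (EuclideanSpace.proj j : E3 →L[ℝ] ℝ) ξ :=
    (EuclideanSpace.proj j : E3 →L[ℝ] ℝ).hasFDerivAt
  have h1 := h0.mul (hasFDerivAt_inv_bracket one_pos ξ)
  have h2 := abs_fderiv_bracket_le one_pos ξ (ej i)
  rw [norm_ej, mul_one] at h2
  have h3 : |(ξ j • (-(bracket 1 ξ ^ 2)⁻¹ • fderiv ℝ (bracket 1) ξ) +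
      (bracket 1 ξ)⁻¹ • (EuclideanSpace.proj j : E3 →L[ℝ] ℝ)) (ej i)| ≤ 2 := by
    change |ξ j * (-(bracket 1 ξ ^ 2)⁻¹ * fderiv ℝ (bracket 1) ξ (ej i)) +
      (bracket 1 ξ)⁻¹ * (ej i).ofLp j| ≤ 2
    refine (abs_add_le _ _).trans ?_
    have e1 : |(bracket 1 ξ)⁻¹ * (ej i).ofLp j| ≤ 1 := by
      rw [abs_mul, abs_of_pos (by positivity)]
      have : |(ej i).ofLp j| ≤ 1 := (abs_coord_le _ _).trans_eq (norm_ej i)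
      exact mul_le_one₀ (inv_bracket_le_one le_rfl ξ) (abs_nonneg _) this
    have e2 : |ξ j * (-(bracket 1 ξ ^ 2)⁻¹ * fderiv ℝ (bracket 1) ξ (ej i))| ≤ 1 := by
      rw [abs_mul, abs_mul, abs_neg, abs_of_pos (by positivity : 0 < (bracket 1 ξ ^ 2)⁻¹),
        mul_left_comm, inv_mul_le_iff₀ (by positivity)]
      calc |ξ j| * |fderiv ℝ (bracket 1) ξ (ej i)| ≤ ‖ξ‖ * (2 * Real.pi) := by
            gcongr; exact abs_coord_le ξ j
        _ ≤ bracket 1 ξ := by rw [mul_comm]; exact norm_le_bracket 1 ξ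
        _ ≤ bracket 1 ξ ^ 2 * 1 := by nlinarith
    linarith
  refine (norm_fderiv_mul_ofReal_le _ h1 h3).trans_eq ?_
  rw [Complex.norm_of_nonneg Real.pi_pos.le]; ring

lemma isSymbol_derSym (j : Fin 3) : IsSymbol (derSym j) := by
  have h : (fun ξ : E3 => ξ j).HasTemperateGrowth :=
    (EuclideanSpace.proj j : E3 →L[ℝ] ℝ).hasTemperateGrowth
  exact ⟨hasTemperateGrowth_mul_ofReal _ (h.mul (hasTemperateGrowth_inv_bracket one_pos)),
    ⟨_, norm_derSym_le j⟩, ⟨_, norm_fderiv_derSym_le j⟩⟩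

/-- The symbol of `e^{it⟨D⟩_m}`. -/
def expSym (m t : ℝ) (ξ : E3) : ℂ := Complex.exp (((t * bracket m ξ : ℝ) : ℂ) * Complex.I)

lemma norm_expSym (m t : ℝ) (ξ : E3) : ‖expSym m t ξ‖ = 1 := Complex.norm_exp_ofReal_mul_I _

lemma fderiv_expSym {m : ℝ} (hm : 0 < m) (t : ℝ) (ξ v : E3) :
    fderiv ℝ (expSym m t) ξ v =
      expSym m t ξ * (((t * fderiv ℝ (bracket m) ξ v : ℝ) : ℂ) * Complex.I) := by
  have h1 := ((hasFDerivAt_bracket hm ξ).differentiableAt.hasFDerivAt).const_mul t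
  have h2 := ((Complex.ofRealCLM.hasFDerivAt.comp ξ h1).mul_const Complex.I).cexp
  have h3 : HasFDerivAt (expSym m t) _ ξ := h2
  rw [h3.fderiv]
  simp [expSym]
  ring

/-- Differentiating the phase costs a factor `t`: weights grow linearly under the flow, by at most a
factor 2 on unit time, whatever the mass. -/
lemma norm_fderiv_expSym_le {m : ℝ} (hm : 0 < m) (t : ℝ) (j : Fin 3) (ξ : E3) :
    ‖fderiv ℝ (expSym m t) ξ (ej j)‖ ≤ 2 * Real.pi * |t| := by
  have h2 := abs_fderiv_bracket_le hm ξ (ej j)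
  rw [norm_ej, mul_one] at h2
  rw [fderiv_expSym hm, norm_mul, norm_expSym, norm_mul, Complex.norm_I, Complex.norm_real,
    Real.norm_eq_abs, abs_mul, one_mul, mul_one, mul_comm]
  gcongr

lemma isSymbol_expSym {m : ℝ} (hm : 0 < m) (t : ℝ) : IsSymbol (expSym m t) :=
  ⟨hasTemperateGrowth_exp_bracket hm t, ⟨1, fun ξ => (norm_expSym m t ξ).le⟩,
    ⟨_, norm_fderiv_expSym_le hm t⟩⟩

lemma expSym_add (m t t' : ℝ) (ξ : E3) : expSym m t ξ * expSym m t' ξ = expSym m (t + t') ξ := by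
  rw [expSym, expSym, expSym, ← Complex.exp_add]
  congr 1; push_cast; ring

lemma expSym_zero (m : ℝ) (ξ : E3) : expSym m 0 ξ = 1 := by simp [expSym]

/-! ### The operators of the system -/

variable {N s : ℝ} [hNs : Exps N s]

/-- `u ↦ ⟨D⟩_m^{-1} Im u`. -/
def fieldY {m : ℝ} (hm : 1 ≤ m) : WSpace N s →L[ℝ] WSpace N s :=
  (multY (isSymbol_fieldSym hm)).comp (ContinuousLinearMap.id ℝ _ - conjY)

/-- `u ↦ Re u`. -/
def dtY : WSpace N s →L[ℝ] WSpace N s := (1 / 2 : ℝ) • (ContinuousLinearMap.id ℝ _ + conjY)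

/-- `u ↦ ∂_j ⟨D⟩^{-1} Im u`. -/
def djY (j : Fin 3) : WSpace N s →L[ℝ] WSpace N s :=
  (multY (isSymbol_derSym j)).comp (ContinuousLinearMap.id ℝ _ - conjY)

/-- `e^{it⟨D⟩_m}`. -/
def evolY {m : ℝ} (hm : 1 ≤ m) (t : ℝ) : WSpace N s →L[ℝ] WSpace N s :=
  multY (isSymbol_expSym (one_pos.trans_le hm) t)

lemma norm_sub_conjY_le (y : WSpace N s) : ‖y - conjY y‖ ≤ 2 * ‖y‖ :=
  (norm_sub_le _ _).trans (by linarith [norm_conjY_le y])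

lemma norm_fieldY_le {m : ℝ} (hm : 1 ≤ m) (y : WSpace N s) : ‖fieldY hm y‖ ≤ 2 * ‖y‖ := by
  have := norm_multY_le (isSymbol_fieldSym hm) (norm_fieldSym_le hm)
    (norm_fderiv_fieldSym_le hm) (y - conjY y)
  calc _ ≤ _ := this
    _ ≤ 2 * ‖y‖ := by linarith [norm_sub_conjY_le y]

lemma norm_djY_le (j : Fin 3) (y : WSpace N s) : ‖djY j y‖ ≤ 3 * ‖y‖ := by
  have := norm_multY_le (isSymbol_derSym j) (norm_derSym_le j)
    (norm_fderiv_derSym_le j) (y - conjY y)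
  calc _ ≤ _ := this
    _ ≤ 3 * ‖y‖ := by linarith [norm_sub_conjY_le y]

lemma norm_dtY_le (y : WSpace N s) : ‖dtY y‖ ≤ ‖y‖ := by
  change ‖(1 / 2 : ℝ) • (y + conjY y)‖ ≤ _
  rw [norm_smul]
  have := (norm_add_le y (conjY y)).trans (add_le_add_right (norm_conjY_le y) _)
  rw [Real.norm_of_nonneg (by norm_num)]
  linarith

lemma norm_evolY_le {m : ℝ} (hm : 1 ≤ m) (t : ℝ) (y : WSpace N s) :
    ‖evolY hm t y‖ ≤ (1 + |t|) * ‖y‖ :=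
  norm_multY_le _ (fun ξ => (norm_expSym m t ξ).le)
    (norm_fderiv_expSym_le (one_pos.trans_le hm) t) y

-- Dominated convergence gives strong continuity. Continuity in operator norm cannot be expected,
-- since the symbols need not converge uniformly in `ξ`.
open Filter Topology in
lemma continuousAt_mulL2 {σ : ℝ → E3 → ℂ} (hb : ∀ t, BddCont (σ t))
    (hc : ∀ ξ, Continuous fun t => σ t ξ) {t₀ C : ℝ} (hC : ∀ᶠ t in 𝓝 t₀, ∀ ξ, ‖σ t ξ‖ ≤ C)
    (a : L2) : ContinuousAt (fun t => mulL2 (σ t) a) t₀ := by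
  rw [ContinuousAt, tendsto_iff_edist_tendsto_0]
  have h1 : ∀ t, edist (mulL2 (σ t) a) (mulL2 (σ t₀) a) ^ 2 =
      ∫⁻ ξ, ‖(σ t ξ - σ t₀ ξ) * a ξ‖ₑ ^ 2 := fun t => by
    rw [edist_eq_enorm_sub, enorm_sq_eq_lintegral]
    refine lintegral_congr_ae ?_
    filter_upwards [Lp.coeFn_sub (mulL2 (σ t) a) (mulL2 (σ t₀) a), mulL2_ae (hb t) a,
      mulL2_ae (hb t₀) a] with ξ h1 h2 h3
    rw [h1, Pi.sub_apply, h2, h3, sub_mul]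
  have h2 : Tendsto (fun t => ∫⁻ ξ, ‖(σ t ξ - σ t₀ ξ) * a ξ‖ₑ ^ 2) (𝓝 t₀) (𝓝 0) := by
    have h3 := tendsto_lintegral_filter_of_dominated_convergence (μ := (volume : Measure E3))
      (l := 𝓝 t₀) (F := fun t ξ => ‖(σ t ξ - σ t₀ ξ) * a ξ‖ₑ ^ 2) (f := fun _ => 0)
      (fun ξ => (ENNReal.ofReal (C + C) * ‖a ξ‖ₑ) ^ 2)
      (Eventually.of_forall fun t => ((((hb t).1.sub (hb t₀).1).measurable.mul
        (measurable_coe a)).enorm.pow_const 2))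
      (by
        filter_upwards [hC] with t ht
        refine ae_of_all _ fun ξ => ?_
        rw [enorm_mul]
        gcongr
        rw [← ofReal_norm]
        exact ENNReal.ofReal_le_ofReal
          ((norm_sub_le _ _).trans (add_le_add (ht ξ) (hC.self_of_nhds ξ))))
      (by
        simp only [mul_pow]
        rw [lintegral_const_mul' _ _ (by finiteness), ← enorm_sq_eq_lintegral]
        finiteness)
      (ae_of_all _ fun ξ => by
        have : Continuous fun t => ‖(σ t ξ - σ t₀ ξ) * a ξ‖ₑ ^ 2 := by
          have := hc ξ; fun_prop
        simpa using this.tendsto t₀)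
    simpa using h3
  have h3 := h2.congr fun t => (h1 t).symm
  have h4 := (ENNReal.continuous_rpow_const (y := (1 / 2 : ℝ))).tendsto 0 |>.comp h3
  rw [ENNReal.zero_rpow_of_pos (by norm_num)] at h4
  refine h4.congr fun t => ?_
  simp only [Function.comp]
  rw [← ENNReal.rpow_natCast, ← ENNReal.rpow_mul]
  norm_num

lemma continuous_evolY {m : ℝ} (hm : 1 ≤ m) (y : WSpace N s) :
    Continuous fun t => evolY hm t y := by
  have hm0 := one_pos.trans_le hm
  have hc : ∀ ξ, Continuous fun t => expSym m t ξ := fun ξ => by unfold expSym; fun_prop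
  have h1 : ∀ a : L2, Continuous fun t => mulL2 (expSym m t) a := fun a =>
    continuous_iff_continuousAt.2 fun t₀ => continuousAt_mulL2
      (fun t => (isSymbol_expSym hm0 t).bddCont) hc
      (Filter.Eventually.of_forall fun t ξ => (norm_expSym m t ξ).le) a
  refine Continuous.subtype_mk (Continuous.prodMk (h1 _) (continuous_pi fun j => ?_)) _
  refine (h1 _).sub (continuous_iff_continuousAt.2 fun t₀ => continuousAt_mulL2
      (fun t => (isSymbol_expSym hm0 t).bddCont_dcoef (N := N) (s := s) j) (fun ξ => ?_)
      (C := |t₀| + 1) ?_ _)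
  · simp only [dcoef, fderiv_expSym hm0]
    have := hc ξ
    fun_prop
  · have : ∀ᶠ t in nhds t₀, |t| < |t₀| + 1 :=
      continuous_abs.continuousAt.eventually_lt continuousAt_const (by simp)
    filter_upwards [this] with t ht ξ
    exact (norm_dcoef_le (norm_fderiv_expSym_le hm0 t j ξ)).trans ht.le

/-- Strong continuity in time together with a Lipschitz constant 2 in the vector, uniform for `|t| ≤
1`, gives joint continuity; this allows the argument to move with time. -/
lemma continuousOn_evolY {m : ℝ} (hm : 1 ≤ m) {f : ℝ → ℝ} {g : ℝ → WSpace N s} {S : Set ℝ}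
    (hf : ContinuousOn f S) (hfS : MapsTo f S (Icc (-1) 1)) (hg : ContinuousOn g S) :
    ContinuousOn (fun t => evolY hm (f t) (g t)) S := by
  have hl : ∀ t ∈ Icc (-1 : ℝ) 1, LipschitzOnWith 2 (evolY (N := N) (s := s) hm t) univ :=
    fun t ht => LipschitzOnWith.of_dist_le_mul fun x _ y _ => by
      rw [dist_eq_norm, dist_eq_norm, ← map_sub]
      refine (norm_evolY_le hm t (x - y)).trans ?_
      have := abs_le.2 ht
      gcongr
      push_cast
      linarith
  have h := continuousOn_prod_of_continuousOn_lipschitzOnWith'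
    (fun p : ℝ × WSpace N s => evolY hm p.1 p.2) 2 hl
    (fun y _ => (continuous_evolY hm y).continuousOn)
  exact ContinuousOn.comp (g := fun p : ℝ × WSpace N s => evolY hm p.1 p.2)
    (f := fun t => (f t, g t)) h (hf.prodMk hg) fun t ht => ⟨hfS ht, mem_univ _⟩

lemma evolY_neg {m : ℝ} (hm : 1 ≤ m) (t : ℝ) (y : WSpace N s) :
    (evolY hm t (evolY hm (-t) y)).1.1 = y.1.1 := by
  have h := fun t => (isSymbol_expSym (one_pos.trans_le hm) t).bddCont
  change mulL2 (expSym m t) (mulL2 (expSym m (-t)) y.1.1) = _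
  rw [mulL2_mulL2 (h _) (h _)]
  refine Lp.ext ?_
  filter_upwards [mulL2_ae ((h t).mul (h (-t))) y.1.1] with ξ h1
  rw [h1, expSym_add, add_neg_cancel, expSym_zero, one_mul]

end

end KleinGordonEFT

/-! ### The source as a polynomial map and the solution of the profile equation. -/

namespace KleinGordonEFT

noncomputable section

/-! ### The nonlinearity -/

variable {N s : ℝ} [hNs : Exps N s]

/-- The light source `-(UV - U³/2)`. -/
def lightY {M : ℝ} (hM : 1 ≤ M) (u v : WSpace N s) : WSpace N s :=
  (1 / 2 : ℝ) • prodY (fieldY le_rfl u) (prodY (fieldY le_rfl u) (fieldY le_rfl u)) -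
    prodY (fieldY le_rfl u) (fieldY hM v)

/-- The heavy source `-(U²V - U⁴/2 + ∂U·∂U)`. -/
def heavyY {M : ℝ} (hM : 1 ≤ M) (u v : WSpace N s) : WSpace N s :=
  (1 / 2 : ℝ) • prodY (prodY (fieldY le_rfl u) (fieldY le_rfl u))
      (prodY (fieldY le_rfl u) (fieldY le_rfl u)) -
    prodY (prodY (fieldY le_rfl u) (fieldY le_rfl u)) (fieldY hM v) +
    prodY (dtY u) (dtY u) - ∑ j, prodY (djY j u) (djY j u)

/-- Functions that are bounded and Lipschitz on the ball of radius `R`. -/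
def LipBdd {E F : Type*} [NormedAddCommGroup E] [NormedAddCommGroup F] (R : ℝ) (f : E → F) : Prop :=
  ∃ C K : ℝ, 0 ≤ C ∧ 0 ≤ K ∧ (∀ x, ‖x‖ ≤ R → ‖f x‖ ≤ C) ∧
    ∀ x y, ‖x‖ ≤ R → ‖y‖ ≤ R → ‖f x - f y‖ ≤ K * ‖x - y‖

section LipBdd

variable {E F G H : Type*} [NormedAddCommGroup E] [NormedAddCommGroup F] [NormedAddCommGroup G]
  [NormedAddCommGroup H]

lemma LipBdd.clm [NormedSpace ℝ E] [NormedSpace ℝ F] {R : ℝ} (hR : 0 ≤ R) (L : E →L[ℝ] F) : LipBdd R L :=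
  ⟨‖L‖ * R, ‖L‖, by positivity, norm_nonneg _,
    fun x hx => (L.le_opNorm x).trans (by gcongr),
    fun x y _ _ => by rw [← map_sub]; exact L.le_opNorm _⟩

lemma LipBdd.add {R : ℝ} {f g : E → F} (hf : LipBdd R f) (hg : LipBdd R g) :
    LipBdd R fun x => f x + g x := by
  obtain ⟨C, K, hC, hK, h1, h2⟩ := hf
  obtain ⟨C', K', hC', hK', h1', h2'⟩ := hg
  refine ⟨C + C', K + K', by positivity, by positivity,
    fun x hx => norm_add_le_of_le (h1 x hx) (h1' x hx), fun x y hx hy => ?_⟩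
  rw [add_sub_add_comm, add_mul]
  exact norm_add_le_of_le (h2 x y hx hy) (h2' x y hx hy)

lemma LipBdd.clm_comp [NormedSpace ℝ F] [NormedSpace ℝ G] {R : ℝ} (L : F →L[ℝ] G) {f : E → F} (hf : LipBdd R f) :
    LipBdd R fun x => L (f x) := by
  obtain ⟨C, K, hC, hK, h1, h2⟩ := hf
  refine ⟨‖L‖ * C, ‖L‖ * K, by positivity, by positivity,
    fun x hx => L.le_opNorm_of_le (h1 x hx), fun x y hx hy => ?_⟩
  rw [← map_sub, mul_assoc]
  exact L.le_opNorm_of_le (h2 x y hx hy)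

/-- The difference of products is telescoped; each term uses the bound of one factor and the
Lipschitz constant of the other. This is why boundedness is carried along with the Lipschitz
property. -/
lemma LipBdd.bilin [NormedSpace ℝ F] [NormedSpace ℝ G] [NormedSpace ℝ H] {R : ℝ}
    (B : F →L[ℝ] G →L[ℝ] H) {f : E → F} {g : E → G} (hf : LipBdd R f)
    (hg : LipBdd R g) : LipBdd R fun x => B (f x) (g x) := by
  obtain ⟨C, K, hC, hK, h1, h2⟩ := hf
  obtain ⟨C', K', hC', hK', h1', h2'⟩ := hg
  refine ⟨‖B‖ * C * C', ‖B‖ * K * C' + ‖B‖ * C * K', by positivity, by positivity,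
    fun x hx => B.le_of_opNorm₂_le_of_le le_rfl (h1 x hx) (h1' x hx), fun x y hx hy => ?_⟩
  have e : B (f x) (g x) - B (f y) (g y) = B (f x - f y) (g x) + B (f y) (g x - g y) := by
    simp only [map_sub, sub_apply]; abel
  rw [e]
  refine (norm_add_le_of_le (B.le_of_opNorm₂_le_of_le le_rfl (h2 x y hx hy) (h1' x hx))
    (B.le_of_opNorm₂_le_of_le le_rfl (h1 y hy) (h2' x y hx hy))).trans_eq ?_
  ring

lemma LipBdd.prodMk [NormedSpace ℝ F] [NormedSpace ℝ G] {R : ℝ} {f : E → F} {g : E → G} (hf : LipBdd R f) (hg : LipBdd R g) :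
    LipBdd R fun x => (f x, g x) := by
  have h1 := hf.clm_comp (ContinuousLinearMap.inl ℝ F G)
  have h2 := hg.clm_comp (ContinuousLinearMap.inr ℝ F G)
  simpa using h1.add h2

end LipBdd

/-- The source of the first-order system in the unknowns `u` and `w = √M v`. -/
def sourceY {M : ℝ} (hM : 1 ≤ M) (z : WSpace N s × WSpace N s) : WSpace N s × WSpace N s :=
  (lightY hM z.1 ((Real.sqrt M)⁻¹ • z.2), Real.sqrt M • heavyY hM z.1 ((Real.sqrt M)⁻¹ • z.2))

lemma lipBdd_sourceY {M : ℝ} (hM : 1 ≤ M) {R : ℝ} (hR : 0 ≤ R) :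
    LipBdd R (sourceY (N := N) (s := s) hM) := by
  let Z := WSpace N s × WSpace N s
  have fst : LipBdd R fun z : Z => z.1 :=
    LipBdd.clm (E := Z) hR (ContinuousLinearMap.fst ℝ (WSpace N s) (WSpace N s))
  have snd : LipBdd R fun z : Z => z.2 :=
    LipBdd.clm (E := Z) hR (ContinuousLinearMap.snd ℝ (WSpace N s) (WSpace N s))
  have smul : ∀ (c : ℝ) {f : Z → WSpace N s}, LipBdd R f → LipBdd R fun z => c • f z :=
    fun c f hf => hf.clm_comp (c • ContinuousLinearMap.id ℝ (WSpace N s))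
  have neg : ∀ {f : Z → WSpace N s}, LipBdd R f → LipBdd R fun z => -f z :=
    fun hf => hf.clm_comp (-ContinuousLinearMap.id ℝ (WSpace N s))
  have hU : LipBdd R fun z : Z => fieldY le_rfl z.1 := fst.clm_comp _
  have hV : LipBdd R fun z : Z => fieldY hM ((Real.sqrt M)⁻¹ • z.2) :=
    (smul _ snd).clm_comp _
  have hUU := hU.bilin prodY hU
  have hd : ∀ j, LipBdd R fun z : Z => prodY (djY j z.1) (djY j z.1) := fun j =>
    (fst.clm_comp (djY j)).bilin prodY (fst.clm_comp (djY j))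
  have ht : LipBdd R fun z : Z => prodY (dtY z.1) (dtY z.1) :=
    (fst.clm_comp dtY).bilin prodY (fst.clm_comp dtY)
  have h1 := (smul (1 / 2) (hU.bilin prodY hUU)).add (neg (hU.bilin prodY hV))
  have h2 := (((smul (1 / 2) (hUU.bilin prodY hUU)).add (neg (hUU.bilin prodY hV))).add ht).add
    (neg (((hd 0).add (hd 1)).add (hd 2)))
  have h3 := h1.prodMk (smul (Real.sqrt M) h2)
  refine (congrArg (LipBdd R) (funext fun z => ?_)).mp h3
  simp only [sourceY, lightY, heavyY, sub_eq_add_neg, Fin.sum_univ_three]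

/-- The constant in the bound of the source. -/
def sourceConst (N s : ℝ) [Exps N s] : ℝ :=
  let p := prodConst N s
  32 * p + 12 * p ^ 2 + 8 * p ^ 3

lemma sourceConst_nonneg (N s : ℝ) [Exps N s] : 0 ≤ sourceConst N s := by
  have := prodConst_nonneg N s
  unfold sourceConst; positivity

/-- Every term is at least quadratic and `R ≤ 1` reduces cubic and quartic terms to `R²`. The factor
`√M` comes from the heavy equation being written for `w = √M v`. The coefficients `32, 12, 8` of
`sourceConst` dominate those of both components. -/
lemma norm_sourceY_le {M : ℝ} (hM : 1 ≤ M) {R : ℝ} (hR1 : R ≤ 1)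
    {z : WSpace N s × WSpace N s} (hz : ‖z‖ ≤ R) :
    ‖sourceY hM z‖ ≤ sourceConst N s * (Real.sqrt M * R ^ 2) := by
  have hR : 0 ≤ R := (norm_nonneg z).trans hz
  obtain ⟨u, w⟩ := z
  have hu : ‖u‖ ≤ R := (_root_.norm_fst_le (u, w)).trans hz
  have hw : ‖w‖ ≤ R := (_root_.norm_snd_le (u, w)).trans hz
  set q := Real.sqrt M
  have hq : 1 ≤ q := Real.one_le_sqrt.2 hM
  set p := prodConst N s with hp
  have hp0 : 0 ≤ p := prodConst_nonneg N s
  have P : ∀ {x y : WSpace N s} {a b : ℝ}, ‖x‖ ≤ a → ‖y‖ ≤ b → ‖prodY x y‖ ≤ p * a * b :=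
    fun ha hb => (norm_prodY_le _ _).trans (by
      have := (norm_nonneg _).trans ha
      gcongr)
  have hU : ‖fieldY le_rfl u‖ ≤ 2 * R := (norm_fieldY_le _ u).trans (by gcongr)
  have hV : ‖fieldY hM (q⁻¹ • w)‖ ≤ 2 * (q⁻¹ * R) := (norm_fieldY_le _ _).trans (by
    rw [norm_smul, norm_inv, Real.norm_of_nonneg (by positivity)]; gcongr)
  -- The factor `M^{-1/2}` is discarded in the light equation, but kept in the heavy one, where it
  -- cancels the `√M` in front of `U²V`.
  have hV' : 2 * (q⁻¹ * R) ≤ 2 * R := by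
    have := inv_le_one_of_one_le₀ hq
    nlinarith
  have hT : ‖dtY u‖ ≤ R := (norm_dtY_le u).trans hu
  have hD : ∀ j, ‖djY j u‖ ≤ 3 * R := fun j => (norm_djY_le j u).trans (by gcongr)
  have hh : ∀ {x : WSpace N s} {a : ℝ}, ‖x‖ ≤ a → ‖(1 / 2 : ℝ) • x‖ ≤ 1 / 2 * a := fun ha => by
    rw [norm_smul, Real.norm_of_nonneg (by norm_num)]; gcongr
  have hR3 : R ^ 3 ≤ R ^ 2 := pow_le_pow_of_le_one hR hR1 (by norm_num)
  have hR4 : R ^ 4 ≤ R ^ 2 := pow_le_pow_of_le_one hR hR1 (by norm_num)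
  have hqR : R ^ 2 ≤ q * R ^ 2 := by nlinarith [sq_nonneg R]
  have hC : sourceConst N s = 32 * p + 12 * p ^ 2 + 8 * p ^ 3 := rfl
  refine max_le ?_ ?_
  · have h1 := norm_sub_le_of_le (hh (P hU (P hU hU))) (P hU (hV.trans hV'))
    refine h1.trans ?_
    calc 1 / 2 * (p * (2 * R) * (p * (2 * R) * (2 * R))) + p * (2 * R) * (2 * R)
        = 4 * p ^ 2 * R ^ 3 + 4 * p * R ^ 2 := by ring
      _ ≤ 4 * p ^ 2 * R ^ 2 + 4 * p * R ^ 2 := by gcongr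
      _ = (4 * p ^ 2 + 4 * p) * R ^ 2 := by ring
      _ ≤ (32 * p + 12 * p ^ 2 + 8 * p ^ 3) * (q * R ^ 2) := by
        refine mul_le_mul ?_ hqR (by positivity) (by positivity)
        have := pow_nonneg hp0 2
        have := pow_nonneg hp0 3
        linarith
  · have h2 : ‖∑ j, prodY (djY j u) (djY j u)‖ ≤ 3 * (p * (3 * R) * (3 * R)) := by
      refine (norm_sum_le_of_le _ (fun j _ => P (hD j) (hD j))).trans_eq ?_
      simp
    have h1 := norm_sub_le_of_le (norm_add_le_of_le (norm_sub_le_of_le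
      (hh (P (P hU hU) (P hU hU))) (P (P hU hU) hV)) (P hT hT)) h2
    change ‖q • heavyY hM u (q⁻¹ • w)‖ ≤ _
    rw [norm_smul, Real.norm_of_nonneg (by positivity)]
    refine (mul_le_mul_of_nonneg_left h1 (by positivity)).trans ?_
    calc q * (1 / 2 * (p * (p * (2 * R) * (2 * R)) * (p * (2 * R) * (2 * R))) +
          p * (p * (2 * R) * (2 * R)) * (2 * (q⁻¹ * R)) + p * R * R + 3 * (p * (3 * R) * (3 * R)))
        = q * (8 * p ^ 3 * R ^ 4 + 28 * p * R ^ 2) + 8 * p ^ 2 * R ^ 3 := by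
          field_simp; ring
      _ ≤ q * (8 * p ^ 3 * R ^ 2 + 28 * p * R ^ 2) + 8 * p ^ 2 * (q * R ^ 2) := by
        gcongr
        exact hR3.trans hqR
      _ = (28 * p + 8 * p ^ 2 + 8 * p ^ 3) * (q * R ^ 2) := by ring
      _ ≤ (32 * p + 12 * p ^ 2 + 8 * p ^ 3) * (q * R ^ 2) := by
        gcongr
        · norm_num
        · norm_num

/-! ### The profile equation -/

/-- The pair of propagators. -/
def evolPair {M : ℝ} (hM : 1 ≤ M) (t : ℝ) :
    (WSpace N s × WSpace N s) →L[ℝ] WSpace N s × WSpace N s :=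
  (evolY le_rfl t).prodMap (evolY hM t)

lemma norm_evolPair_le {M : ℝ} (hM : 1 ≤ M) {t : ℝ} (ht : |t| ≤ 1) (z : WSpace N s × WSpace N s) :
    ‖evolPair hM t z‖ ≤ 2 * ‖z‖ := by
  refine max_le ?_ ?_
  · refine (norm_evolY_le le_rfl t z.1).trans ?_
    gcongr
    · linarith
    · exact _root_.norm_fst_le z
  · refine (norm_evolY_le hM t z.2).trans ?_
    gcongr
    · linarith
    · exact _root_.norm_snd_le z

lemma continuousOn_evolPair {M : ℝ} (hM : 1 ≤ M) {f : ℝ → ℝ} {g : ℝ → WSpace N s × WSpace N s}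
    {S : Set ℝ} (hf : ContinuousOn f S) (hfS : MapsTo f S (Icc (-1) 1)) (hg : ContinuousOn g S) :
    ContinuousOn (fun t => evolPair hM (f t) (g t)) S :=
  (continuousOn_evolY le_rfl hf hfS (continuous_fst.comp_continuousOn hg)).prodMk
    (continuousOn_evolY hM hf hfS (continuous_snd.comp_continuousOn hg))

lemma LipBdd.continuous {E F : Type*} [NormedAddCommGroup E] [NormedAddCommGroup F] {f : E → F}
    (h : ∀ R, 0 ≤ R → LipBdd R f) : Continuous f := by
  refine continuous_iff_continuousAt.2 fun x => ?_
  obtain ⟨C, K, hC, hK, -, h2⟩ := h (‖x‖ + 1) (by positivity)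
  refine continuousAt_of_locally_lipschitz (r := 1) one_pos K fun y hy => ?_
  rw [dist_eq_norm] at hy
  rw [dist_eq_norm, dist_eq_norm]
  refine h2 y x ?_ (by linarith)
  have := norm_le_norm_add_norm_sub' y x
  linarith

lemma continuous_sourceY {M : ℝ} (hM : 1 ≤ M) : Continuous (sourceY (N := N) (s := s) hM) :=
  LipBdd.continuous fun _ hR => lipBdd_sourceY hM hR

/-- The right-hand side of the profile equation. -/
def profileField {M : ℝ} (hM : 1 ≤ M) (t : ℝ) (z : WSpace N s × WSpace N s) :
    WSpace N s × WSpace N s :=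
  evolPair hM (-t) (sourceY hM (evolPair hM t z))

lemma continuousOn_profileField {M : ℝ} (hM : 1 ≤ M) {g : ℝ → WSpace N s × WSpace N s}
    (hg : ContinuousOn g (Icc 0 1)) :
    ContinuousOn (fun t => profileField hM t (g t)) (Icc 0 1) := by
  refine continuousOn_evolPair hM continuousOn_neg (fun t ht => ⟨by linarith [ht.2], by linarith [ht.1]⟩) ?_
  exact (continuous_sourceY hM).comp_continuousOn
    (continuousOn_evolPair hM continuousOn_id (fun t ht => ⟨(by linarith [ht.1] : (-1 : ℝ) ≤ t), ht.2⟩) hg)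

/-- On unit time the propagators have norm at most 2, so `e^{it⟨D⟩} z` stays in the ball of radius
`2R` and the field is at most `2 · C √M (2R)²`. That is the left side of the smallness hypothesis,
so a solution cannot leave the ball of radius `ε` before time 1. -/
lemma exists_profile {M : ℝ} (hM : 1 ≤ M) (z₀ : WSpace N s × WSpace N s) {R ε : ℝ} (hε : 0 ≤ ε)
    (hz : ‖z₀‖ + ε ≤ R) (hR : 2 * R ≤ 1)
    (hs : 8 * sourceConst N s * (Real.sqrt M * R ^ 2) ≤ ε) :
    ∃ z : ℝ → WSpace N s × WSpace N s, z 0 = z₀ ∧ ∀ t ∈ Icc (0 : ℝ) 1,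
      HasDerivWithinAt z (profileField hM t (z t)) (Icc 0 1) t ∧ ‖z t - z₀‖ ≤ ε := by
  have hR0 : 0 ≤ R := (add_nonneg (norm_nonneg _) hε).trans hz
  obtain ⟨C, K, hC, hK, -, hl⟩ := lipBdd_sourceY (N := N) (s := s) hM (R := 2 * R) (by positivity)
  have hball : ∀ z ∈ Metric.closedBall z₀ ε, ‖z‖ ≤ R := fun z hz' => by
    rw [mem_closedBall_iff_norm] at hz'
    have := norm_le_norm_add_norm_sub' z z₀
    linarith
  have habs : ∀ t ∈ Icc (0 : ℝ) 1, |t| ≤ 1 := fun t ht => abs_le.2 ⟨by linarith [ht.1], ht.2⟩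
  have hev : ∀ t ∈ Icc (0 : ℝ) 1, ∀ z ∈ Metric.closedBall z₀ ε, ‖evolPair hM t z‖ ≤ 2 * R :=
    fun t ht z hz' => (norm_evolPair_le hM (habs t ht) z).trans (by gcongr; exact hball z hz')
  lift ε to NNReal using hε
  lift K to NNReal using hK
  -- The two occurrences of `ε` are the radius of the ball and the bound of the field; they agree
  -- because the time interval has length 1. The Lipschitz constant has one factor 2 from each of
  -- the two propagators.
  have hPL : IsPicardLindelof (profileField (N := N) (s := s) hM) (tmin := 0) (tmax := 1)
      ⟨0, by simp⟩ z₀ ε 0 ε (2 * (K * 2)) := by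
    refine ⟨fun t ht => LipschitzOnWith.of_dist_le_mul fun x hx y hy => ?_, fun x _ =>
      continuousOn_profileField hM continuousOn_const, fun t ht x hx => ?_, ?_⟩
    · rw [dist_eq_norm, dist_eq_norm]
      have ht' : |-t| ≤ 1 := by rw [abs_neg]; exact habs t ht
      calc ‖profileField hM t x - profileField hM t y‖
          = ‖evolPair hM (-t) (sourceY hM (evolPair hM t x) - sourceY hM (evolPair hM t y))‖ := by
            rw [map_sub]; rfl
        _ ≤ 2 * (K * ‖evolPair hM t x - evolPair hM t y‖) :=
          (norm_evolPair_le hM ht' _).trans (by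
            gcongr; exact hl _ _ (hev t ht x hx) (hev t ht y hy))
        _ ≤ 2 * (K * (2 * ‖x - y‖)) := by
          gcongr
          rw [← map_sub]
          exact norm_evolPair_le hM (habs t ht) _
        _ = 2 * (K * 2) * ‖x - y‖ := by ring
    · have ht' : |-t| ≤ 1 := by rw [abs_neg]; exact habs t ht
      refine (norm_evolPair_le hM ht' _).trans ((mul_le_mul_of_nonneg_left
        (norm_sourceY_le hM hR (hev t ht x hx)) zero_le_two).trans ?_)
      refine le_trans (le_of_eq ?_) hs
      ring
    · simp
  -- The fixed point itself is extracted because it also carries the information that the curve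
  -- stays in the ball, needed for the final norm bound.
  obtain ⟨α, hα⟩ := ODE.FunSpace.exists_isFixedPt_next hPL (x := z₀) (by simp)
  refine ⟨α.compProj, ?_, fun t ht => ⟨?_, ?_⟩⟩
  · rw [ODE.FunSpace.compProj_of_mem (by simp)]
    exact α.apply_of_zero
  · have h1 : ∀ t ∈ Icc (0 : ℝ) 1, α.compProj t = ODE.picard (profileField hM) 0 z₀ α.compProj t :=
      fun t ht => by
        rw [ODE.FunSpace.compProj_of_mem ht]
        exact (ODE.FunSpace.isFixedPt_next_iff hPL (by simp)).1 hα ⟨t, ht⟩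
    have h2 := ODE.hasDerivWithinAt_picard_Icc (t₀ := (0 : ℝ)) (by simp) hPL.continuousOn_uncurry
      α.continuous_compProj.continuousOn
      (fun t _ => α.compProj_mem_closedBall hPL.mul_max_le) z₀ ht
    exact h2.congr h1 (h1 t ht)
  · have := α.compProj_mem_closedBall hPL.mul_max_le (t := t)
    rwa [mem_closedBall_iff_norm] at this

end

end KleinGordonEFT

/-! ### Plane wave kernels and their derivatives in space-time. -/

namespace KleinGordonEFT

noncomputable section

open scoped FourierTransform RealInnerProductSpace

/-! ### Synthesis of functions from their Fourier transforms -/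

/-- Continuous functions that are `O(⟨ξ⟩^{-r})`. -/
structure Decay (r : ℝ) (ω : E3 → ℂ) : Prop where
  cont : Continuous ω
  bound : ∃ C, ∀ ξ, ‖ω ξ‖ ≤ C * bracket 1 ξ ^ (-r)

lemma Decay.mono {r r' : ℝ} {ω : E3 → ℂ} (h : Decay r ω) (hr : r' ≤ r) : Decay r' ω := by
  obtain ⟨hc, C, hC⟩ := h
  refine ⟨hc, |C|, fun ξ => (hC ξ).trans ?_⟩
  have := Real.rpow_nonneg (bracket_nonneg 1 ξ) (-r)
  exact mul_le_mul (le_abs_self C) (bracket_rpow_mono (by linarith) ξ) this (abs_nonneg _)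

lemma Decay.memLp {r : ℝ} {ω : E3 → ℂ} (h : Decay r ω) (hr : 2 ≤ r) : MemLp ω 2 := by
  obtain ⟨hc, C, hC⟩ := h.mono hr
  refine (memLp_wt (s := -2) le_rfl).of_le_mul (c := C) hc.aestronglyMeasurable
    (ae_of_all _ fun ξ => ?_)
  rw [norm_wt]
  exact hC ξ

lemma decay_wt (r : ℝ) : Decay r (wt (-r)) :=
  ⟨continuous_wt _, 1, fun ξ => by rw [norm_wt, one_mul]⟩

lemma Decay.mul {r q : ℝ} {ω σ : E3 → ℂ} (h : Decay r ω) (hσ : Decay q σ) :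
    Decay (q + r) fun ξ => σ ξ * ω ξ := by
  obtain ⟨hc, C, hC⟩ := h
  obtain ⟨hc', C', hC'⟩ := hσ
  refine ⟨hc'.mul hc, C' * C, fun ξ => ?_⟩
  rw [norm_mul, neg_add, Real.rpow_add (bracket_pos one_pos ξ)]
  calc _ ≤ (C' * bracket 1 ξ ^ (-q)) * (C * bracket 1 ξ ^ (-r)) :=
        mul_le_mul (hC' ξ) (hC ξ) (norm_nonneg _) ((norm_nonneg _).trans (hC' ξ))
    _ = _ := by ring

lemma BddCont.decay {ω : E3 → ℂ} (h : BddCont ω) : Decay 0 ω := by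
  obtain ⟨hc, C, hC⟩ := h
  exact ⟨hc, C, fun ξ => by simpa using hC ξ⟩

lemma Decay.const_mul {r : ℝ} {ω : E3 → ℂ} (h : Decay r ω) (c : ℂ) :
    Decay r fun ξ => c * ω ξ := by
  simpa using h.mul (bddCont_const c).decay

lemma decay_bracket {m : ℝ} (hm : 1 ≤ m) : Decay (-1) fun ξ => (bracket m ξ : ℂ) :=
  ⟨Complex.continuous_ofReal.comp (continuous_bracket m), m, fun ξ => by
    rw [Complex.norm_of_nonneg (bracket_nonneg m ξ), neg_neg, Real.rpow_one]
    exact bracket_le_mul hm ξ⟩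

lemma decay_coord (j : Fin 3) : Decay (-1) fun ξ => tpi * (ξ j : ℂ) :=
  ⟨by fun_prop, 1, fun ξ => by
    rw [norm_mul, neg_neg, Real.rpow_one, one_mul, Complex.norm_real, Real.norm_eq_abs]
    have h1 : ‖tpi‖ = 2 * Real.pi := by simp [tpi, abs_of_pos Real.pi_pos]
    rw [h1]
    refine le_trans ?_ (norm_le_bracket 1 ξ)
    have := abs_coord_le ξ j
    gcongr⟩

/-- The function with Fourier transform `ω a`. -/
def synth (ω : E3 → ℂ) (a : L2) (x : E3) : ℂ :=
  ∫ ξ, Complex.exp (((2 * Real.pi * ⟪x, ξ⟫ : ℝ) : ℂ) * Complex.I) * (ω ξ * a ξ)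

lemma synth_eq_fourierInv (ω : E3 → ℂ) (a : L2) (x : E3) :
    synth ω a x = 𝓕⁻ (fun ξ => ω ξ * a ξ) x := by
  rw [Real.fourierInv_eq', synth]
  refine integral_congr_ae (ae_of_all _ fun ξ => ?_)
  beta_reduce
  rw [real_inner_comm, smul_eq_mul]

lemma synth_congr {ω ω' : E3 → ℂ} {a a' : L2}
    (h : (fun ξ => ω ξ * a ξ) =ᵐ[volume] fun ξ => ω' ξ * a' ξ) (x : E3) :
    synth ω a x = synth ω' a' x := by
  refine integral_congr_ae ?_
  filter_upwards [h] with ξ hξ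
  rw [hξ]

lemma synth_mulL2 {ω σ : E3 → ℂ} (h : BddCont σ) (a : L2) (x : E3) :
    synth ω (mulL2 σ a) x = synth (fun ξ => σ ξ * ω ξ) a x := by
  refine synth_congr ?_ x
  filter_upwards [mulL2_ae h a] with ξ hξ
  rw [hξ]; ring

lemma synth_const_mul (c : ℂ) (ω : E3 → ℂ) (a : L2) (x : E3) :
    synth (fun ξ => c * ω ξ) a x = c * synth ω a x := by
  rw [synth, synth, ← integral_const_mul]
  refine integral_congr_ae (ae_of_all _ fun ξ => ?_)
  simp only; ring

lemma conj_synth {ω : E3 → ℂ} (a : L2) (x : E3) :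
    (starRingEnd ℂ) (synth ω a x) =
      synth (fun ξ => (starRingEnd ℂ) (ω (-ξ))) (conjL2 a) x := by
  rw [synth, synth, ← integral_conj, ← integral_neg_eq_self]
  refine integral_congr_ae ?_
  filter_upwards [conjL2_ae a] with ξ hξ
  rw [hξ, map_mul, map_mul, ← Complex.exp_conj, map_mul, Complex.conj_I, Complex.conj_ofReal,
    inner_neg_right]
  congr 2
  push_cast; ring

/-- The phase of a plane wave. -/
def phase (m : ℝ) (z : ℝ × E3) (ξ : E3) : ℝ := z.1 * bracket m ξ + 2 * Real.pi * ⟪z.2, ξ⟫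

/-- A plane wave. -/
def wave (m : ℝ) (z : ℝ × E3) (ξ : E3) : ℂ := Complex.exp ((phase m z ξ : ℂ) * Complex.I)

lemma norm_wave (m : ℝ) (z : ℝ × E3) (ξ : E3) : ‖wave m z ξ‖ = 1 := Complex.norm_exp_ofReal_mul_I _

lemma continuous_phase (m : ℝ) (z : ℝ × E3) : Continuous (phase m z) := by
  have := continuous_bracket m
  unfold phase; fun_prop

lemma bddCont_wave (m : ℝ) (z : ℝ × E3) : BddCont (wave m z) :=
  ⟨by have := continuous_phase m z; unfold wave; fun_prop, 1, fun ξ => (norm_wave m z ξ).le⟩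

lemma phase_add (m : ℝ) (z h : ℝ × E3) (ξ : E3) :
    phase m (z + h) ξ = phase m z ξ + phase m h ξ := by
  simp only [phase, Prod.fst_add, Prod.snd_add, inner_add_left]; ring

lemma wave_add (m : ℝ) (z h : ℝ × E3) (ξ : E3) :
    wave m (z + h) ξ = wave m z ξ * wave m h ξ := by
  rw [wave, wave, wave, ← Complex.exp_add, phase_add]
  congr 1; push_cast; ring

lemma wave_eq (m : ℝ) (z : ℝ × E3) (ξ : E3) :
    wave m z ξ = Complex.exp (((2 * Real.pi * ⟪z.2, ξ⟫ : ℝ) : ℂ) * Complex.I) * expSym m z.1 ξ := by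
  rw [wave, expSym, ← Complex.exp_add, phase]
  congr 1; push_cast; ring

lemma abs_phase_le {m : ℝ} (hm : 1 ≤ m) (h : ℝ × E3) (ξ : E3) :
    |phase m h ξ| ≤ (m + 1) * ‖h‖ * bracket 1 ξ := by
  have h1 : |h.1| ≤ ‖h‖ := _root_.norm_fst_le h
  have h2 : ‖h.2‖ ≤ ‖h‖ := _root_.norm_snd_le h
  have h3 := bracket_le_mul hm ξ
  have h4 := norm_le_bracket 1 ξ
  have h5 := bracket_nonneg m ξ
  have h6 := bracket_nonneg 1 ξ
  calc |phase m h ξ| ≤ |h.1| * bracket m ξ + 2 * Real.pi * (‖h.2‖ * ‖ξ‖) := by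
        refine (abs_add_le _ _).trans ?_
        rw [abs_mul, abs_mul, abs_of_nonneg h5, abs_of_pos Real.two_pi_pos]
        gcongr
        exact abs_real_inner_le_norm _ _
    _ = |h.1| * bracket m ξ + ‖h.2‖ * (2 * Real.pi * ‖ξ‖) := by ring
    _ ≤ ‖h‖ * (m * bracket 1 ξ) + ‖h‖ * bracket 1 ξ := by gcongr
    _ = _ := by ring

lemma norm_exp_mul_I_sub_one_sub_le (θ : ℝ) :
    ‖Complex.exp ((θ : ℂ) * Complex.I) - 1 - (θ : ℂ) * Complex.I‖ ≤ 2 * θ ^ 2 := by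
  have h0 : ‖(θ : ℂ) * Complex.I‖ = |θ| := by simp
  rcases le_total |θ| 1 with h | h
  · have := Complex.norm_exp_sub_one_sub_id_le (x := (θ : ℂ) * Complex.I) (by rwa [h0])
    rw [h0, sq_abs] at this
    nlinarith [sq_nonneg θ]
  · have h1 : ‖Complex.exp ((θ : ℂ) * Complex.I) - 1‖ ≤ |θ| := by
      have := Real.norm_exp_I_mul_ofReal_sub_one_le (x := θ)
      rwa [mul_comm] at this
    have h2 := norm_sub_le (Complex.exp ((θ : ℂ) * Complex.I) - 1) ((θ : ℂ) * Complex.I)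
    rw [h0] at h2
    nlinarith [sq_abs θ]

/-- The square integrable function `e^{iφ} ω`. -/
def kern (m : ℝ) {ω : E3 → ℂ} (hω : MemLp ω 2) (z : ℝ × E3) : L2 := mulL2 (wave m z) (hω.toLp ω)

lemma kern_ae (m : ℝ) {ω : E3 → ℂ} (hω : MemLp ω 2) (z : ℝ × E3) :
    kern m hω z =ᵐ[volume] fun ξ => wave m z ξ * ω ξ := by
  filter_upwards [mulL2_ae (bddCont_wave m z) (hω.toLp ω), hω.coeFn_toLp] with ξ h1 h2
  rw [kern, h1, h2]

/-- The propagator moves from the profile to the kernel. All dependence on `x`, and all time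
dependence of the free flow, then sits in a fixed family of `L²` functions that can be
differentiated directly. -/
lemma pairL2_kern {m : ℝ} (hm : 0 < m) {ω : E3 → ℂ} (hω : MemLp ω 2) (z : ℝ × E3) (a : L2) :
    pairL2 (kern m hω z) a = synth ω (mulL2 (expSym m z.1) a) z.2 := by
  rw [pairL2_apply, synth]
  refine integral_congr_ae ?_
  filter_upwards [kern_ae m hω z, mulL2_ae (isSymbol_expSym hm z.1).bddCont a] with ξ h1 h2
  rw [h1, h2, wave_eq]; ring

lemma synth_eq_pairL2 {ω : E3 → ℂ} (hω : MemLp ω 2) (a : L2) (x : E3) :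
    synth ω a x = pairL2 (kern 1 hω (0, x)) a := by
  rw [pairL2_kern one_pos]
  refine (synth_congr ?_ x).symm
  filter_upwards [mulL2_ae (isSymbol_expSym one_pos 0).bddCont a] with ξ h
  rw [h, expSym_zero, one_mul]

lemma synth_add {ω : E3 → ℂ} (hω : MemLp ω 2) (a b : L2) (x : E3) :
    synth ω (a + b) x = synth ω a x + synth ω b x := by
  simp only [synth_eq_pairL2 hω, map_add]

lemma synth_sub {ω : E3 → ℂ} (hω : MemLp ω 2) (a b : L2) (x : E3) :
    synth ω (a - b) x = synth ω a x - synth ω b x := by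
  simp only [synth_eq_pairL2 hω, map_sub]

lemma synth_smul {ω : E3 → ℂ} (hω : MemLp ω 2) (c : ℝ) (a : L2) (x : E3) :
    synth ω (c • a) x = c * synth ω a x := by
  simp only [synth_eq_pairL2 hω, map_smul, Complex.real_smul]

/-- The symbol of `∂_t` applied to the function with frequency profile `ω`. -/
def tSym (m : ℝ) (ω : E3 → ℂ) (ξ : E3) : ℂ := Complex.I * ((bracket m ξ : ℂ) * ω ξ)

/-- The symbol of `∂_j` applied to the function with frequency profile `ω`. -/
def xSym (j : Fin 3) (ω : E3 → ℂ) (ξ : E3) : ℂ := tpi * (ξ j : ℂ) * ω ξ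

lemma Decay.tSym {m r : ℝ} (hm : 1 ≤ m) {ω : E3 → ℂ} (h : Decay r ω) :
    Decay (r - 1) (tSym m ω) := by
  have := (h.mul (decay_bracket hm)).const_mul Complex.I
  rwa [neg_add_eq_sub] at this

lemma Decay.xSym {r : ℝ} (j : Fin 3) {ω : E3 → ℂ} (h : Decay r ω) :
    Decay (r - 1) (xSym j ω) := by
  have := h.mul (decay_coord j)
  rwa [neg_add_eq_sub] at this

lemma sum_inner_coord (x ξ : E3) : ⟪x, ξ⟫ = ∑ j, x j * ξ j := by
  simp [PiLp.inner_apply, mul_comm]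

/-- The linear form `(τ, h) ↦ τ a + ∑ h_j b_j`. -/
def jetCLM {F : Type*} [NormedAddCommGroup F] [NormedSpace ℝ F] (a : F) (b : Fin 3 → F) :
    ℝ × E3 →L[ℝ] F :=
  (ContinuousLinearMap.fst ℝ ℝ E3).smulRight a +
    ∑ j, ((EuclideanSpace.proj j : E3 →L[ℝ] ℝ).comp (ContinuousLinearMap.snd ℝ ℝ E3)).smulRight (b j)

lemma jetCLM_apply {F : Type*} [NormedAddCommGroup F] [NormedSpace ℝ F] (a : F) (b : Fin 3 → F)
    (h : ℝ × E3) : jetCLM a b h = h.1 • a + ∑ j, h.2 j • b j := by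
  simp [jetCLM]

/-- The second order remainder of the exponential is at most twice the square of the phase
increment, hence costs `⟨ξ⟩²`. Decay of order 4 leaves `⟨ξ⟩^{-2}`, which is in `L²`; the remainder
is therefore `O(|h|²)` in `L²`. -/
lemma hasFDerivAt_kern {m : ℝ} (hm : 1 ≤ m) {ω : E3 → ℂ} (hω : Decay 4 ω)
    (h2 : MemLp ω 2) (ht : MemLp (tSym m ω) 2) (hx : ∀ j, MemLp (xSym j ω) 2) (z : ℝ × E3) :
    HasFDerivAt (kern m h2) (jetCLM (kern m ht z) fun j => kern m (hx j) z) z := by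
  obtain ⟨-, C, hC⟩ := hω
  have hC0 : 0 ≤ C := by
    by_contra h
    have := (norm_nonneg _).trans (hC 0)
    have h3 := Real.rpow_pos_of_pos (bracket_pos one_pos 0) (-4)
    nlinarith
  let K : ℝ := 2 * (m + 1) ^ 2 * C
  let w : L2 := (memLp_wt (s := -2) le_rfl).toLp _
  have key : ∀ h : ℝ × E3, ‖kern m h2 (z + h) - kern m h2 z -
      jetCLM (kern m ht z) (fun j => kern m (hx j) z) h‖ ≤ K * ‖h‖ ^ 2 * ‖w‖ := fun h => by
    refine Lp.norm_le_mul_norm_of_ae_le_mul ?_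
    have e1 := kern_ae m h2 (z + h)
    have e2 := kern_ae m h2 z
    have e3 := kern_ae m ht z
    have e4 := fun j => kern_ae m (hx j) z
    rw [jetCLM_apply, Fin.sum_univ_three]
    filter_upwards [e1, e2, e3, e4 0, e4 1, e4 2, (memLp_wt (s := -2) le_rfl).coeFn_toLp,
      Lp.coeFn_sub (kern m h2 (z + h) - kern m h2 z) (h.1 • kern m ht z +
        (h.2 0 • kern m (hx 0) z + h.2 1 • kern m (hx 1) z + h.2 2 • kern m (hx 2) z)),
      Lp.coeFn_sub (kern m h2 (z + h)) (kern m h2 z),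
      Lp.coeFn_add (h.1 • kern m ht z)
        (h.2 0 • kern m (hx 0) z + h.2 1 • kern m (hx 1) z + h.2 2 • kern m (hx 2) z),
      Lp.coeFn_add (h.2 0 • kern m (hx 0) z + h.2 1 • kern m (hx 1) z) (h.2 2 • kern m (hx 2) z),
      Lp.coeFn_add (h.2 0 • kern m (hx 0) z) (h.2 1 • kern m (hx 1) z),
      Lp.coeFn_smul h.1 (kern m ht z), Lp.coeFn_smul (h.2 0) (kern m (hx 0) z),
      Lp.coeFn_smul (h.2 1) (kern m (hx 1) z), Lp.coeFn_smul (h.2 2) (kern m (hx 2) z)]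
      with ξ a1 a2 a3 a4 a5 a6 a7 b1 b2 b3 b4 b5 b6 b7 b8 b9
    rw [b1, Pi.sub_apply, b2, Pi.sub_apply, b3, Pi.add_apply, b4, Pi.add_apply, b5, Pi.add_apply,
      b6, b7, b8, b9, Pi.smul_apply, Pi.smul_apply, Pi.smul_apply, Pi.smul_apply, a1, a2, a3, a4,
      a5, a6, a7, wave_add]
    have e : wave m z ξ * wave m h ξ * ω ξ - wave m z ξ * ω ξ -
        (h.1 • (wave m z ξ * tSym m ω ξ) + (h.2 0 • (wave m z ξ * xSym 0 ω ξ) +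
          h.2 1 • (wave m z ξ * xSym 1 ω ξ) + h.2 2 • (wave m z ξ * xSym 2 ω ξ))) =
        wave m z ξ * ((wave m h ξ - 1 - (phase m h ξ : ℂ) * Complex.I) * ω ξ) := by
      simp only [tSym, xSym, phase, sum_inner_coord, Fin.sum_univ_three, Complex.real_smul]
      push_cast; ring
    rw [e, norm_mul, norm_wave, one_mul, norm_mul, norm_wt]
    have h5 := bracket_pos one_pos ξ
    have h6 : |phase m h ξ| ^ 2 ≤ ((m + 1) * ‖h‖ * bracket 1 ξ) ^ 2 := by
      gcongr; exact abs_phase_le hm h ξ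
    rw [sq_abs] at h6
    have h7 : bracket 1 ξ ^ (-2 : ℝ) = bracket 1 ξ ^ 2 * bracket 1 ξ ^ (-4 : ℝ) := by
      rw [← Real.rpow_natCast, ← Real.rpow_add h5]; norm_num
    calc _ ≤ (2 * ((m + 1) * ‖h‖ * bracket 1 ξ) ^ 2) * (C * bracket 1 ξ ^ (-4 : ℝ)) := by
          refine mul_le_mul ((norm_exp_mul_I_sub_one_sub_le _).trans (by gcongr)) (hC ξ)
            (norm_nonneg _) (by positivity)
      _ = K * ‖h‖ ^ 2 * bracket 1 ξ ^ (-2 : ℝ) := by rw [h7]; ring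
  rw [hasFDerivAt_iff_isLittleO_nhds_zero]
  refine (Asymptotics.IsBigO.of_bound (K * ‖w‖) (g := fun h : ℝ × E3 => ‖h‖ ^ 2)
    (Filter.Eventually.of_forall fun h => ?_)).trans_isLittleO ?_
  · rw [Real.norm_of_nonneg (by positivity)]
    linarith [key h]
  · exact Asymptotics.isLittleO_norm_pow_id one_lt_two

lemma continuous_kern {m : ℝ} (hm : 1 ≤ m) {ω : E3 → ℂ} (hω : Decay 4 ω) (h2 : MemLp ω 2) :
    Continuous (kern m h2) :=
  continuous_iff_continuousAt.2 fun z => (hasFDerivAt_kern hm hω h2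
    ((hω.tSym hm).memLp (by norm_num)) (fun j => (hω.xSym j).memLp (by norm_num)) z).continuousAt

end

end KleinGordonEFT

/-! ### Differentiability and the Klein–Gordon equation for fields built from profiles. -/

namespace KleinGordonEFT

noncomputable section

/-! ### Products -/

open scoped FourierTransform in
lemma synth_wconv {N : ℝ} (h : ConvExp N N) (a b : L2) (x : E3) :
    synth (wt (-N)) (wconv h a b) x = synth (wt (-N)) a x * synth (wt (-N)) b x := by
  have hN : -N ≤ -2 := by linarith [h.2.1]
  have e : synth (wt (-N)) (wconv h a b) x =
      𝓕⁻ (conv (fun ξ => wt (-N) ξ * a ξ) (fun ξ => wt (-N) ξ * b ξ)) x := by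
    rw [synth_eq_fourierInv, Real.fourierInv_eq, Real.fourierInv_eq]
    refine integral_congr_ae ?_
    filter_upwards [wt_neg_mul_wconv_ae h a b] with ξ hξ
    rw [hξ]
  rw [e, synth_eq_fourierInv, synth_eq_fourierInv, Real.fourierInv_eq_fourier_neg,
    Real.fourierInv_eq_fourier_neg, Real.fourierInv_eq_fourier_neg]
  exact Real.fourier_mul_convolution_eq (R := ℂ) (integrable_wt_mul hN a) (integrable_wt_mul hN b)
    (-x)

/-! ### Functions with a jet -/

/-- The time slab `[0,1] × ℝ³`. -/
abbrev slab : Set (ℝ × E3) := Icc (0 : ℝ) 1 ×ˢ univ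

lemma uniqueDiffOn_slab : UniqueDiffOn ℝ slab := (uniqueDiffOn_Icc one_pos).prod uniqueDiffOn_univ

/-- Smoothness is read off from the coefficients of the derivative. Derivatives are taken within the
slab, which has unique differentials, so regularity includes the end times 0 and 1. -/
lemma contDiffOn_succ_of_jet {F : Type*} [NormedAddCommGroup F] [NormedSpace ℝ F] {n : ℕ}
    {f a : ℝ × E3 → F} {b : Fin 3 → ℝ × E3 → F}
    (hf : ∀ z ∈ slab, HasFDerivWithinAt f (jetCLM (a z) fun j => b j z) slab z)
    (ha : ContDiffOn ℝ n a slab) (hb : ∀ j, ContDiffOn ℝ n (b j) slab) :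
    ContDiffOn ℝ (n + 1) f slab := by
  refine (contDiffOn_succ_iff_hasFDerivWithinAt_of_uniqueDiffOn uniqueDiffOn_slab).2
    ⟨fun h => by simp at h, _, ?_, hf⟩
  exact (contDiffOn_const.smulRight ha).add
    (ContDiffOn.sum fun j _ => contDiffOn_const.smulRight (hb j))

lemma comp_jetCLM {F G : Type*} [NormedAddCommGroup F] [NormedSpace ℝ F] [NormedAddCommGroup G]
    [NormedSpace ℝ G] (L : F →L[ℝ] G) (a : F) (b : Fin 3 → F) :
    L.comp (jetCLM a b) = jetCLM (L a) fun j => L (b j) := by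
  refine ContinuousLinearMap.ext fun h => ?_
  simp [jetCLM_apply]

lemma hasFDerivWithinAt_bilinear_jet {E F G : Type*} [NormedAddCommGroup E] [NormedSpace ℝ E]
    [NormedAddCommGroup F] [NormedSpace ℝ F] [NormedAddCommGroup G] [NormedSpace ℝ G]
    (B : E →L[ℝ] F →L[ℝ] G) {f : ℝ × E3 → E} {a : E} {b : Fin 3 → E} {g : ℝ → F} {g' : F}
    {z : ℝ × E3} (hf : HasFDerivWithinAt f (jetCLM a b) slab z)
    (hg : HasDerivWithinAt g g' (Icc 0 1) z.1) :
    HasFDerivWithinAt (fun w => B (f w) (g w.1))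
      (jetCLM (B a (g z.1) + B (f z) g') fun j => B (b j) (g z.1)) slab z := by
  have h3 : HasFDerivWithinAt (fun w : ℝ × E3 => g w.1)
      ((ContinuousLinearMap.fst ℝ ℝ E3).smulRight g') slab z := by
    refine (hg.hasFDerivWithinAt.comp z (hasFDerivWithinAt_fst (𝕜 := ℝ) (s := slab) (p := z))
      fun w hw => hw.1).congr_fderiv ?_
    refine ContinuousLinearMap.ext fun v => ?_
    simp
  refine (B.hasFDerivWithinAt_of_bilinear hf h3).congr_fderiv ?_
  refine ContinuousLinearMap.ext fun v => ?_
  change B (f z) ((ContinuousLinearMap.fst ℝ ℝ E3).smulRight g' v) + B (jetCLM a b v) (g z.1) = _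
  simp only [jetCLM_apply, add_apply, ContinuousLinearMap.smulRight_apply,
    ContinuousLinearMap.coe_fst', map_add, map_smul, map_sum, sum_apply, smul_apply, smul_add]
  abel

section RealJet

variable {U : ℝ → E3 → ℝ} {a a' : ℝ × E3 → ℝ} {b c d : Fin 3 → ℝ × E3 → ℝ}
  {e : Fin 3 → Fin 3 → ℝ × E3 → ℝ}

lemma hasDerivWithinAt_of_jet {f : ℝ × E3 → ℝ} {p : ℝ} {q : Fin 3 → ℝ} {t : ℝ} {x : E3}
    (h : HasFDerivWithinAt f (jetCLM p q) slab (t, x)) :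
    HasDerivWithinAt (fun s => f (s, x)) p (Icc 0 1) t := by
  have h1 : HasDerivWithinAt (fun s : ℝ => (s, x)) ((1 : ℝ), (0 : E3)) (Icc 0 1) t :=
    (hasDerivWithinAt_id t _).prodMk (hasDerivWithinAt_const t _ x)
  have h2 := h.comp_hasDerivWithinAt t h1 fun s hs => (⟨hs, mem_univ _⟩ : (s, x) ∈ slab)
  have e : jetCLM p q ((1 : ℝ), (0 : E3)) = p := by simp [jetCLM_apply]
  rwa [e] at h2

lemma hasFDerivAt_of_jet {f : ℝ × E3 → ℝ} {p : ℝ} {q : Fin 3 → ℝ} {t : ℝ} (ht : t ∈ Icc (0 : ℝ) 1)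
    {x : E3} (h : HasFDerivWithinAt f (jetCLM p q) slab (t, x)) :
    HasFDerivAt (fun y => f (t, y)) (∑ j, q j • (EuclideanSpace.proj j : E3 →L[ℝ] ℝ)) x := by
  have h1 : HasFDerivWithinAt (fun y : E3 => (t, y)) (ContinuousLinearMap.inr ℝ ℝ E3) univ x :=
    (hasFDerivAt_prodMk_right t x).hasFDerivWithinAt
  have h2 := (h.comp x h1 fun y _ => ⟨ht, mem_univ _⟩).hasFDerivAt Filter.univ_mem
  refine h2.congr_fderiv ?_
  refine ContinuousLinearMap.ext fun v => ?_
  simp [jetCLM_apply, mul_comm]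

lemma timeDeriv_of_jet
    (hU : ∀ z ∈ slab, HasFDerivWithinAt (fun z : ℝ × E3 => U z.1 z.2)
      (jetCLM (a z) fun j => b j z) slab z) {t : ℝ} (ht : t ∈ Icc (0 : ℝ) 1) (x : E3) :
    timeDeriv (Icc 0 1) U t x = a (t, x) :=
  (hasDerivWithinAt_of_jet (hU (t, x) ⟨ht, mem_univ _⟩)).derivWithin
    (uniqueDiffOn_Icc one_pos t ht)

lemma norm_sq_gradient_of_jet
    (hU : ∀ z ∈ slab, HasFDerivWithinAt (fun z : ℝ × E3 => U z.1 z.2)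
      (jetCLM (a z) fun j => b j z) slab z) {t : ℝ} (ht : t ∈ Icc (0 : ℝ) 1) (x : E3) :
    ‖gradient (U t) x‖ ^ 2 = ∑ j, b j (t, x) ^ 2 := by
  have h : HasFDerivAt (U t) _ x := hasFDerivAt_of_jet ht (hU (t, x) ⟨ht, mem_univ _⟩)
  rw [EuclideanSpace.norm_sq_eq]
  refine Finset.sum_congr rfl fun j _ => ?_
  have h1 : gradient (U t) x j = fderiv ℝ (U t) x (EuclideanSpace.single j 1) := by
    have h2 := InnerProductSpace.toDual_symm_apply (𝕜 := ℝ) (E := E3)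
      (x := EuclideanSpace.single j (1 : ℝ)) (y := fderiv ℝ (U t) x)
    rw [← h2, EuclideanSpace.inner_single_right]
    simp [gradient]
  rw [Real.norm_eq_abs, sq_abs, h1, h.fderiv]
  simp

lemma box_of_jet
    (hU : ∀ z ∈ slab, HasFDerivWithinAt (fun z : ℝ × E3 => U z.1 z.2)
      (jetCLM (a z) fun j => b j z) slab z)
    (ha : ∀ z ∈ slab, HasFDerivWithinAt a (jetCLM (a' z) fun j => c j z) slab z)
    (hb : ∀ j, ∀ z ∈ slab, HasFDerivWithinAt (b j) (jetCLM (d j z) fun i => e j i z) slab z)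
    {t : ℝ} (ht : t ∈ Icc (0 : ℝ) 1) (x : E3) :
    box (Icc 0 1) U t x = -a' (t, x) + ∑ j, e j j (t, x) := by
  have h1 : derivWithin (fun s => timeDeriv (Icc 0 1) U s x) (Icc 0 1) t = a' (t, x) := by
    rw [derivWithin_congr (fun s hs => timeDeriv_of_jet hU hs x) (timeDeriv_of_jet hU ht x)]
    exact (hasDerivWithinAt_of_jet (ha (t, x) ⟨ht, mem_univ _⟩)).derivWithin
      (uniqueDiffOn_Icc one_pos t ht)
  have h2 : fderiv ℝ (U t) = fun y => ∑ j, b j (t, y) • (EuclideanSpace.proj j : E3 →L[ℝ] ℝ) := by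
    funext y
    exact (hasFDerivAt_of_jet ht (hU (t, y) ⟨ht, mem_univ _⟩)).fderiv
  have h3 : HasFDerivAt (fun y => ∑ j, b j (t, y) • (EuclideanSpace.proj j : E3 →L[ℝ] ℝ))
      (∑ j, (∑ i, e j i (t, x) • (EuclideanSpace.proj i : E3 →L[ℝ] ℝ)).smulRight
        (EuclideanSpace.proj j : E3 →L[ℝ] ℝ)) x :=
    HasFDerivAt.fun_sum fun j _ => HasFDerivAt.smul_const (F := E3 →L[ℝ] ℝ)
      (hasFDerivAt_of_jet ht (hb j (t, x) ⟨ht, mem_univ _⟩)) (EuclideanSpace.proj j)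
  rw [box, h1, InnerProductSpace.laplacian_eq_iteratedFDeriv_orthonormalBasis (U t)
    (EuclideanSpace.basisFun (Fin 3) ℝ)]
  congr 1
  refine Finset.sum_congr rfl fun j _ => ?_
  rw [iteratedFDeriv_two_apply, h2, h3.fderiv]
  simp

end RealJet

/-! ### Half waves -/

/-- `l` is the profile of a solution of the half Klein-Gordon equation with source `F`. -/
structure Duhamel (m : ℝ) (l F : ℝ → L2) : Prop where
  deriv : ∀ t ∈ Icc (0 : ℝ) 1,
    HasDerivWithinAt l (mulL2 (expSym m (-t)) (F t)) (Icc 0 1) t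
  cont : ContinuousOn (fun t => mulL2 (expSym m (-t)) (F t)) (Icc 0 1)

lemma mulL2_expSym_neg {m : ℝ} (hm : 0 < m) (t : ℝ) (a : L2) :
    mulL2 (expSym m t) (mulL2 (expSym m (-t)) a) = a := by
  have h := fun t => (isSymbol_expSym hm t).bddCont
  rw [mulL2_mulL2 (h _) (h _)]
  refine Lp.ext ?_
  filter_upwards [mulL2_ae ((h t).mul (h (-t))) a] with ξ h1
  rw [h1, expSym_add, add_neg_cancel, expSym_zero, one_mul]

/-- The function `ω(D) e^{it⟨D⟩_m} l`. -/
def spacetime (m : ℝ) (ω : E3 → ℂ) (l : ℝ → L2) (z : ℝ × E3) : ℂ :=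
  synth ω (mulL2 (expSym m z.1) (l z.1)) z.2

lemma spacetime_eq {m : ℝ} (hm : 0 < m) {ω : E3 → ℂ} (hω : MemLp ω 2) (l : ℝ → L2) (z : ℝ × E3) :
    spacetime m ω l z = pairL2 (kern m hω z) (l z.1) := (pairL2_kern hm hω z (l z.1)).symm

lemma continuousOn_pairL2_kern {m : ℝ} (hm : 1 ≤ m) {ω : E3 → ℂ} (hω : Decay 4 ω)
    (h2 : MemLp ω 2) {g : ℝ → L2} (hg : ContinuousOn g (Icc 0 1)) :
    ContinuousOn (fun z : ℝ × E3 => pairL2 (kern m h2 z) (g z.1)) slab := by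
  have h1 : ContinuousOn (fun z : ℝ × E3 => g z.1) slab :=
    hg.comp continuousOn_fst fun z hz => hz.1
  exact (pairL2.continuous.comp_continuousOn (continuous_kern hm hω h2).continuousOn).clm_apply h1

section Duhamel

variable {m : ℝ} {l F : ℝ → L2}

/-- Product rule for kernel paired with profile. Time differentiation hits the phase, giving `tSym`,
or the profile, where the factor `e^{-it⟨D⟩_m}` cancels the propagator and leaves the source. -/
lemma Duhamel.hasFDerivWithinAt (hm : 1 ≤ m) (h : Duhamel m l F) {ω : E3 → ℂ} (hω : Decay 4 ω)
    {z : ℝ × E3} (hz : z ∈ slab) :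
    HasFDerivWithinAt (spacetime m ω l)
      (jetCLM (spacetime m (tSym m ω) l z + synth ω (F z.1) z.2)
        fun j => spacetime m (xSym j ω) l z) slab z := by
  have hm0 := one_pos.trans_le hm
  have h2 := hω.memLp (by norm_num)
  have ht := (hω.tSym hm).memLp (by norm_num)
  have hx := fun j => (hω.xSym j).memLp (by norm_num)
  have h4 := hasFDerivWithinAt_bilinear_jet pairL2
    (hasFDerivAt_kern hm hω h2 ht hx z).hasFDerivWithinAt (h.deriv z.1 hz.1)
  have e2 : synth ω (F z.1) z.2 = pairL2 (kern m h2 z) (mulL2 (expSym m (-z.1)) (F z.1)) := by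
    rw [pairL2_kern hm0, mulL2_expSym_neg hm0]
  rw [funext (spacetime_eq hm0 h2 l), spacetime_eq hm0 ht, e2]
  simp only [fun j => spacetime_eq hm0 (hx j) l z]
  exact h4

lemma Duhamel.continuousOn (h : Duhamel m l F) : ContinuousOn l (Icc 0 1) :=
  fun t ht => (h.deriv t ht).continuousWithinAt

lemma Duhamel.continuousOn_spacetime (hm : 1 ≤ m) (h : Duhamel m l F) {ω : E3 → ℂ}
    (hω : Decay 4 ω) : ContinuousOn (spacetime m ω l) slab := by
  have h2 := hω.memLp (by norm_num)
  rw [funext (spacetime_eq (one_pos.trans_le hm) h2 l)]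
  exact continuousOn_pairL2_kern hm hω h2 h.continuousOn

/-- What is known to be continuous in time is `e^{-it⟨D⟩_m} F(t)`; pairing it with the kernel
restores the propagator and yields continuity of the source itself. -/
lemma Duhamel.continuousOn_synth (hm : 1 ≤ m) (h : Duhamel m l F) {ω : E3 → ℂ}
    (hω : Decay 4 ω) : ContinuousOn (fun z : ℝ × E3 => synth ω (F z.1) z.2) slab := by
  have h2 := hω.memLp (by norm_num)
  refine (continuousOn_pairL2_kern hm hω h2 h.cont).congr fun z _ => ?_
  simp only
  rw [pairL2_kern (one_pos.trans_le hm), mulL2_expSym_neg (one_pos.trans_le hm)]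

lemma Duhamel.contDiffOn_one (hm : 1 ≤ m) (h : Duhamel m l F) {ω : E3 → ℂ}
    (hω : Decay 5 ω) : ContDiffOn ℝ 1 (spacetime m ω l) slab := by
  have h4 := hω.mono (r' := 4) (by norm_num)
  refine contDiffOn_succ_of_jet (n := 0) (fun z hz => h.hasFDerivWithinAt hm h4 hz)
    (contDiffOn_zero.2 ?_) fun j => contDiffOn_zero.2 ?_
  · exact (h.continuousOn_spacetime hm ((hω.tSym hm).mono (by norm_num))).add
      (h.continuousOn_synth hm h4)
  · exact h.continuousOn_spacetime hm ((hω.xSym j).mono (by norm_num))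

end Duhamel

/-- The symbol `⟨ξ⟩^{-N} ⟨ξ⟩_m^{-1}`. -/
def posSym (N m : ℝ) (ξ : E3) : ℂ := (((bracket m ξ)⁻¹ : ℝ) : ℂ) * wt (-N) ξ

lemma bddCont_inv_bracket {m : ℝ} (hm : 1 ≤ m) : BddCont fun ξ => (((bracket m ξ)⁻¹ : ℝ) : ℂ) :=
  ⟨Complex.continuous_ofReal.comp ((continuous_bracket m).inv₀ fun ξ =>
    (bracket_pos (one_pos.trans_le hm) ξ).ne'), 1, fun ξ => by
      rw [Complex.norm_of_nonneg (inv_nonneg.2 (bracket_nonneg m ξ))]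
      exact inv_bracket_le_one hm ξ⟩

lemma decay_posSym (N : ℝ) {m : ℝ} (hm : 1 ≤ m) : Decay N (posSym N m) := by
  have h := (decay_wt N).mul (bddCont_inv_bracket hm).decay
  rwa [zero_add] at h

lemma tSym_posSym (N : ℝ) {m : ℝ} (hm : 0 < m) :
    tSym m (posSym N m) = fun ξ => Complex.I * wt (-N) ξ := by
  funext ξ
  have h : (bracket m ξ : ℂ) ≠ 0 := Complex.ofReal_ne_zero.2 (bracket_pos hm ξ).ne'
  rw [tSym, posSym, Complex.ofReal_inv, mul_inv_cancel_left₀ h]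

lemma integrable_exp_mul {ω : E3 → ℂ} (hω : MemLp ω 2) (a : L2) (x : E3) :
    Integrable fun ξ => Complex.exp (((2 * Real.pi * inner ℝ x ξ : ℝ) : ℂ) * Complex.I) *
      (ω ξ * a ξ) :=
  (hω.integrable_mul (Lp.memLp a)).bdd_mul (c := 1)
    (Continuous.aestronglyMeasurable (by fun_prop))
    (ae_of_all _ fun ξ => (Complex.norm_exp_ofReal_mul_I _).le)

lemma synth_add_symbol {ω ω' : E3 → ℂ} (hω : MemLp ω 2) (hω' : MemLp ω' 2) (a : L2) (x : E3) :
    synth (fun ξ => ω ξ + ω' ξ) a x = synth ω a x + synth ω' a x := by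
  rw [synth, synth, synth, ← integral_add (integrable_exp_mul hω a x) (integrable_exp_mul hω' a x)]
  refine integral_congr_ae (ae_of_all _ fun ξ => ?_)
  beta_reduce
  ring

/-- The dispersion relation `⟨ξ⟩_m² = m² + |2πξ|²`, divided by `⟨ξ⟩_m`. -/
lemma symbol_identity (N : ℝ) {m : ℝ} (hm : 0 < m) (ξ : E3) :
    (bracket m ξ : ℂ) * wt (-N) ξ + (xSym 0 (xSym 0 (posSym N m)) ξ +
      (xSym 1 (xSym 1 (posSym N m)) ξ + xSym 2 (xSym 2 (posSym N m)) ξ)) =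
      (m : ℂ) ^ 2 * posSym N m ξ := by
  have h : (bracket m ξ : ℂ) ≠ 0 := Complex.ofReal_ne_zero.2 (bracket_pos hm ξ).ne'
  have h1 : (bracket m ξ : ℂ) ^ 2 =
      (m : ℂ) ^ 2 + (2 * Real.pi) ^ 2 * ((ξ 0 : ℂ) ^ 2 + (ξ 1 : ℂ) ^ 2 + (ξ 2 : ℂ) ^ 2) := by
    have h2 := bracket_sq m ξ
    rw [mul_pow, EuclideanSpace.norm_sq_eq, Fin.sum_univ_three] at h2
    simp only [Real.norm_eq_abs, sq_abs] at h2
    exact_mod_cast congrArg (fun r : ℝ => (r : ℂ)) h2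
  simp only [xSym, posSym, tpi, Complex.ofReal_inv]
  field_simp
  rw [h1]
  linear_combination (4 * (Real.pi : ℂ) ^ 2 * wt (-N) ξ *
    ((ξ 0 : ℂ) ^ 2 + (ξ 1 : ℂ) ^ 2 + (ξ 2 : ℂ) ^ 2)) * Complex.I_sq

/-- The real field `⟨D⟩_m^{-1} Im u` of the half wave `u` with profile `l`. -/
def field (N m : ℝ) (l : ℝ → L2) (t : ℝ) (x : E3) : ℝ := (spacetime m (posSym N m) l (t, x)).im

section Field

variable {N m : ℝ} {l F : ℝ → L2}

lemma im_synth_eq_zero {a : L2} (ha : conjL2 a = a) {ω : E3 → ℂ}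
    (hω : ∀ ξ, (starRingEnd ℂ) (ω (-ξ)) = ω ξ) (x : E3) : (synth ω a x).im = 0 := by
  rw [← Complex.conj_eq_iff_im, conj_synth, ha]
  simp only [hω]

lemma conj_posSym (N m : ℝ) (ξ : E3) : (starRingEnd ℂ) (posSym N m (-ξ)) = posSym N m ξ := by
  rw [posSym, posSym, map_mul, Complex.conj_ofReal, conj_wt, wt_neg, bracket_neg]

lemma Duhamel.jet_im (hm : 1 ≤ m) (h : Duhamel m l F) {ω : E3 → ℂ} (hω : Decay 4 ω)
    {z : ℝ × E3} (hz : z ∈ slab) :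
    HasFDerivWithinAt (fun z => (spacetime m ω l z).im)
      (jetCLM (spacetime m (tSym m ω) l z + synth ω (F z.1) z.2).im
        fun j => (spacetime m (xSym j ω) l z).im) slab z := by
  have h1 := (Complex.imCLM.hasFDerivAt (x := spacetime m ω l z)).comp_hasFDerivWithinAt z
    (h.hasFDerivWithinAt hm hω hz)
  rw [comp_jetCLM] at h1
  exact h1

lemma Duhamel.jet_re (hm : 1 ≤ m) (h : Duhamel m l F) {ω : E3 → ℂ} (hω : Decay 4 ω)
    {z : ℝ × E3} (hz : z ∈ slab) :
    HasFDerivWithinAt (fun z => (spacetime m ω l z).re)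
      (jetCLM (spacetime m (tSym m ω) l z + synth ω (F z.1) z.2).re
        fun j => (spacetime m (xSym j ω) l z).re) slab z := by
  have h1 := (Complex.reCLM.hasFDerivAt (x := spacetime m ω l z)).comp_hasFDerivWithinAt z
    (h.hasFDerivWithinAt hm hω hz)
  rw [comp_jetCLM] at h1
  exact h1

/-- Since the source is real and the symbol is even and real, the Duhamel term is a real function
and its imaginary part vanishes. Hence `∂_t U = Re u` contains no source and can be differentiated
in time once more. -/
lemma Duhamel.jet_field (hN : 6 ≤ N) (hm : 1 ≤ m) (h : Duhamel m l F)
    (hF : ∀ t, conjL2 (F t) = F t) {z : ℝ × E3} (hz : z ∈ slab) :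
    HasFDerivWithinAt (fun z : ℝ × E3 => field N m l z.1 z.2)
      (jetCLM (spacetime m (wt (-N)) l z).re
        fun j => (spacetime m (xSym j (posSym N m)) l z).im) slab z := by
  have h1 := h.jet_im hm ((decay_posSym N hm).mono (by linarith)) hz
  rw [Complex.add_im, im_synth_eq_zero (hF z.1) (conj_posSym N m),
    tSym_posSym N (one_pos.trans_le hm), add_zero] at h1
  have e : (spacetime m (fun ξ => Complex.I * wt (-N) ξ) l z).im =
      (spacetime m (wt (-N)) l z).re := by
    rw [spacetime, synth_const_mul, Complex.I_mul_im]; rfl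
  rwa [e] at h1

/-- First derivatives have symbols decaying to order at least `N - 1 ≥ 5`, which is what being `C¹`
requires. -/
lemma Duhamel.contDiffOn_field (hN : 6 ≤ N) (hm : 1 ≤ m) (h : Duhamel m l F)
    (hF : ∀ t, conjL2 (F t) = F t) :
    ContDiffOn ℝ 2 (fun z : ℝ × E3 => field N m l z.1 z.2) slab := by
  refine contDiffOn_succ_of_jet (n := 1) (fun z hz => h.jet_field hN hm hF hz) ?_ fun j => ?_
  · exact Complex.reCLM.contDiff.comp_contDiffOn
      (h.contDiffOn_one hm ((decay_wt N).mono (by linarith)))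
  · exact Complex.imCLM.contDiff.comp_contDiffOn
      (h.contDiffOn_one hm (((decay_posSym N hm).xSym j).mono (by linarith)))

lemma Duhamel.timeDeriv_field (hN : 6 ≤ N) (hm : 1 ≤ m) (h : Duhamel m l F)
    (hF : ∀ t, conjL2 (F t) = F t) {t : ℝ} (ht : t ∈ Icc (0 : ℝ) 1) (x : E3) :
    timeDeriv (Icc 0 1) (field N m l) t x = (spacetime m (wt (-N)) l (t, x)).re :=
  timeDeriv_of_jet (fun _ hz => h.jet_field hN hm hF hz) ht x

lemma Duhamel.norm_sq_gradient_field (hN : 6 ≤ N) (hm : 1 ≤ m) (h : Duhamel m l F)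
    (hF : ∀ t, conjL2 (F t) = F t) {t : ℝ} (ht : t ∈ Icc (0 : ℝ) 1) (x : E3) :
    ‖gradient (field N m l t) x‖ ^ 2 =
      ∑ j, (spacetime m (xSym j (posSym N m)) l (t, x)).im ^ 2 :=
  norm_sq_gradient_of_jet (b := fun j z => (spacetime m (xSym j (posSym N m)) l z).im)
    (fun _ hz => h.jet_field hN hm hF hz) ht x

/-- Differentiating `Re u` in time gives `-Im ⟨D⟩_m u` plus the real part of the source. The
dispersion relation cancels the first against `Δ U - m² U`. The minus sign explains why the sources
are the negatives of the right-hand sides of the system. -/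
lemma Duhamel.box_field (hN : 6 ≤ N) (hm : 1 ≤ m) (h : Duhamel m l F)
    (hF : ∀ t, conjL2 (F t) = F t) {t : ℝ} (ht : t ∈ Icc (0 : ℝ) 1) (x : E3) :
    box (Icc 0 1) (field N m l) t x - m ^ 2 * field N m l t x =
      -(synth (wt (-N)) (F t) x).re := by
  have hm0 := one_pos.trans_le hm
  have hx := fun j => (((decay_posSym N hm).xSym j).xSym j).memLp (by linarith)
  have hb := ((decay_wt N).mul (decay_bracket hm)).memLp (by linarith)
  rw [box_of_jet (fun _ hz => h.jet_field hN hm hF hz)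
    (fun _ hz => h.jet_re hm ((decay_wt N).mono (by linarith)) hz)
    (b := fun j z => (spacetime m (xSym j (posSym N m)) l z).im)
    (fun j _ hz => h.jet_im hm (((decay_posSym N hm).xSym j).mono (by linarith)) hz) ht x]
  have e1 : (spacetime m (tSym m (wt (-N))) l (t, x)).re =
      -(spacetime m (fun ξ => (bracket m ξ : ℂ) * wt (-N) ξ) l (t, x)).im := by
    unfold tSym
    rw [spacetime, synth_const_mul, Complex.I_mul_re]; rfl
  have e2 : spacetime m (fun ξ => (bracket m ξ : ℂ) * wt (-N) ξ) l (t, x) +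
      (spacetime m (xSym 0 (xSym 0 (posSym N m))) l (t, x) +
        (spacetime m (xSym 1 (xSym 1 (posSym N m))) l (t, x) +
          spacetime m (xSym 2 (xSym 2 (posSym N m))) l (t, x))) =
      ((m ^ 2 : ℝ) : ℂ) * spacetime m (posSym N m) l (t, x) := by
    simp only [spacetime]
    have h12 : MemLp (fun ξ => xSym 1 (xSym 1 (posSym N m)) ξ + xSym 2 (xSym 2 (posSym N m)) ξ) 2 :=
      (hx 1).add (hx 2)
    have h02 : MemLp (fun ξ => xSym 0 (xSym 0 (posSym N m)) ξ +
      (xSym 1 (xSym 1 (posSym N m)) ξ + xSym 2 (xSym 2 (posSym N m)) ξ)) 2 := (hx 0).add h12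
    rw [← synth_add_symbol (hx 1) (hx 2), ← synth_add_symbol (hx 0) h12,
      ← synth_add_symbol hb h02, ← synth_const_mul]
    congr 1
    funext ξ
    push_cast
    exact symbol_identity N hm0 ξ
  have e3 := congrArg Complex.im e2
  rw [Complex.im_ofReal_mul] at e3
  simp only [Complex.add_im] at e3
  rw [Complex.add_re, e1, Fin.sum_univ_three, field]
  linarith

end Field

end

end KleinGordonEFT

/-! ### From the abstract profile equation to the nonlinear system for functions. -/

namespace KleinGordonEFT

noncomputable section

/-! ### Functions represented by the weighted space -/

lemma Exps.memLp_wt {N s : ℝ} (hNs : Exps N s) : MemLp (wt (-N)) 2 :=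
  KleinGordonEFT.memLp_wt (by linarith [hNs.six_lt])

variable {N s : ℝ} [hNs : Exps N s]

/-- The function on physical space represented by an element of the weighted space. -/
def funY (y : WSpace N s) (x : E3) : ℂ := synth (wt (-N)) y.1.1 x

lemma funY_prodY (y z : WSpace N s) (x : E3) : funY (prodY y z) x = funY y x * funY z x := by
  rw [funY, prodY_fst, synth_wconv, mul_comm]; rfl

lemma funY_add (y z : WSpace N s) (x : E3) : funY (y + z) x = funY y x + funY z x :=
  synth_add hNs.memLp_wt y.1.1 z.1.1 x

lemma funY_sub (y z : WSpace N s) (x : E3) : funY (y - z) x = funY y x - funY z x :=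
  synth_sub hNs.memLp_wt y.1.1 z.1.1 x

lemma funY_smul (c : ℝ) (y : WSpace N s) (x : E3) : funY (c • y) x = c * funY y x :=
  synth_smul hNs.memLp_wt c y.1.1 x

/-- The elements representing real-valued functions. -/
def realY (N s : ℝ) [Exps N s] : Submodule ℝ (WSpace N s) where
  carrier := {y | conjL2 y.1.1 = y.1.1}
  add_mem' := fun {y z} hy hz => by
    change conjL2 (y.1.1 + z.1.1) = y.1.1 + z.1.1
    rw [map_add, hy, hz]
  zero_mem' := map_zero _
  smul_mem' := fun c y hy => by
    change conjL2 (c • y.1.1) = c • y.1.1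
    rw [map_smul, hy]

lemma prodY_mem_realY {y z : WSpace N s} (hy : y ∈ realY N s) (hz : z ∈ realY N s) :
    prodY y z ∈ realY N s := by
  change conjL2 (prodY y z).1.1 = (prodY y z).1.1
  rw [prodY_fst, conjL2_wconv, hy, hz]

/-- The symmetry of `σ` says that conjugation anticommutes with `σ(D)`, and `u - ū` changes sign
under conjugation; the two signs cancel. -/
lemma multY_sub_conjY_mem_realY {σ : E3 → ℂ} (h : IsSymbol σ)
    (hσ : ∀ ξ, (starRingEnd ℂ) (σ (-ξ)) = -σ ξ) (u : WSpace N s) :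
    multY h (u - conjY u) ∈ realY N s := by
  change conjL2 (mulL2 σ (u.1.1 - conjL2 u.1.1)) = mulL2 σ (u.1.1 - conjL2 u.1.1)
  have hn : BddCont fun ξ => -σ ξ := by simpa using (bddCont_const (-1)).mul h.bddCont
  rw [conjL2_mulL2 h.bddCont hn hσ, map_sub, conjL2_conjL2]
  refine Lp.ext ?_
  filter_upwards [mulL2_ae hn (conjL2 u.1.1 - u.1.1), mulL2_ae h.bddCont (u.1.1 - conjL2 u.1.1),
    Lp.coeFn_sub u.1.1 (conjL2 u.1.1), Lp.coeFn_sub (conjL2 u.1.1) u.1.1] with ξ h1 h2 h3 h4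
  rw [h1, h2, h3, h4, Pi.sub_apply, Pi.sub_apply]; ring

lemma conj_fieldSym (m : ℝ) (ξ : E3) : (starRingEnd ℂ) (fieldSym m (-ξ)) = -fieldSym m ξ := by
  simp only [fieldSym, bracket_neg, map_mul, map_neg, Complex.conj_ofReal, map_div₀, Complex.conj_I,
    map_ofNat]
  ring

lemma conj_derSym (j : Fin 3) (ξ : E3) : (starRingEnd ℂ) (derSym j (-ξ)) = -derSym j ξ := by
  simp [derSym, bracket_neg]

lemma fieldY_mem_realY {m : ℝ} (hm : 1 ≤ m) (u : WSpace N s) : fieldY hm u ∈ realY N s :=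
  multY_sub_conjY_mem_realY (isSymbol_fieldSym hm) (conj_fieldSym m) u

lemma djY_mem_realY (j : Fin 3) (u : WSpace N s) : djY j u ∈ realY N s :=
  multY_sub_conjY_mem_realY (isSymbol_derSym j) (conj_derSym j) u

lemma dtY_mem_realY (u : WSpace N s) : dtY u ∈ realY N s := by
  change conjL2 ((1 / 2 : ℝ) • (u.1.1 + conjL2 u.1.1)) = (1 / 2 : ℝ) • (u.1.1 + conjL2 u.1.1)
  rw [map_smul, map_add, conjL2_conjL2, add_comm]

lemma funY_mult_sub_conjY {σ : E3 → ℂ} (h : IsSymbol σ)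
    (hσ : ∀ ξ, (starRingEnd ℂ) (σ (-ξ)) = -σ ξ) (u : WSpace N s) (x : E3) :
    funY (multY h (u - conjY u)) x = 2 * (synth (fun ξ => σ ξ * wt (-N) ξ) u.1.1 x).re := by
  have hω : MemLp (fun ξ => σ ξ * wt (-N) ξ) 2 :=
    ((decay_wt N).mul h.bddCont.decay).memLp (by linarith [hNs.six_lt])
  change synth (wt (-N)) (mulL2 σ (u.1.1 - conjL2 u.1.1)) x = _
  rw [synth_mulL2 h.bddCont, synth_sub hω]
  have h1 := conj_synth (ω := fun ξ => σ ξ * wt (-N) ξ) u.1.1 x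
  have e : (fun ξ => (starRingEnd ℂ) (σ (-ξ) * wt (-N) (-ξ))) =
      fun ξ => (-1 : ℂ) * (σ ξ * wt (-N) ξ) := by
    funext ξ
    rw [map_mul, hσ, conj_wt, wt_neg]; ring
  rw [e, synth_const_mul] at h1
  have h2 : synth (fun ξ => σ ξ * wt (-N) ξ) (conjL2 u.1.1) x =
      -(starRingEnd ℂ) (synth (fun ξ => σ ξ * wt (-N) ξ) u.1.1 x) := by
    rw [h1]; ring
  rw [h2, sub_neg_eq_add, Complex.add_conj]
  push_cast; ring

lemma funY_fieldY {m : ℝ} (hm : 1 ≤ m) (u : WSpace N s) (x : E3) :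
    funY (fieldY hm u) x = ((synth (posSym N m) u.1.1 x).im : ℂ) := by
  have h := funY_mult_sub_conjY (isSymbol_fieldSym hm) (conj_fieldSym m) u x
  have e : (fun ξ => fieldSym m ξ * wt (-N) ξ) =
      fun ξ => (-(Complex.I / 2)) * posSym N m ξ := by
    funext ξ
    rw [fieldSym, posSym]; ring
  rw [e, synth_const_mul] at h
  refine h.trans ?_
  have : (-(Complex.I / 2) * synth (posSym N m) u.1.1 x).re =
      (synth (posSym N m) u.1.1 x).im / 2 := by
    have : -(Complex.I / 2) = (((-1 / 2 : ℝ)) : ℂ) * Complex.I := by push_cast; ring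
    rw [this, mul_assoc, Complex.re_ofReal_mul, Complex.I_mul_re]; ring
  rw [this]; push_cast; ring

lemma funY_djY (j : Fin 3) (u : WSpace N s) (x : E3) :
    funY (djY j u) x = ((synth (xSym j (posSym N 1)) u.1.1 x).im : ℂ) := by
  have h := funY_mult_sub_conjY (isSymbol_derSym j) (conj_derSym j) u x
  have e : xSym j (posSym N 1) =
      fun ξ => (2 * Complex.I) * (derSym j ξ * wt (-N) ξ) := by
    funext ξ
    rw [xSym, posSym, derSym]; push_cast; ring
  rw [e, synth_const_mul]
  refine h.trans ?_
  have : (2 * Complex.I : ℂ) = ((2 : ℝ) : ℂ) * Complex.I := by push_cast; ring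
  rw [this, mul_assoc, Complex.im_ofReal_mul, Complex.I_mul_im]
  push_cast; ring

lemma funY_dtY (u : WSpace N s) (x : E3) :
    funY (dtY u) x = ((synth (wt (-N)) u.1.1 x).re : ℂ) := by
  change synth (wt (-N)) ((1 / 2 : ℝ) • (u.1.1 + conjL2 u.1.1)) x = _
  rw [synth_smul hNs.memLp_wt, synth_add hNs.memLp_wt]
  have h1 := conj_synth (ω := wt (-N)) u.1.1 x
  simp only [wt_neg, conj_wt] at h1
  rw [← h1, Complex.add_conj]
  push_cast; ring

lemma lightY_mem_realY {M : ℝ} (hM : 1 ≤ M) (u v : WSpace N s) : lightY hM u v ∈ realY N s := by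
  have hU := fieldY_mem_realY le_rfl u
  exact sub_mem (Submodule.smul_mem _ _ (prodY_mem_realY hU (prodY_mem_realY hU hU)))
    (prodY_mem_realY hU (fieldY_mem_realY hM v))

lemma heavyY_mem_realY {M : ℝ} (hM : 1 ≤ M) (u v : WSpace N s) : heavyY hM u v ∈ realY N s := by
  have hU := fieldY_mem_realY le_rfl u
  have hUU := prodY_mem_realY hU hU
  exact sub_mem (add_mem (sub_mem (Submodule.smul_mem _ _ (prodY_mem_realY hUU hUU))
    (prodY_mem_realY hUU (fieldY_mem_realY hM v)))
    (prodY_mem_realY (dtY_mem_realY u) (dtY_mem_realY u)))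
    (sum_mem fun j _ => prodY_mem_realY (djY_mem_realY j u) (djY_mem_realY j u))

lemma funY_lightY {M : ℝ} (hM : 1 ≤ M) (u v : WSpace N s) (x : E3) :
    funY (lightY hM u v) x =
      1 / 2 * funY (fieldY le_rfl u) x ^ 3 - funY (fieldY le_rfl u) x * funY (fieldY hM v) x := by
  rw [lightY, funY_sub, funY_smul, funY_prodY, funY_prodY, funY_prodY]
  push_cast; ring

lemma funY_heavyY {M : ℝ} (hM : 1 ≤ M) (u v : WSpace N s) (x : E3) :
    funY (heavyY hM u v) x =
      1 / 2 * funY (fieldY le_rfl u) x ^ 4 - funY (fieldY le_rfl u) x ^ 2 * funY (fieldY hM v) x +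
        funY (dtY u) x ^ 2 - ∑ j, funY (djY j u) x ^ 2 := by
  rw [heavyY, funY_sub, funY_add, funY_sub, funY_smul, Fin.sum_univ_three, funY_add, funY_add]
  simp only [funY_prodY, Fin.sum_univ_three]
  push_cast; ring

/-! ### The solution attached to a profile -/

/-- The light profile. -/
def lightProf (z : ℝ → WSpace N s × WSpace N s) (t : ℝ) : L2 := (z t).1.1.1

/-- The heavy profile. -/
def heavyProf (M : ℝ) (z : ℝ → WSpace N s × WSpace N s) (t : ℝ) : L2 :=
  ((Real.sqrt M)⁻¹ • (z t).2).1.1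

section Profile

variable {M : ℝ} (hM : 1 ≤ M) (z : ℝ → WSpace N s × WSpace N s)

/-- The light half wave. -/
def lightWave (z : ℝ → WSpace N s × WSpace N s) (t : ℝ) : WSpace N s := evolY le_rfl t (z t).1

/-- The heavy half wave. -/
def heavyWave (t : ℝ) : WSpace N s := evolY hM t ((Real.sqrt M)⁻¹ • (z t).2)

lemma field_lightProf (t : ℝ) (x : E3) :
    (field N 1 (lightProf z) t x : ℂ) = funY (fieldY le_rfl (lightWave z t)) x := by
  rw [funY_fieldY]; rfl

lemma field_heavyProf (t : ℝ) (x : E3) :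
    (field N M (heavyProf M z) t x : ℂ) = funY (fieldY hM (heavyWave hM z t)) x := by
  rw [funY_fieldY]; rfl

lemma synth_eq_funY_lightWave (t : ℝ) (x : E3) :
    (((spacetime 1 (wt (-N)) (lightProf z) (t, x)).re : ℝ) : ℂ) = funY (dtY (lightWave z t)) x := by
  rw [funY_dtY]; rfl

lemma synth_eq_funY_heavyWave (t : ℝ) (x : E3) :
    (((spacetime M (wt (-N)) (heavyProf M z) (t, x)).re : ℝ) : ℂ) =
      funY (dtY (heavyWave hM z t)) x := by
  rw [funY_dtY]; rfl

lemma xSym_eq_funY_lightWave (j : Fin 3) (t : ℝ) (x : E3) :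
    (((spacetime 1 (xSym j (posSym N 1)) (lightProf z) (t, x)).im : ℝ) : ℂ) =
      funY (djY j (lightWave z t)) x := by
  rw [funY_djY]; rfl

/-- The light source along the solution. -/
def lightSrc (t : ℝ) : L2 := (lightY hM (lightWave z t) (heavyWave hM z t)).1.1

/-- The heavy source along the solution. -/
def heavySrc (t : ℝ) : L2 := (heavyY hM (lightWave z t) (heavyWave hM z t)).1.1

variable {z}

/-- The scaling `w = √M v` commutes with the linear propagator, so the source is evaluated at the
true half waves. -/
lemma sourceY_evolPair (t : ℝ) : sourceY hM (evolPair hM t (z t)) =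
    (lightY hM (lightWave z t) (heavyWave hM z t),
      Real.sqrt M • heavyY hM (lightWave z t) (heavyWave hM z t)) := by
  have e : heavyWave hM z t = (Real.sqrt M)⁻¹ • evolY hM t (z t).2 := map_smul _ _ _
  rw [e]; rfl

lemma duhamel_light
    (hz : ∀ t ∈ Icc (0 : ℝ) 1, HasDerivWithinAt z (profileField hM t (z t)) (Icc 0 1) t) :
    Duhamel 1 (lightProf z) (lightSrc hM z) := by
  let π : WSpace N s × WSpace N s →L[ℝ] L2 := (ContinuousLinearMap.fst ℝ L2 (Fin 3 → L2)).comp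
    ((WSpace N s).subtypeL.comp (ContinuousLinearMap.fst ℝ (WSpace N s) (WSpace N s)))
  have e : ∀ t, π (profileField hM t (z t)) = mulL2 (expSym 1 (-t)) (lightSrc hM z t) := fun t => by
    rw [profileField, sourceY_evolPair]; rfl
  refine ⟨fun t ht => ?_, ?_⟩
  · rw [← e]
    exact π.hasFDerivAt.comp_hasDerivWithinAt t (hz t ht)
  · simp only [← e]
    exact π.continuous.comp_continuousOn
      (continuousOn_profileField hM fun t ht => (hz t ht).continuousWithinAt)

lemma duhamel_heavy
    (hz : ∀ t ∈ Icc (0 : ℝ) 1, HasDerivWithinAt z (profileField hM t (z t)) (Icc 0 1) t) :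
    Duhamel M (heavyProf M z) (heavySrc hM z) := by
  let π : WSpace N s × WSpace N s →L[ℝ] L2 := (ContinuousLinearMap.fst ℝ L2 (Fin 3 → L2)).comp
    ((WSpace N s).subtypeL.comp
      ((Real.sqrt M)⁻¹ • (ContinuousLinearMap.snd ℝ (WSpace N s) (WSpace N s))))
  have hq : Real.sqrt M ≠ 0 := (Real.sqrt_pos.2 (one_pos.trans_le hM)).ne'
  have e : ∀ t, π (profileField hM t (z t)) = mulL2 (expSym M (-t)) (heavySrc hM z t) := fun t => by
    rw [profileField, sourceY_evolPair]
    change ((Real.sqrt M)⁻¹ • evolY hM (-t) (Real.sqrt M • heavyY hM (lightWave z t)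
      (heavyWave hM z t))).1.1 = _
    rw [← map_smul, inv_smul_smul₀ hq]; rfl
  refine ⟨fun t ht => ?_, ?_⟩
  · rw [← e]
    exact π.hasFDerivAt.comp_hasDerivWithinAt t (hz t ht)
  · simp only [← e]
    exact π.continuous.comp_continuousOn
      (continuousOn_profileField hM fun t ht => (hz t ht).continuousWithinAt)

lemma timeDeriv_light
    (hz : ∀ t ∈ Icc (0 : ℝ) 1, HasDerivWithinAt z (profileField hM t (z t)) (Icc 0 1) t)
    {t : ℝ} (ht : t ∈ Icc (0 : ℝ) 1) (x : E3) :
    ((timeDeriv (Icc 0 1) (field N 1 (lightProf z)) t x : ℝ) : ℂ) =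
      funY (dtY (lightWave z t)) x := by
  rw [(duhamel_light hM hz).timeDeriv_field hNs.six_lt.le le_rfl
    (fun t => lightY_mem_realY hM _ _) ht, synth_eq_funY_lightWave]

lemma timeDeriv_heavy
    (hz : ∀ t ∈ Icc (0 : ℝ) 1, HasDerivWithinAt z (profileField hM t (z t)) (Icc 0 1) t)
    {t : ℝ} (ht : t ∈ Icc (0 : ℝ) 1) (x : E3) :
    ((timeDeriv (Icc 0 1) (field N M (heavyProf M z)) t x : ℝ) : ℂ) =
      funY (dtY (heavyWave hM z t)) x := by
  rw [(duhamel_heavy hM hz).timeDeriv_field hNs.six_lt.le hM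
    (fun t => heavyY_mem_realY hM _ _) ht, synth_eq_funY_heavyWave hM]

/-- Both equations are the identity of `Duhamel.box_field` with the source evaluated pointwise. The
functions of the weighted space are complex valued, so the polynomial identity is obtained in `ℂ`
and its real part taken. -/
lemma isSolution_of_profile
    (hz : ∀ t ∈ Icc (0 : ℝ) 1, HasDerivWithinAt z (profileField hM t (z t)) (Icc 0 1) t) :
    IsSolution M (Icc 0 1) (field N 1 (lightProf z)) (field N M (heavyProf M z)) := by
  have hN := hNs.six_lt.le
  have h1 := duhamel_light hM hz
  have h2 := duhamel_heavy hM hz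
  have r1 : ∀ t, conjL2 (lightSrc hM z t) = lightSrc hM z t := fun t => lightY_mem_realY hM _ _
  have r2 : ∀ t, conjL2 (heavySrc hM z t) = heavySrc hM z t := fun t => heavyY_mem_realY hM _ _
  refine ⟨h1.contDiffOn_field hN le_rfl r1, h2.contDiffOn_field hN hM r2, fun t ht x => ?_,
    fun t ht x => ?_⟩
  · have h3 := h1.box_field hN le_rfl r1 ht x
    have h4 : synth (wt (-N)) (lightSrc hM z t) x = _ :=
      funY_lightY hM (lightWave z t) (heavyWave hM z t) x
    rw [← field_lightProf, ← field_heavyProf] at h4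
    have h5 : (synth (wt (-N)) (lightSrc hM z t) x).re = 1 / 2 * field N 1 (lightProf z) t x ^ 3 -
        field N 1 (lightProf z) t x * field N M (heavyProf M z) t x := by
      refine (congrArg Complex.re (h4.trans ?_)).trans (Complex.ofReal_re _)
      push_cast; ring
    rw [h5] at h3
    linarith
  · have h3 := h2.box_field hN hM r2 ht x
    have h4 : synth (wt (-N)) (heavySrc hM z t) x = _ :=
      funY_heavyY hM (lightWave z t) (heavyWave hM z t) x
    rw [← field_lightProf, ← field_heavyProf, ← timeDeriv_light hM hz ht] at h4
    simp only [← xSym_eq_funY_lightWave] at h4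
    have h5 : (synth (wt (-N)) (heavySrc hM z t) x).re = 1 / 2 * field N 1 (lightProf z) t x ^ 4 -
        field N 1 (lightProf z) t x ^ 2 * field N M (heavyProf M z) t x +
        timeDeriv (Icc 0 1) (field N 1 (lightProf z)) t x ^ 2 -
        ∑ j, (spacetime 1 (xSym j (posSym N 1)) (lightProf z) (t, x)).im ^ 2 := by
      refine (congrArg Complex.re (h4.trans ?_)).trans (Complex.ofReal_re _)
      push_cast; ring
    rw [h5, ← h1.norm_sq_gradient_field hN le_rfl r1 ht x] at h3
    rw [nullForm]
    linarith

end Profile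

end

end KleinGordonEFT

/-! ### Identification with tempered distributions and Sobolev norms. -/

namespace KleinGordonEFT

noncomputable section

open scoped FourierTransform LineDeriv

/-! ### Tempered distributions attached to the weighted space -/

/-- The tempered distribution with Fourier transform `ω a`. -/
def dist (ω : E3 → ℂ) (a : L2) : 𝓢'(E3, ℂ) :=
  𝓕⁻ (TemperedDistribution.smulLeftCLM ℂ ω (Lp.toTemperedDistribution a))

lemma toTemperedDistribution_apply_eq (a : L2) (ψ : 𝓢(E3, ℂ)) :
    (Lp.toTemperedDistribution a : 𝓢'(E3, ℂ)) ψ = pairS ψ a := by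
  rw [Lp.toTemperedDistribution_apply, pairS_apply]; rfl

lemma dist_apply (ω : E3 → ℂ) (a : L2) (φ : 𝓢(E3, ℂ)) :
    dist ω a φ = pairS (SchwartzMap.smulLeftCLM ℂ ω (𝓕⁻ φ)) a := by
  rw [← toTemperedDistribution_apply_eq]; rfl

lemma dist_add (ω : E3 → ℂ) (a b : L2) : dist ω (a + b) = dist ω a + dist ω b := by
  ext φ
  simp only [dist_apply, map_add, add_apply]

lemma dist_smul (ω : E3 → ℂ) (c : ℝ) (a : L2) : dist ω (c • a) = (c : ℂ) • dist ω a := by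
  ext φ
  simp only [dist_apply, map_smul, smul_apply, Complex.real_smul, smul_eq_mul]

lemma fourierMultiplier_dist {σ ω : E3 → ℂ} (hσ : σ.HasTemperateGrowth)
    (hω : ω.HasTemperateGrowth) (a : L2) :
    TemperedDistribution.fourierMultiplierCLM ℂ σ (dist ω a) = dist (fun ξ => σ ξ * ω ξ) a := by
  rw [TemperedDistribution.fourierMultiplierCLM_apply, dist, FourierTransform.fourier_fourierInv_eq,
    TemperedDistribution.smulLeftCLM_smulLeftCLM_apply hω hσ, mul_comm]
  rfl

lemma dist_mulL2 {σ ω : E3 → ℂ} (hσ : IsSymbol σ) (hω : ω.HasTemperateGrowth) (a : L2) :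
    dist ω (mulL2 σ a) = dist (fun ξ => σ ξ * ω ξ) a := by
  ext φ
  rw [dist_apply, dist_apply, pairS, pairL2_mulL2 hσ.bddCont, mulL2_toLp hσ,
    SchwartzMap.smulLeftCLM_smulLeftCLM_apply hσ.temperate hω]
  rfl

lemma temperate_wt (r : ℝ) : (wt r).HasTemperateGrowth :=
  Complex.ofRealCLM.hasTemperateGrowth.comp (hasTemperateGrowth_bracket_rpow one_pos r)

lemma dist_wt_zero (a : L2) :
    dist (wt 0) a = Lp.toTemperedDistribution (𝓕⁻ a : L2) := by
  rw [← Lp.fourierInv_toTemperedDistribution_eq, dist]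
  have : wt 0 = fun _ => 1 := funext wt_zero
  rw [this, TemperedDistribution.smulLeftCLM_const, one_smul]

lemma besselOp_dist (r q : ℝ) (a : L2) : besselOp r (dist (wt q) a) = dist (wt (r + q)) a := by
  have h := fourierMultiplier_dist (temperate_wt r) (temperate_wt q) a
  simp only [wt_mul] at h
  exact h

lemma isLpFunction_toTemperedDistribution (f : L2) :
    IsLpFunction 2 (Lp.toTemperedDistribution f) f :=
  ⟨Lp.memLp f, fun φ => by rw [Lp.toTemperedDistribution_apply]; rfl⟩

lemma IsLpFunction.toTemperedDistribution_eq {T : 𝓢'(E3, ℂ)} {f : E3 → ℂ}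
    (h : IsLpFunction 2 T f) : Lp.toTemperedDistribution (h.1.toLp f) = T := by
  ext φ
  rw [h.2, Lp.toTemperedDistribution_apply]
  refine integral_congr_ae ?_
  filter_upwards [h.1.coeFn_toLp] with x hx
  rw [hx]; rfl

lemma toTemperedDistribution_injective :
    Function.Injective (Lp.toTemperedDistribution : L2 → 𝓢'(E3, ℂ)) := by
  have h := Lp.ker_toTemperedDistributionCLM_eq_bot (F := ℂ) (μ := (volume : Measure E3)) (p := 2)
  exact LinearMap.ker_eq_bot.1 h

lemma sobolevNorm_dist_le (r : ℝ) (a : L2) : sobolevNorm r 2 (dist (wt (-r)) a) ≤ ‖a‖ₑ := by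
  have h : IsLpFunction 2 (besselOp r (dist (wt (-r)) a)) (𝓕⁻ a : L2) := by
    rw [besselOp_dist, add_neg_cancel, dist_wt_zero]
    exact isLpFunction_toTemperedDistribution _
  refine (iInf₂_le _ h).trans_eq ?_
  have h2 : ‖(𝓕⁻ a : L2)‖ = ‖a‖ := (Lp.fourierTransformₗᵢ E3 ℂ).symm.norm_map a
  rw [← Lp.enorm_def, enorm_eq_iff_norm_eq, h2]

/-- A finite norm means that the infimum runs over a nonempty set, hence that `⟨D⟩^r T` is an `L²`
function; `a` is its Fourier transform. Plancherel makes the norms equal, without a constant. -/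
lemma exists_dist_eq {r : ℝ} {T : 𝓢'(E3, ℂ)} (h : sobolevNorm r 2 T ≠ ∞) :
    ∃ a : L2, dist (wt (-r)) a = T ∧ ‖a‖ₑ = sobolevNorm r 2 T := by
  have hex : ∃ f, IsLpFunction 2 (besselOp r T) f := by
    by_contra hne
    push Not at hne
    refine h (iInf₂_eq_top.2 fun f hf => absurd hf (hne f))
  obtain ⟨f, hf⟩ := hex
  let g : L2 := hf.1.toLp f
  have hg : ‖(𝓕 g : L2)‖ = ‖g‖ := Lp.norm_fourier_eq g
  refine ⟨𝓕 g, ?_, le_antisymm (le_iInf₂ fun f' hf' => ?_) ?_⟩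
  · have h1 : dist (wt 0) (𝓕 g) = besselOp r T := by
      rw [dist_wt_zero, FourierTransform.fourierInv_fourier_eq]
      exact hf.toTemperedDistribution_eq
    have h2 := besselOp_dist (-r) 0 (𝓕 g)
    rw [h1, add_zero] at h2
    have h3 := TemperedDistribution.fourierMultiplierCLM_fourierMultiplierCLM_apply
      (temperate_wt r) (temperate_wt (-r)) T
    rw [← h2]
    refine h3.trans ?_
    have : wt r * wt (-r) = fun _ => 1 := by
      funext ξ
      rw [Pi.mul_apply, wt_mul, add_neg_cancel, wt_zero]
    rw [this, TemperedDistribution.fourierMultiplierCLM_const]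
    simp
  -- Two `L²` functions representing the same distribution agree almost everywhere, so the infimum
  -- is over a single class and is attained.
  · have h1 : hf.1.toLp f = hf'.1.toLp f' := toTemperedDistribution_injective
      (hf.toTemperedDistribution_eq.trans hf'.toTemperedDistribution_eq.symm)
    have h2 : ‖g‖ₑ = eLpNorm f' 2 volume := by
      change ‖hf.1.toLp f‖ₑ = _
      rw [h1, Lp.enorm_toLp]
    rw [← h2, enorm_le_iff_norm_le, hg]
  · refine (iInf₂_le _ hf).trans_eq ?_
    have h2 : ‖g‖ₑ = eLpNorm f 2 volume := Lp.enorm_toLp _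
    rw [← h2, enorm_eq_iff_norm_eq, hg]

/-- Multiplication by `x_j` is a derivative on the Fourier side. -/
lemma coordMul_fourierInv (j : Fin 3) (T : 𝓢'(E3, ℂ)) :
    tpi • coordMul j (𝓕⁻ T) = -𝓕⁻ (∂_{ej j} T) := by
  rw [TemperedDistribution.fourierInv_lineDerivOp_eq, neg_smul, neg_neg]
  have : (fun x : E3 => ((x j : ℝ) : ℂ)) = fun x : E3 => ((inner ℝ x (ej j) : ℝ) : ℂ) := by
    funext x
    simp [EuclideanSpace.inner_single_right]
  rw [coordMul, this]

lemma pairS_mulL2 {σ : E3 → ℂ} (hb : BddCont σ) (ht : σ.HasTemperateGrowth) (ψ : 𝓢(E3, ℂ))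
    (a : L2) : pairS ψ (mulL2 σ a) = pairS (SchwartzMap.smulLeftCLM ℂ σ ψ) a := by
  rw [pairS_congr ψ (mulL2_ae hb a), pairS_apply]
  refine integral_congr_ae (ae_of_all _ fun ξ => ?_)
  beta_reduce
  rw [SchwartzMap.smulLeftCLM_apply_apply ht, smul_eq_mul]; ring

lemma fourierInv_injective : Function.Injective (𝓕⁻ : 𝓢'(E3, ℂ) → 𝓢'(E3, ℂ)) :=
  fun S T h => by
    have h1 := congrArg (𝓕 : 𝓢'(E3, ℂ) → 𝓢'(E3, ℂ)) h
    rwa [FourierTransform.fourier_fourierInv_eq, FourierTransform.fourier_fourierInv_eq] at h1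

/-- After inverse Fourier transform, the weak derivative relation is the statement that `b_j`
represents `x_j u`. The weighted space thus consists exactly of the distributions for which both
data norms are finite. -/
lemma mem_WSpace_iff {N s : ℝ} (hN : 0 ≤ N) (hs : 0 ≤ s) (y : L2 × (Fin 3 → L2)) :
    y ∈ WSpace N s ↔ ∀ j, coordMul j (dist (wt (-N)) y.1) = dist (wt (-s)) (y.2 j) := by
  refine forall_congr' fun j => ?_
  rw [← (smul_right_injective (𝓢'(E3, ℂ)) tpi_ne_zero).eq_iff]
  simp only [dist]
  rw [coordMul_fourierInv, ← FourierTransform.fourierInv_smul, ← FourierTransform.fourierInv_neg,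
    fourierInv_injective.eq_iff, DFunLike.ext_iff]
  refine forall_congr' fun ψ => ?_
  rw [pairS_mulL2 (bddCont_wt (by linarith)) (temperate_wt _),
    pairS_mulL2 (bddCont_wt (by linarith)) (temperate_wt _), eq_comm]
  simp only [neg_apply, smul_apply, TemperedDistribution.lineDerivOp_apply_apply,
    TemperedDistribution.smulLeftCLM_apply_apply, toTemperedDistribution_apply_eq, smul_eq_mul,
    map_neg, neg_neg]

/-! ### Continuous representatives -/

lemma integral_fourierInv_mul (φ : 𝓢(E3, ℂ)) {g : E3 → ℂ} (hg : Integrable g) :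
    ∫ ξ, (𝓕⁻ φ) ξ * g ξ = ∫ x, φ x * 𝓕⁻ g x := by
  have h := VectorFourier.integral_fourierIntegral_smul_eq_flip (μ := (volume : Measure E3))
    (ν := (volume : Measure E3)) (L := -innerₗ E3) (f := φ) (g := g) Real.continuous_fourierChar
    (by
      change Continuous fun p : E3 × E3 => -inner ℝ p.1 p.2
      fun_prop) φ.integrable hg
  have e : (-innerₗ E3).flip = -innerₗ E3 := by
    ext x y; simp [real_inner_comm]
  rw [e] at h
  rw [SchwartzMap.fourierInv_coe]
  exact h

lemma continuous_synth {ω : E3 → ℂ} (h2 : MemLp ω 2) (a : L2) : Continuous (synth ω a) := by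
  refine continuous_of_dominated (bound := fun ξ => ‖ω ξ * a ξ‖)
    (fun x => (integrable_exp_mul h2 a x).1) (fun x => ae_of_all _ fun ξ => ?_)
    (h2.integrable_mul (Lp.memLp a)).norm (ae_of_all _ fun ξ => by fun_prop)
  rw [norm_mul, Complex.norm_exp_ofReal_mul_I, one_mul]

lemma dist_apply_eq_integral {ω : E3 → ℂ} (hω : ω.HasTemperateGrowth) (h2 : MemLp ω 2) (a : L2)
    (φ : 𝓢(E3, ℂ)) : dist ω a φ = ∫ x, φ x * synth ω a x := by
  rw [dist_apply, pairS_apply]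
  have h := integral_fourierInv_mul φ (g := fun ξ => ω ξ * a ξ) (h2.integrable_mul (Lp.memLp a))
  simp only [← synth_eq_fourierInv] at h
  rw [← h]
  refine integral_congr_ae (ae_of_all _ fun ξ => ?_)
  beta_reduce
  rw [SchwartzMap.smulLeftCLM_apply_apply hω, smul_eq_mul]; ring

lemma ae_eq_of_schwartz {f g : E3 → ℂ} (hf : LocallyIntegrable f) (hg : LocallyIntegrable g)
    (h : ∀ φ : 𝓢(E3, ℂ), ∫ x, φ x * f x = ∫ x, φ x * g x) : f =ᵐ[volume] g := by
  refine ae_eq_of_integral_contDiff_smul_eq hf hg fun ψ hψ hc => ?_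
  have h1 : HasCompactSupport (Complex.ofRealCLM ∘ ψ) := hc.comp_left rfl
  have h2 := Complex.ofRealCLM.contDiff.comp hψ
  have h3 := h (h1.toSchwartzMap h2)
  simpa [Complex.real_smul] using h3

/-- The absolutely convergent inverse transform and the one given by Plancherel define the same
distribution, hence the same function almost everywhere. The former is continuous, the latter has a
computable `L²` norm; both properties are needed of one function. -/
lemma synth_ae_eq {ω : E3 → ℂ} (hω : ω.HasTemperateGrowth) (hb : BddCont ω) (h2 : MemLp ω 2)
    (a : L2) : synth ω a =ᵐ[volume] (𝓕⁻ (mulL2 ω a) : L2) := by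
  refine ae_eq_of_schwartz (continuous_synth h2 a).locallyIntegrable
    ((Lp.memLp _).locallyIntegrable (by norm_num)) fun φ => ?_
  rw [← dist_apply_eq_integral hω h2]
  have h3 : dist (wt 0) (mulL2 ω a) φ = dist ω a φ := by
    rw [dist_apply, dist_apply, pairS_mulL2 hb hω, SchwartzMap.smulLeftCLM_smulLeftCLM_apply hω
      (temperate_wt 0)]
    have : ω * wt 0 = ω := by funext ξ; rw [Pi.mul_apply, wt_zero, mul_one]
    rw [this]
  rw [← h3, dist_wt_zero, Lp.toTemperedDistribution_apply]
  rfl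

lemma memLp_synth {ω : E3 → ℂ} (hω : ω.HasTemperateGrowth) (hb : BddCont ω) (h2 : MemLp ω 2)
    (a : L2) : MemLp (synth ω a) 2 :=
  (memLp_congr_ae (synth_ae_eq hω hb h2 a)).2 (Lp.memLp _)

lemma isLpFunction_dist {ω : E3 → ℂ} (hω : ω.HasTemperateGrowth) (hb : BddCont ω) (h2 : MemLp ω 2)
    (a : L2) : IsLpFunction 2 (dist ω a) (synth ω a) :=
  ⟨memLp_synth hω hb h2 a, dist_apply_eq_integral hω h2 a⟩

lemma eLpNorm_synth {ω : E3 → ℂ} (hω : ω.HasTemperateGrowth) (hb : BddCont ω) (h2 : MemLp ω 2)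
    (a : L2) : eLpNorm (synth ω a) 2 volume = ‖mulL2 ω a‖ₑ := by
  have h : ‖(𝓕⁻ (mulL2 ω a) : L2)‖ = ‖mulL2 ω a‖ :=
    (Lp.fourierTransformₗᵢ E3 ℂ).symm.norm_map _
  rw [eLpNorm_congr_ae (synth_ae_eq hω hb h2 a), ← Lp.enorm_def, enorm_eq_iff_norm_eq, h]

end

end KleinGordonEFT

/-! ### Norm estimates with explicit constants. -/

namespace KleinGordonEFT

noncomputable section

/-! ### The decay norm -/

lemma lintegral_enorm_wt_sq_le {r : ℝ} (hr : r ≤ -6) :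
    ∫⁻ ξ, ‖wt r ξ‖ₑ ^ 2 ≤ ENNReal.ofReal (1 / 8) := by
  have h0 : ∀ ξ : E3, 0 ≤ bracket 1 ξ ^ (-12 : ℝ) := fun ξ =>
    Real.rpow_nonneg (bracket_nonneg 1 ξ) _
  have hi : Integrable fun ξ : E3 => bracket 1 ξ ^ (-12 : ℝ) :=
    integrable_bracket_neg_four.mono' (continuous_bracket_rpow _).aestronglyMeasurable
      (ae_of_all _ fun ξ => by
        rw [Real.norm_of_nonneg (h0 ξ)]
        exact bracket_rpow_mono (by norm_num) ξ)
  calc ∫⁻ ξ, ‖wt r ξ‖ₑ ^ 2 ≤ ∫⁻ ξ, ENNReal.ofReal (bracket 1 ξ ^ (-12 : ℝ)) := by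
        refine lintegral_mono fun ξ => ?_
        have h1 : bracket 1 ξ ^ (-12 : ℝ) = (bracket 1 ξ ^ (-6 : ℝ)) ^ 2 := by
          rw [← Real.rpow_natCast, ← Real.rpow_mul (bracket_nonneg 1 ξ)]; norm_num
        rw [h1, ENNReal.ofReal_pow (Real.rpow_nonneg (bracket_nonneg 1 ξ) _), ← ofReal_norm,
          norm_wt]
        exact pow_le_pow_left₀ zero_le (ENNReal.ofReal_le_ofReal (bracket_rpow_mono hr ξ)) 2
    _ = ENNReal.ofReal (∫ ξ : E3, bracket 1 ξ ^ (-12 : ℝ)) :=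
      (ofReal_integral_eq_lintegral_ofReal hi (ae_of_all _ h0)).symm
    _ ≤ _ := ENNReal.ofReal_le_ofReal integral_bracket_neg_twelve_le

lemma enorm_synth_sq_le {r : ℝ} (hr : r ≤ -6) (a : L2) (x : E3) :
    ‖synth (wt r) a x‖ₑ ^ 2 ≤ ENNReal.ofReal (1 / 8) * ‖a‖ₑ ^ 2 := by
  have h1 : ‖synth (wt r) a x‖ₑ ≤ ∫⁻ ξ, ‖wt r ξ‖ₑ * ‖a ξ‖ₑ := by
    refine (enorm_integral_le_lintegral_enorm _).trans (le_of_eq (lintegral_congr fun ξ => ?_))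
    rw [enorm_mul, enorm_mul, ← ofReal_norm, Complex.norm_exp_ofReal_mul_I]
    simp
  calc _ ≤ (∫⁻ ξ, ‖wt r ξ‖ₑ * ‖a ξ‖ₑ) ^ 2 := by gcongr
    _ ≤ _ := sq_lintegral_mul_le volume (continuous_wt r).measurable.enorm.aemeasurable
      (measurable_coe a).enorm.aemeasurable
    _ ≤ _ := by
      rw [← enorm_sq_eq_lintegral]
      gcongr
      exact lintegral_enorm_wt_sq_le hr

/-- Interpolation between the sup bound `√c A` and the `L²` bound `A`: the integrand is `|f|^{q-2}
|f|²`. -/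
lemma eLpNorm_le_of_sq_le {f : E3 → ℂ} {c A : ℝ≥0∞} (hc : c ≠ ∞) (hA : A ≠ ∞) (h1 : ∀ x, ‖f x‖ₑ ^ 2 ≤ c * A ^ 2)
    (h2 : ∫⁻ x, ‖f x‖ₑ ^ 2 ≤ A ^ 2) {q : ℝ} (hq : 2 ≤ q) :
    eLpNorm f (ENNReal.ofReal q) volume ≤ c ^ ((q - 2) / (2 * q)) * A := by
  have hq0 : 0 < q := by linarith
  rw [eLpNorm_eq_lintegral_rpow_enorm_toReal (by simpa using hq0) ENNReal.ofReal_ne_top,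
    ENNReal.toReal_ofReal hq0.le]
  have h3 : ∀ y : ℝ≥0∞, y ^ q = (y ^ 2) ^ ((q - 2) / 2) * y ^ 2 := fun y => by
    rw [← ENNReal.rpow_natCast, ← ENNReal.rpow_mul, ← ENNReal.rpow_add_of_nonneg _ _
      (by push_cast; linarith) (by positivity)]
    congr 1; push_cast; ring
  have h4 : ∫⁻ x, ‖f x‖ₑ ^ q ≤ (c * A ^ 2) ^ ((q - 2) / 2) * A ^ 2 := by
    calc ∫⁻ x, ‖f x‖ₑ ^ q ≤ ∫⁻ x, (c * A ^ 2) ^ ((q - 2) / 2) * ‖f x‖ₑ ^ 2 := by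
          refine lintegral_mono fun x => ?_
          rw [h3]
          have := ENNReal.rpow_le_rpow (h1 x) (by linarith : 0 ≤ (q - 2) / 2)
          gcongr
      _ = (c * A ^ 2) ^ ((q - 2) / 2) * ∫⁻ x, ‖f x‖ₑ ^ 2 :=
        lintegral_const_mul' _ _ (ENNReal.rpow_ne_top_of_nonneg (by linarith) (by finiteness))
      _ ≤ _ := by gcongr
  refine (ENNReal.rpow_le_rpow h4 (by positivity)).trans_eq ?_
  rw [ENNReal.mul_rpow_of_nonneg c _ (by linarith : 0 ≤ (q - 2) / 2), mul_assoc, ← h3,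
    ENNReal.mul_rpow_of_nonneg _ _ (by positivity), ← ENNReal.rpow_mul, ← ENNReal.rpow_mul]
  rw [mul_one_div_cancel hq0.ne', ENNReal.rpow_one]
  congr 2
  field_simp

variable {N s : ℝ}

/-- The tempered distribution represented by an element of the weighted space. -/
def distY (y : WSpace N s) : 𝓢'(E3, ℂ) := dist (wt (-N)) y.1.1

/-- The six derivatives of `H^N` above `k` allow the sup bound with `∫ ⟨ξ⟩^{-12} ≤ 1/8`. The
exponent is `(q-2)/(2q) = 17/42` for `q = p = 21/2`. -/
lemma sobolevNorm_decay_distY_le {k : ℝ} (hk : k + 6 ≤ N) (y : WSpace N s) :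
    sobolevNorm k decayExponent (distY y) ≤
      ENNReal.ofReal (1 / 8) ^ (17 / 42 : ℝ) * ‖y.1.1‖ₑ := by
  have hr : k + -N ≤ -6 := by linarith
  have hb := bddCont_wt (s := k + -N) (by linarith)
  have h2 := memLp_wt (s := k + -N) (by linarith)
  have he : decayExponent = ENNReal.ofReal (21 / 2) := by
    rw [decayExponent, delta]; norm_num
  have h3 : eLpNorm (synth (wt (k + -N)) y.1.1) decayExponent volume ≤
      ENNReal.ofReal (1 / 8) ^ (17 / 42 : ℝ) * ‖y.1.1‖ₑ := by
    have h4 := eLpNorm_le_of_sq_le ENNReal.ofReal_ne_top enorm_ne_top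
      (enorm_synth_sq_le hr y.1.1) (q := 21 / 2) (by
      rw [← eLpNorm_two_sq, eLpNorm_synth (temperate_wt _) hb h2]
      have := norm_mulL2_le hb (C := 1) (fun ξ => by
        rw [norm_wt]; exact bracket_rpow_le_one (by linarith) ξ) y.1.1
      rw [one_mul] at this
      gcongr
      exact enorm_le_iff_norm_le.2 this) (by norm_num)
    rw [he]
    refine h4.trans_eq ?_
    norm_num
  have h4 : IsLpFunction decayExponent (besselOp k (distY y)) (synth (wt (k + -N)) y.1.1) := by
    rw [distY, besselOp_dist]
    refine ⟨⟨(continuous_synth h2 _).aestronglyMeasurable, h3.trans_lt ?_⟩,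
      dist_apply_eq_integral (temperate_wt _) h2 _⟩
    exact ENNReal.mul_lt_top (ENNReal.rpow_lt_top_of_nonneg (by norm_num) (by finiteness))
      (by finiteness)
  exact (iInf₂_le _ h4).trans h3

/-- On unit time the weight is at most `2^{17/28}` and the Sobolev constant is `2^{-17/14}`, so the
product is at most `2^{-17/28}`. Being below 1, it leaves room for the drift in the final bound. -/
lemma jap_mul_le {τ : ℝ} (hτ : τ ^ 2 ≤ 1) :
    ENNReal.ofReal (jap τ ^ (1 + 3 * delta)) * ENNReal.ofReal (1 / 8) ^ (17 / 42 : ℝ) ≤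
      ENNReal.ofReal (9 / 10) := by
  have hj : 0 ≤ jap τ := Real.sqrt_nonneg _
  rw [ENNReal.ofReal_rpow_of_nonneg (by norm_num) (by norm_num), ← ENNReal.ofReal_mul (by positivity)]
  refine ENNReal.ofReal_le_ofReal ?_
  have h1 : jap τ ^ (1 + 3 * delta) ≤ 2 ^ (17 / 28 : ℝ) := by
    calc jap τ ^ (1 + 3 * delta) ≤ Real.sqrt 2 ^ (1 + 3 * delta) := by
          refine Real.rpow_le_rpow hj (Real.sqrt_le_sqrt (by linarith)) (by norm_num [delta])
      _ = _ := by
        rw [Real.sqrt_eq_rpow, ← Real.rpow_mul (by norm_num), delta]; norm_num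
  have h2 : (1 / 8 : ℝ) ^ (17 / 42 : ℝ) = 2 ^ (-(17 / 14) : ℝ) := by
    have : (1 / 8 : ℝ) = 2 ^ (-3 : ℝ) := by norm_num [Real.rpow_neg]
    rw [this, ← Real.rpow_mul (by norm_num)]; norm_num
  calc _ ≤ (2 : ℝ) ^ (17 / 28 : ℝ) * 2 ^ (-(17 / 14) : ℝ) := by
        rw [h2]; gcongr
    _ = 2 ^ (-(17 / 28) : ℝ) := by rw [← Real.rpow_add (by norm_num)]; norm_num
    _ ≤ 2 ^ (-(1 / 2) : ℝ) := Real.rpow_le_rpow_of_exponent_le (by norm_num) (by norm_num)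
    _ ≤ 9 / 10 := by
      rw [Real.rpow_neg (by norm_num), ← Real.sqrt_eq_rpow]
      refine inv_le_of_inv_le₀ (by norm_num) (Real.le_sqrt_of_sq_le (by norm_num))

/-! ### Sobolev and weighted norms -/

lemma sobolevNorm_distY_le (y : WSpace N s) : sobolevNorm N 2 (distY y) ≤ ‖y.1.1‖ₑ :=
  sobolevNorm_dist_le N y.1.1

/-- The Euclidean norm of the weighted components. -/
def wnorm (y : WSpace N s) : ℝ := ‖WithLp.toLp 2 y.1.2‖

lemma wnorm_add_le (y z : WSpace N s) : wnorm (y + z) ≤ wnorm y + wnorm z :=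
  norm_add_le (WithLp.toLp 2 y.1.2) (WithLp.toLp 2 z.1.2)

lemma wnorm_smul (c : ℝ) (y : WSpace N s) : wnorm (c • y) = |c| * wnorm y :=
  norm_smul c (WithLp.toLp 2 y.1.2)

lemma wnorm_sq (y : WSpace N s) : wnorm y ^ 2 = ∑ j, ‖y.1.2 j‖ ^ 2 :=
  PiLp.norm_sq_eq_of_L2 _ _

lemma wnorm_nonneg (y : WSpace N s) : 0 ≤ wnorm y := norm_nonneg _

lemma ofReal_wnorm (y : WSpace N s) :
    ENNReal.ofReal (wnorm y) = (∑ j, ‖y.1.2 j‖ₑ ^ 2) ^ (1 / 2 : ℝ) := by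
  have h : ∑ j, ‖y.1.2 j‖ₑ ^ 2 = ENNReal.ofReal (wnorm y) ^ 2 := by
    rw [← ENNReal.ofReal_pow (wnorm_nonneg y), wnorm_sq,
      ENNReal.ofReal_sum_of_nonneg fun _ _ => by positivity]
    refine Finset.sum_congr rfl fun j _ => ?_
    rw [ENNReal.ofReal_pow (norm_nonneg _), ofReal_norm]
  rw [h, ← ENNReal.rpow_natCast, ← ENNReal.rpow_mul]
  norm_num

/-- The norm of the weighted space is a maximum over components, while the weighted norm of the
theorem is Euclidean; they differ by at most `√3 ≤ 2`. -/
lemma wnorm_le (y : WSpace N s) : wnorm y ≤ 2 * ‖y‖ := by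
  refine le_of_sq_le_sq ?_ (by positivity)
  rw [wnorm_sq]
  have h : ∀ j, ‖y.1.2 j‖ ^ 2 ≤ ‖y‖ ^ 2 := fun j => by
    gcongr; exact norm_snd_le y j
  rw [Fin.sum_univ_three]
  nlinarith [h 0, h 1, h 2, sq_nonneg ‖y‖]

variable [hNs : Exps N s]

lemma coordMul_distY (j : Fin 3) (y : WSpace N s) :
    coordMul j (distY y) = dist (wt (-s)) (y.1.2 j) :=
  (mem_WSpace_iff (by linarith [hNs.six_lt]) hNs.nonneg y.1).1 y.2 j

lemma weightedNorm_distY_le (y : WSpace N s) :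
    weightedNorm s (distY y) ≤ ENNReal.ofReal (wnorm y) := by
  rw [ofReal_wnorm, weightedNorm]
  gcongr with j
  rw [coordMul_distY]
  exact sobolevNorm_dist_le s _

lemma exists_distY_eq {T : 𝓢'(E3, ℂ)} (h1 : sobolevNorm N 2 T ≠ ∞) (h2 : weightedNorm s T ≠ ∞) :
    ∃ y : WSpace N s, distY y = T ∧ ‖y.1.1‖ₑ = sobolevNorm N 2 T ∧
      ENNReal.ofReal (wnorm y) = weightedNorm s T := by
  obtain ⟨a, ha, ha'⟩ := exists_dist_eq h1
  have h3 : ∀ j, sobolevNorm s 2 (coordMul j T) ≠ ∞ := fun j hj => h2 (by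
    have : ∑ j : Fin 3, sobolevNorm s 2 (coordMul j T) ^ 2 = ∞ :=
      ENNReal.sum_eq_top.2 ⟨j, Finset.mem_univ j, by rw [hj]; simp⟩
    rw [weightedNorm, this, ENNReal.top_rpow_of_pos (by norm_num)])
  choose b hb hb' using fun j => exists_dist_eq (h3 j)
  have hy : (a, b) ∈ WSpace N s :=
    (mem_WSpace_iff (by linarith [hNs.six_lt]) hNs.nonneg _).2 fun j => by
      rw [ha, hb j]
  refine ⟨⟨(a, b), hy⟩, ha, ha', ?_⟩
  rw [ofReal_wnorm, weightedNorm]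
  simp only [hb']

/-! ### Propagators and half waves -/

lemma temperate_ofReal_bracket {m : ℝ} (hm : 0 < m) :
    (fun ξ : E3 => (bracket m ξ : ℂ)).HasTemperateGrowth :=
  Complex.ofRealCLM.hasTemperateGrowth.comp (hasTemperateGrowth_bracket hm)

lemma propagator_distY {m : ℝ} (hm : 1 ≤ m) (t : ℝ) (y : WSpace N s) :
    propagator m t (distY y) = distY (evolY hm t y) := by
  have h := isSymbol_expSym (one_pos.trans_le hm) t
  have h1 := fourierMultiplier_dist h.temperate (temperate_wt (-N)) y.1.1
  rw [← dist_mulL2 h (temperate_wt (-N))] at h1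
  exact h1

lemma isLpFunction_distY (y : WSpace N s) : IsLpFunction 2 (distY y) (funY y) :=
  isLpFunction_dist (temperate_wt _) (bddCont_wt (by linarith [hNs.six_lt])) hNs.memLp_wt _

/-- This is `u = Re u + i ⟨D⟩_m (⟨D⟩_m⁻¹ Im u)`. -/
lemma distY_eq_halfWave {m : ℝ} (hm : 1 ≤ m) (u : WSpace N s) :
    distY u = distY (dtY u) + Complex.I • dispOp m (distY (fieldY hm u)) := by
  have hm0 := one_pos.trans_le hm
  have h1 : distY (dtY u) = ((1 / 2 : ℝ) : ℂ) • dist (wt (-N)) (u.1.1 + conjL2 u.1.1) :=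
    dist_smul _ _ _
  have hs := isSymbol_fieldSym hm
  have h2 : dispOp m (distY (fieldY hm u)) =
      (-(Complex.I / 2)) • dist (wt (-N)) (u.1.1 - conjL2 u.1.1) := by
    have e1 : distY (fieldY hm u) = dist (fun ξ => fieldSym m ξ * wt (-N) ξ)
      (u.1.1 - conjL2 u.1.1) := dist_mulL2 hs (temperate_wt _) _
    have e2 := fourierMultiplier_dist (temperate_ofReal_bracket hm0)
      (hs.temperate.mul (temperate_wt (-N))) (u.1.1 - conjL2 u.1.1)
    have e3 : (fun ξ => (bracket m ξ : ℂ) * (fieldSym m * wt (-N)) ξ) =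
        (-(Complex.I / 2)) • wt (-N) := by
      funext ξ
      have h : (bracket m ξ : ℂ) ≠ 0 := Complex.ofReal_ne_zero.2 (bracket_pos hm0 ξ).ne'
      simp only [Pi.mul_apply, Pi.smul_apply, smul_eq_mul, fieldSym, Complex.ofReal_inv]
      field_simp
    rw [e3] at e2
    rw [e1]
    refine e2.trans ?_
    ext φ
    rw [dist_apply, SchwartzMap.smulLeftCLM_smul (temperate_wt _), smul_apply, smul_apply,
      dist_apply, pairS_apply, pairS_apply, smul_eq_mul, ← integral_const_mul]
    simp only [_root_.smul_apply, smul_eq_mul, mul_assoc]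
  have h3 : u.1.1 - conjL2 u.1.1 = u.1.1 + (-1 : ℝ) • conjL2 u.1.1 := by
    rw [neg_one_smul, sub_eq_add_neg]
  rw [h1, h2, h3, dist_add, dist_add, dist_smul, smul_smul, distY]
  have h4 : Complex.I * -(Complex.I / 2) = 1 / 2 := by
    linear_combination (-1 / 2 : ℂ) * Complex.I_sq
  rw [h4]
  ext φ
  simp only [add_apply, smul_apply, smul_eq_mul]
  push_cast; ring

end

end KleinGordonEFT

/-! ### Assembling the solution and its norm. -/

namespace KleinGordonEFT

noncomputable section

variable {N s : ℝ}

/-! ### The solution norm -/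

lemma norm_fst_le_add_of_norm_sub_le {y z : WSpace N s} {ε : ℝ} (h : ‖y - z‖ ≤ ε) :
    ‖y.1.1‖ ≤ ‖z.1.1‖ + ε := by
  have h1 := norm_le_norm_add_norm_sub' y.1.1 z.1.1
  have h2 : ‖y.1.1 - z.1.1‖ ≤ ‖y - z‖ := norm_fst_le (y - z)
  linarith

lemma norm_le_fst_add_wnorm (y : WSpace N s) : ‖y‖ ≤ ‖y.1.1‖ + wnorm y := by
  have h := wnorm_nonneg y
  refine norm_WSpace_le (by linarith) fun j => ?_
  have h1 : ‖y.1.2 j‖ ≤ wnorm y := by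
    refine le_of_sq_le_sq ?_ h
    rw [wnorm_sq]
    exact Finset.single_le_sum (f := fun j => ‖y.1.2 j‖ ^ 2) (fun _ _ => by positivity)
      (Finset.mem_univ j)
  linarith [norm_nonneg y.1.1]

lemma wnorm_le_add_of_norm_sub_le {y z : WSpace N s} {ε : ℝ} (h : ‖y - z‖ ≤ ε) :
    wnorm y ≤ wnorm z + 2 * ε := by
  have h1 := wnorm_add_le z (y - z)
  rw [add_sub_cancel] at h1
  linarith [wnorm_le (y - z)]

variable [hNs : Exps N s]

lemma norm_evolY_fst {m : ℝ} (hm : 1 ≤ m) (t : ℝ) (y : WSpace N s) :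
    ‖(evolY hm t y).1.1‖ = ‖y.1.1‖ :=
  norm_mulL2_eq (isSymbol_expSym (one_pos.trans_le hm) t).bddCont (norm_expSym m t) y.1.1

lemma propagator_neg_distY {m : ℝ} (hm : 1 ≤ m) (t : ℝ) (y : WSpace N s) :
    propagator m (-t) (distY (evolY hm t y)) = distY y := by
  rw [propagator_distY hm]
  have h := evolY_neg hm (-t) y
  rw [neg_neg] at h
  rw [distY, h, distY]

lemma distY_evolY_zero {m : ℝ} (hm : 1 ≤ m) (y : WSpace N s) :
    distY (evolY hm 0 y) = distY y := by
  have h : mulL2 (expSym m 0) y.1.1 = y.1.1 := by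
    refine Lp.ext ?_
    filter_upwards [mulL2_ae (isSymbol_expSym (one_pos.trans_le hm) 0).bddCont y.1.1] with ξ hξ
    rw [hξ, expSym_zero, one_mul]
  change dist (wt (-N)) (mulL2 (expSym m 0) y.1.1) = _
  rw [h, distY]

lemma isHalfWave_light {M : ℝ} (hM : 1 ≤ M) {z : ℝ → WSpace N s × WSpace N s}
    (hz : ∀ t ∈ Icc (0 : ℝ) 1, HasDerivWithinAt z (profileField hM t (z t)) (Icc 0 1) t) :
    IsHalfWave 1 (Icc 0 1) (field N 1 (lightProf z)) fun t => distY (lightWave z t) := by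
  refine fun t ht => ⟨distY (dtY (lightWave z t)), distY (fieldY le_rfl (lightWave z t)), ?_, ?_,
    distY_eq_halfWave le_rfl _⟩
  · simp only [timeDeriv_light hM hz ht]
    exact isLpFunction_distY _
  · simp only [field_lightProf]
    exact isLpFunction_distY _

lemma isHalfWave_heavy {M : ℝ} (hM : 1 ≤ M) {z : ℝ → WSpace N s × WSpace N s}
    (hz : ∀ t ∈ Icc (0 : ℝ) 1, HasDerivWithinAt z (profileField hM t (z t)) (Icc 0 1) t) :
    IsHalfWave M (Icc 0 1) (field N M (heavyProf M z)) fun t => distY (heavyWave hM z t) := by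
  refine fun t ht => ⟨distY (dtY (heavyWave hM z t)), distY (fieldY hM (heavyWave hM z t)), ?_, ?_,
    distY_eq_halfWave hM _⟩
  · simp only [timeDeriv_heavy hM hz ht]
    exact isLpFunction_distY _
  · simp only [field_heavyProf hM]
    exact isLpFunction_distY _

/-- The factors `√M` of the norm are absorbed by `w = √M v`. The propagator is an `L²` isometry and
the weighted norm is taken of the profiles, so no growth in time appears. Decay and energy norms
contribute `9/10 + 1 = 19/10`, the weighted norms 1, and the drifts add up to `7.8 ε ≤ 8 ε`. -/
lemma XNorm_le {k M : ℝ} (hk : k + 6 ≤ N) (hs : k + 3 / 2 = s) (hM : 1 ≤ M)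
    {z : ℝ → WSpace N s × WSpace N s} {z₀ : WSpace N s × WSpace N s} {ε : ℝ} (hε : 0 ≤ ε)
    (hz : ∀ t ∈ Icc (0 : ℝ) 1, ‖z t - z₀‖ ≤ ε) :
    XNorm N k M (Icc 0 1) (fun t => distY (lightWave z t)) (fun t => distY (heavyWave hM z t)) ≤
      ENNReal.ofReal (19 / 10 * (‖z₀.1.1.1‖ + ‖z₀.2.1.1‖) + (wnorm z₀.1 + wnorm z₀.2) + 8 * ε) := by
  subst hs
  set q := Real.sqrt M
  have hq : 0 < q := Real.sqrt_pos.2 (one_pos.trans_le hM)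
  set A₁ := ‖z₀.1.1.1‖
  set A₂ := ‖z₀.2.1.1‖
  set B₁ := wnorm z₀.1
  set B₂ := wnorm z₀.2
  have hA₁ : 0 ≤ A₁ := norm_nonneg _
  have hA₂ : 0 ≤ A₂ := norm_nonneg _
  have hB₁ : 0 ≤ B₁ := wnorm_nonneg _
  have hB₂ : 0 ≤ B₂ := wnorm_nonneg _
  have hz1 : ∀ t ∈ Icc (0 : ℝ) 1, ‖(z t).1 - z₀.1‖ ≤ ε := fun t ht =>
    (_root_.norm_fst_le (z t - z₀)).trans (hz t ht)
  have hz2 : ∀ t ∈ Icc (0 : ℝ) 1, ‖(z t).2 - z₀.2‖ ≤ ε := fun t ht =>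
    (_root_.norm_snd_le (z t - z₀)).trans (hz t ht)
  have a1 : ∀ t ∈ Icc (0 : ℝ) 1, ‖(lightWave z t).1.1‖ₑ ≤ ENNReal.ofReal (A₁ + ε) := fun t ht => by
    rw [← ofReal_norm, lightWave, norm_evolY_fst]
    exact ENNReal.ofReal_le_ofReal (norm_fst_le_add_of_norm_sub_le (hz1 t ht))
  have a2 : ∀ t ∈ Icc (0 : ℝ) 1, ENNReal.ofReal q * ‖(heavyWave hM z t).1.1‖ₑ ≤
      ENNReal.ofReal (A₂ + ε) := fun t ht => by
    rw [← ofReal_norm, ← ENNReal.ofReal_mul hq.le, heavyWave, norm_evolY_fst]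
    refine ENNReal.ofReal_le_ofReal ?_
    have : ‖(q⁻¹ • (z t).2).1.1‖ = q⁻¹ * ‖(z t).2.1.1‖ := by
      change ‖q⁻¹ • (z t).2.1.1‖ = _
      rw [norm_smul, Real.norm_of_nonneg (by positivity)]
    rw [this, mul_inv_cancel_left₀ hq.ne']
    exact norm_fst_le_add_of_norm_sub_le (hz2 t ht)
  have hj : ∀ t ∈ Icc (0 : ℝ) 1, t ^ 2 ≤ 1 := fun t ht => pow_le_one₀ ht.1 ht.2
  have hj' : ∀ t ∈ Icc (0 : ℝ) 1, (t / M) ^ 2 ≤ 1 := fun t ht =>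
    pow_le_one₀ (div_nonneg ht.1 (by linarith)) (div_le_one_of_le₀ (ht.2.trans hM) (by linarith))
  have z1 : (⨆ t ∈ Icc (0 : ℝ) 1, ENNReal.ofReal (jap t ^ (1 + 3 * delta)) *
      sobolevNorm k decayExponent (distY (lightWave z t))) ≤
      ENNReal.ofReal (9 / 10 * (A₁ + ε)) := iSup₂_le fun t ht => by
    rw [ENNReal.ofReal_mul (by norm_num)]
    calc _ ≤ ENNReal.ofReal (jap t ^ (1 + 3 * delta)) *
          (ENNReal.ofReal (1 / 8) ^ (17 / 42 : ℝ) * ‖(lightWave z t).1.1‖ₑ) := by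
          gcongr; exact sobolevNorm_decay_distY_le hk _
      _ ≤ _ := by
        rw [← mul_assoc]
        exact mul_le_mul' (jap_mul_le (hj t ht)) (a1 t ht)
  have z2 : (⨆ t ∈ Icc (0 : ℝ) 1, ENNReal.ofReal (jap (t / M) ^ (1 + 3 * delta) * q) *
      sobolevNorm k decayExponent (distY (heavyWave hM z t))) ≤
      ENNReal.ofReal (9 / 10 * (A₂ + ε)) := iSup₂_le fun t ht => by
    have hjn : 0 ≤ jap (t / M) := Real.sqrt_nonneg _
    rw [ENNReal.ofReal_mul (Real.rpow_nonneg hjn _),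
      ENNReal.ofReal_mul (by norm_num : (0 : ℝ) ≤ 9 / 10)]
    calc _ ≤ ENNReal.ofReal (jap (t / M) ^ (1 + 3 * delta)) * ENNReal.ofReal q *
          (ENNReal.ofReal (1 / 8) ^ (17 / 42 : ℝ) * ‖(heavyWave hM z t).1.1‖ₑ) := by
          gcongr; exact sobolevNorm_decay_distY_le hk _
      _ = ENNReal.ofReal (jap (t / M) ^ (1 + 3 * delta)) * ENNReal.ofReal (1 / 8) ^ (17 / 42 : ℝ) *
          (ENNReal.ofReal q * ‖(heavyWave hM z t).1.1‖ₑ) := by ring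
      _ ≤ _ := mul_le_mul' (jap_mul_le (hj' t ht)) (a2 t ht)
  have s1 : (⨆ t ∈ Icc (0 : ℝ) 1, weightedNorm (k + 3 / 2)
      (propagator 1 (-t) (distY (lightWave z t)))) ≤ ENNReal.ofReal (B₁ + 2 * ε) :=
    iSup₂_le fun t ht => by
      rw [lightWave, propagator_neg_distY]
      exact (weightedNorm_distY_le _).trans
        (ENNReal.ofReal_le_ofReal (wnorm_le_add_of_norm_sub_le (hz1 t ht)))
  have s2 : ENNReal.ofReal q * (⨆ t ∈ Icc (0 : ℝ) 1, weightedNorm (k + 3 / 2)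
      (propagator M (-t) (distY (heavyWave hM z t)))) ≤ ENNReal.ofReal (B₂ + 2 * ε) := by
    simp only [ENNReal.mul_iSup]
    refine iSup₂_le fun t ht => ?_
    rw [heavyWave, propagator_neg_distY]
    refine (mul_le_mul_right (weightedNorm_distY_le _) _).trans ?_
    rw [← ENNReal.ofReal_mul hq.le, wnorm_smul, abs_of_pos (by positivity),
      mul_inv_cancel_left₀ hq.ne']
    exact ENNReal.ofReal_le_ofReal (wnorm_le_add_of_norm_sub_le (hz2 t ht))
  have n1 : (⨆ t ∈ Icc (0 : ℝ) 1, sobolevNorm N 2 (distY (lightWave z t))) ≤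
      ENNReal.ofReal (A₁ + ε) :=
    iSup₂_le fun t ht => (sobolevNorm_distY_le _).trans (a1 t ht)
  have n2 : ENNReal.ofReal q * (⨆ t ∈ Icc (0 : ℝ) 1, sobolevNorm N 2 (distY (heavyWave hM z t))) ≤
      ENNReal.ofReal (A₂ + ε) := by
    simp only [ENNReal.mul_iSup]
    exact iSup₂_le fun t ht => (mul_le_mul_right (sobolevNorm_distY_le _) _).trans (a2 t ht)
  refine (add_le_add (add_le_add (add_le_add z1 z2) (add_le_add s1 s2))
    (add_le_add n1 n2)).trans ?_
  rw [← ENNReal.ofReal_add (by positivity) (by positivity),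
    ← ENNReal.ofReal_add (by positivity) (by positivity),
    ← ENNReal.ofReal_add (by positivity) (by positivity),
    ← ENNReal.ofReal_add (by positivity) (by positivity),
    ← ENNReal.ofReal_add (by positivity) (by positivity)]
  exact ENNReal.ofReal_le_ofReal (by linarith)

/-- The data carry the weight `M` on `v₀` while the solution norm carries only `√M ≤ M`. Hence the
initial pair `(u₀, √M v₀)` has total size below `E/M`. -/
lemma exists_solution {k M E : ℝ} (hk : k + 6 ≤ N) (hs : k + 3 / 2 = s) (hE : 0 < E) (hM : 1 ≤ M)
    (hM4 : 4 * E ≤ M) (hMs : (3200 * sourceConst N s * E) ^ 2 ≤ M) {u₀ v₀ : 𝓢'(E3, ℂ)}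
    (hd : dataNorm N k M u₀ v₀ < ENNReal.ofReal (E / M)) :
    ∃ (U V : ℝ → E3 → ℝ) (u v : ℝ → 𝓢'(E3, ℂ)),
      IsSolution M (Icc 0 1) U V ∧ IsHalfWave 1 (Icc 0 1) U u ∧ IsHalfWave M (Icc 0 1) V v ∧
      u 0 = u₀ ∧ v 0 = v₀ ∧ XNorm N k M (Icc 0 1) u v < ENNReal.ofReal (2 * (E / M)) := by
  have hM0 : 0 < M := one_pos.trans_le hM
  have hdt := (hd.trans ENNReal.ofReal_lt_top).ne
  have hMe : ENNReal.ofReal M ≠ 0 := by simpa using hM0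
  simp only [dataNorm, hs, ne_eq, ENNReal.add_eq_top, ENNReal.mul_eq_top, hMe, not_or, not_and,
    not_false_eq_true, true_implies] at hdt
  obtain ⟨⟨⟨h1, h2⟩, h3⟩, h4⟩ := hdt
  obtain ⟨y, hy, hy1, hy2⟩ := exists_distY_eq (N := N) (s := s) h1 h3
  obtain ⟨w, hw, hw1, hw2⟩ := exists_distY_eq (N := N) (s := s) h2.1 h4.1
  have hd' : ‖y.1.1‖ + M * ‖w.1.1‖ + wnorm y + M * wnorm w < E / M := by
    have := wnorm_nonneg y
    have := wnorm_nonneg w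
    refine (ENNReal.ofReal_lt_ofReal_iff (by positivity)).1 (lt_of_eq_of_lt ?_ hd)
    rw [dataNorm, hs, ← hy1, ← hy2, ← hw1, ← hw2, ← ofReal_norm, ← ofReal_norm,
      ← ENNReal.ofReal_mul hM0.le, ← ENNReal.ofReal_mul hM0.le,
      ← ENNReal.ofReal_add (by positivity) (by positivity),
      ← ENNReal.ofReal_add (by positivity) (by positivity),
      ← ENNReal.ofReal_add (by positivity) (by positivity)]
  set q := Real.sqrt M with hq
  have hq1 : 1 ≤ q := Real.one_le_sqrt.2 hM
  have hqq : q * q = M := Real.mul_self_sqrt hM0.le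
  have hqM : q ≤ M := by nlinarith
  have hy0 := wnorm_nonneg y
  have hw0 := wnorm_nonneg w
  let z₀ : WSpace N s × WSpace N s := (y, q • w)
  have c1 : ‖(q • w).1.1‖ ≤ M * ‖w.1.1‖ := by
    change ‖q • w.1.1‖ ≤ _
    rw [norm_smul, Real.norm_of_nonneg (by positivity)]
    gcongr
  have c2 : wnorm (q • w) ≤ M * wnorm w := by
    rw [wnorm_smul, abs_of_pos (by positivity)]
    gcongr
  have hz₀ : ‖z₀‖ ≤ E / M := by
    refine max_le ?_ ?_
    · have := norm_le_fst_add_wnorm y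
      have : 0 ≤ M * ‖w.1.1‖ := by positivity
      have : 0 ≤ M * wnorm w := by positivity
      linarith
    · have := norm_le_fst_add_wnorm (q • w)
      have := norm_nonneg y.1.1
      linarith
  have hEM : 0 < E / M := by positivity
  -- The drift `E/(100M)` is chosen so that `19/10 + 8/100 < 2`. With `R = 2E/M`, the condition
  -- `8C√M R² ≤ ε` becomes `3200 C E √M ≤ M`, and `2R ≤ 1` becomes `4E ≤ M`.
  obtain ⟨z, hz0, hz⟩ := exists_profile hM z₀ (R := 2 * (E / M)) (ε := E / M / 100)
    (by positivity) (by linarith) (by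
      have : E / M ≤ 1 / 4 := by rw [div_le_iff₀ hM0]; linarith
      linarith) (by
      have hC := sourceConst_nonneg N s
      have h5 : 3200 * sourceConst N s * E ≤ q :=
        Real.le_sqrt_of_sq_le hMs
      have h6 : 3200 * sourceConst N s * E * q ≤ M := by rw [← hqq]; gcongr
      have e : 8 * sourceConst N s * (q * (2 * (E / M)) ^ 2) =
          (3200 * sourceConst N s * E * q) / M * (E / M / 100) := by
        field_simp; ring
      rw [← hq, e]
      exact mul_le_of_le_one_left (by positivity) (div_le_one_of_le₀ h6 hM0.le))
  have hzd := fun t ht => (hz t ht).1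
  refine ⟨_, _, _, _, isSolution_of_profile hM hzd, isHalfWave_light hM hzd,
    isHalfWave_heavy hM hzd, ?_, ?_, ?_⟩
  · change distY (evolY le_rfl 0 (z 0).1) = u₀
    rw [distY_evolY_zero, hz0, hy]
  · change distY (evolY hM 0 (q⁻¹ • (z 0).2)) = v₀
    rw [distY_evolY_zero, hz0, inv_smul_smul₀ (by positivity), hw]
  · refine (XNorm_le hk hs hM (by positivity) fun t ht => (hz t ht).2).trans_lt ?_
    refine (ENNReal.ofReal_lt_ofReal_iff (by positivity)).2 ?_
    have : 0 ≤ M * wnorm w := by positivity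
    change 19 / 10 * (‖y.1.1‖ + ‖(q • w).1.1‖) + (wnorm y + wnorm (q • w)) + 8 * (E / M / 100) < _
    linarith

end

end KleinGordonEFT

theorem mainTheorem10 (N k : ℝ) (hk : 0 ≤ k) (hN : k + 6 < N) (E : ℝ) (hE : 0 < E) :
    ∃ M₀ : ℝ, 0 < M₀ ∧ ∀ M : ℝ, M₀ ≤ M → ∀ u₀ v₀ : 𝓢'(E3, ℂ),
      dataNorm N k M u₀ v₀ < ENNReal.ofReal (E / M) →
      ∃ (I : Set ℝ) (U V : ℝ → E3 → ℝ) (u v : ℝ → 𝓢'(E3, ℂ)),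
        I.OrdConnected ∧ Icc 0 1 ⊆ I ∧
        IsSolution M I U V ∧ IsHalfWave 1 I U u ∧ IsHalfWave M I V v ∧
        u 0 = u₀ ∧ v 0 = v₀ ∧
        XNorm N k M I u v < ENNReal.ofReal (2 * (E / M)) := by
  have : Exps N (k + 3 / 2) := ⟨by linarith, by linarith, by linarith⟩
  have h1 := sq_nonneg (3200 * sourceConst N (k + 3 / 2) * E)
  -- The three summands ensure `M ≥ 1`, `2R ≤ 1` and the smallness of the drift respectively.
  refine ⟨1 + 4 * E + (3200 * sourceConst N (k + 3 / 2) * E) ^ 2, by positivity,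
    fun M hM u₀ v₀ hd => ?_⟩
  obtain ⟨U, V, u, v, h⟩ := exists_solution (N := N) (s := k + 3 / 2) hN.le rfl hE
    (by linarith) (by linarith) (by linarith) hd
  exact ⟨Icc 0 1, U, V, u, v, ordConnected_Icc, subset_rfl, h⟩
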